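/- **Setting.** Let $\mathcal S$ be a finite nonempty set, $E:\mathcal S\to\mathbb R$ injective, and for every $\beta>0$ let $p=p_\beta$ be a transition matrix on $\mathcal S$ with stationary distribution $\pi=\pi_\beta$ such that: (i) $p_\beta(s,s)>0$ for all $s$, and for $r\ne s$ one has $p_\beta(r,s)>0$ iff $r\sim s$, where $\sim$ is a connected graph (symmetric relation) on $\mathcal S$ not depending on $\beta$; (ii) there are $\gamma_\beta>0$ with $\gamma_\beta\to0$, $\beta\gamma_\beta\to\infty$ as $\beta\to\infty$ and $$e^{-\beta((E(s)-E(r))^++\gamma_\beta/|\mathcal S|)}\le p_\beta(r,s)\le e^{-\beta((E(s)-E(r))^+-\gamma_\beta/|\mathcal S|)}\qquad(r\sim s);$$ (iii) $p^*(r,s)=\lim_{\beta\to\infty}p_\beta(r,s)$ exists for all $r,s$, is positive if $E(r)\ge E(s)$ and ($r\sim s$ or $r=s$), and is $0$ if $E(r)<E(s)$; (iv) $\pi(r)p(r,s)=\pi(s)p(s,r)$. Let $X=(X_k)_{k\ge0}$ be the chain and $\mathbb P_x$ its law when started at $x$. **Saddles and metastable states.** Paths are self-avoiding paths in the graph, end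 points included. A path from $r$ to $s$ is *minimal* if its maximal energy is smallest among all paths from $r$ to $s$; $z^*(r,s)$ is the state of maximal energy on a minimal path (it does not depend on the path), and $z^*(s,s)=s$. Enumerate the local minima of $E$ as $m^{(1)},\dots,m^{(n)}$, put $M^{(i)}=\{m^{(i)},\dots,m^{(n)}\}$, and let the order be such that for each $i<n$ the state $m^{(i)}$ minimizes $\min_{m'\in M^{(i)}\setminus\{m\}}E(z^*(m,m'))-E(m)$ over $m\in M^{(i)}$ (ties broken arbitrarily). **Valleys.** For $m\in M^{(i)}$ let $V^{(i)}_<(m)=\{s: E(z^*(s,m))<E(z^*(s,m'))\ \forall m'\in M^{(i)}\setminus\{m\}\}$. Say $s\leadsto m$ at level $i$ if $E(z^*(s,m))=\min_{m'\in M^{(i)}}E(z^*(s,m'))$ and every minimal path from $s$ to any $m'\in M^{(i)}\setminus\{m\}$ with $E(z^*(s,m'))=E(z^*(s,m))$ hits $V^{(i)}_<(m)$. Let $l(j)$ be the smallest $k\in(j,n]$ with $m^{(j)}\leadsto m$ at level $k$ for some $m\in M^{(k)}$ ($\infty$ if there is none). Let $V^{(1)}(m)=\{s:s\leadsto m\text{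 at level }1\}$ and, for $2\le i\le n$, $m\in M^{(i)}$, $$V^{(i)}(m)=V^{(i-1)}(m)\cup\{s\in N^{(i-1)}:s\leadsto m\text{ at level }i\}\cup\bigcup_{j:\,l(j)=i,\ m^{(j)}\leadsto m\text{ at level }i}V^{(j)}(m^{(j)}),$$ where $N^{(i)}=\mathcal S\setminus\bigcup_{j=1}^nV^{(i\wedge j)}(m^{(j)})$ is the set of non-assigned states. Let $\mathcal M^{(i)}=\{m^{(j)}:l(j)>i\}$, $\mathcal S^{(i)}=\mathcal M^{(i)}\cup N^{(i)}$; for $s=m^{(j)}\in\mathcal M^{(i)}$ put $V^{(i)}(s)=V^{(i\wedge j)}(m^{(j)})$ and for $s\in N^{(i)}$ put $V^{(i)}(s)=\{s\}$. For $m\in\mathcal M^{(i)}$ let $s_m$ be the state of least energy outside $V^{(i)}(m)$ that is adjacent to $V^{(i)}(m)$; $E(s_m)-E(m)$ is the *depth* of $V^{(i)}(m)$. **Aggregated processes.** $\overline Y_k\in\mathcal S^{(i)}$ is the state with $X_k\in V^{(i)}(\overline Y_k)$; $\sigma_0=0$, $\sigma_{k+1}=\inf\{t>\sigma_k:\overline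 Y_t\ne\overline Y_{t-1}\}$, $Y_k=\overline Y_{\sigma_k}$. Further $\xi_0=\inf\{t\ge0:X_t\notin N^{(i)}\}$, $\zeta_0=\inf\{t\ge\xi_0:X_t\in N^{(i)}\}$, $\xi_1=\inf\{t\ge\zeta_0:X_t\notin N^{(i)}\}$. *Reciprocating jumps of order $\delta>0$* are exhibited at level $i$ if there is a set $\emptyset\ne A\subsetneq\mathcal M^{(i)}$ such that for each $m_1\in A$ there is $m_2\in A$ with $$\liminf_{\beta\to\infty}\frac1\beta\Big(\ln\mathbb P_{m_1}(X_{\xi_1}\in V^{(i)}(m_2))-\ln\mathbb P_{m_1}(X_{\xi_1}\in V^{(i)}(m))\Big)\ge\delta\quad\text{for all }m\in\mathcal M^{(i)}\setminus A,$$ with $\ln0=-\infty$ and $-\infty-(-\infty)=-\infty$. **Metabasins.** Let $\varepsilon>0$. The chain has *metabasins of order $\varepsilon$* at level $i$, $1\le i<n-1$, if for each $m\in\mathcal M^{(i)}$: (MB1) $E(z^*(m,m'))-E(s_m)\le\varepsilon$ for all $m'\in\mathcal M^{(i)}\setminus\{m\}$; (MB2) there are at least two distinct $m_1,m_2\in\mathcal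 M^{(i)}\setminus\{m\}$ such that for $k=1,2$ there is a minimal path from $s_m$ to $m_k$ along which the energy first strictly increases and then strictly decreases (one piece may be trivial) and which hits no valley $V^{(i)}(m')$, $m'\in\mathcal M^{(i)}$, other than $V^{(i)}(m_k)$. The metabasins are then the sets $V^{(i)}(s)$, $s\in\mathcal S^{(i)}$. **Theorem.** Suppose the chain has metabasins of order $\varepsilon$ at level $i$. Then: (1) Transition probabilities between metabasins asymptotically do not depend on the state of entrance. For $r,s\in\mathcal S^{(i)}$ put $\hat p(r,s)=\mathbf 1\{s=s_r\}$ if $r\in\mathcal M^{(i)}$ and $\hat p(r,s)=\frac1{1-p^*(r,r)}\sum_{x\in V^{(i)}(s),\,x\ne r}p^*(r,x)$ if $r\in N^{(i)}$. Then, as $\beta\to\infty$, $\mathbb P_x(Y_1=s)\to\hat p(r,s)$ for every $x\in V^{(i)}(r)$; and for every initial state, every $k\ge0$, every history $y_0,\dots,y_k=r$ and every entrance state $x\in V^{(i)}(r)$, both $\mathbb P(Y_{k+1}=s\mid Y_0=y_0,\dots,Y_k=y_k)\to\hat p(r,s)$ and $\mathbb P(Y_{k+1}=s\mid Y_0=y_0,\dots,Y_k=y_k,\,X_{\sigma_k}=x)\to\hat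 p(r,s)$, whenever the conditioning event has positive probability. (2) There are no reciprocating jumps of order $\delta$ at level $i$ for any $\delta>\varepsilon$; and there are none of order $\varepsilon$ if the inequality in (MB1) is strict for all $m,m'$. (3) The log-asymptotic expected residence time depends only on the depth: for $m\in\mathcal M^{(i)}$ and every $r\in V^{(i)}(m)$, $\mathbb E_r\zeta_0<\infty$ and $\lim_{\beta\to\infty}\frac1\beta\ln\mathbb E_r\zeta_0=E(s_m)-E(m)$. For a singleton metabasin $\{s\}$, $s\in N^{(i)}$, $\mathbb E_s\sigma_1<\infty$ and $\lim_{\beta\to\infty}\frac1\beta\ln\mathbb E_s\sigma_1=0$. (4) Restricted to the metabasins of local minima the system is a trap model up to $\varepsilon$: there is an energy threshold $E_0$ such that $E_0-\varepsilon\le E(s_m)\le E_0+\varepsilon$ for all $m\in\mathcal M^{(i)}$ and $E_0-\varepsilon\le E(z^*(m,m'))\le E_0+\varepsilon$ for all distinct $m,m'\in\mathcal M^{(i)}$. -/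

import Mathlib

open Filter Topology MeasureTheory ProbabilityTheory
open scoped ENNReal

noncomputable section

/-- A family (indexed by the inverse temperature `β`) of reversible Markov chains on a finite state
space, driven by an energy landscape. For `β ≤ 0` nothing is required of the family. -/
structure EnergyChain (S : Type*) [Fintype S] where
  /-- the energy function -/
  E : S → ℝ
  /-- the neighbourhood graph: `r ∼ s` iff `r ≠ s` and `p(r,s) > 0` -/
  G : SimpleGraph S
  /-- `P β r` is the row `p(r,·)` of the transition matrix at inverse temperature `β` -/
  P : ℝ → S → PMF S
  /-- the stationary distribution -/
  stat : ℝ → PMF S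
  /-- the error term `γ_β` -/
  gam : ℝ → ℝ
  /-- the limiting transition probabilities `p*(r,s)` -/
  pLim : S → S → ℝ
  connected : G.Connected
  self_pos : ∀ β > 0, ∀ s, P β s s ≠ 0
  adj_iff : ∀ β > 0, ∀ r s, r ≠ s → (P β r s ≠ 0 ↔ G.Adj r s)
  gam_pos : ∀ β > 0, 0 < gam β
  gam_tendsto : Tendsto gam atTop (𝓝 0)
  mul_gam_tendsto : Tendsto (fun β => β * gam β) atTop atTop
  lower : ∀ β > 0, ∀ r s, G.Adj r s →
    Real.exp (-β * (max (E s - E r) 0 + gam β / Fintype.card S)) ≤ (P β r s).toReal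
  upper : ∀ β > 0, ∀ r s, G.Adj r s →
    (P β r s).toReal ≤ Real.exp (-β * (max (E s - E r) 0 - gam β / Fintype.card S))
  tendsto_pLim : ∀ r s, Tendsto (fun β => (P β r s).toReal) atTop (𝓝 (pLim r s))
  pLim_pos : ∀ r s, r = s ∨ G.Adj r s → E s ≤ E r → 0 < pLim r s
  pLim_zero : ∀ r s, E r < E s → pLim r s = 0
  detailed_balance : ∀ β > 0, ∀ r s, stat β r * P β r s = stat β s * P β s r
  E_injective : Function.Injective E

namespace EnergyChain

variable {S : Type*} [Fintype S]

/-! ### Paths, saddles and local minima -/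

section Landscape

variable (C : EnergyChain S)

/-- `z` is the state of maximal energy on the path `γ` (end points included). -/
def IsPeak {r s : S} (γ : C.G.Path r s) (z : S) : Prop :=
  z ∈ γ.1.support ∧ ∀ t ∈ γ.1.support, C.E t ≤ C.E z

/-- A self-avoiding path is minimal if its maximal energy is minimal among all self-avoiding paths
with the same end points. -/
def IsMinimalPath {r s : S} (γ : C.G.Path r s) : Prop :=
  ∀ γ' : C.G.Path r s, ∀ z z', C.IsPeak γ z → C.IsPeak γ' z' → C.E z ≤ C.E z'

theorem exists_peak {r s : S} (γ : C.G.Path r s) : ∃ z, C.IsPeak γ z := by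
  classical
  obtain ⟨z, hz, h⟩ := γ.1.support.toFinset.exists_max_image C.E
    ⟨r, by simp⟩
  exact ⟨z, by simpa using hz, fun t ht => h t (by simpa using ht)⟩

theorem existsUnique_saddle (r s : S) :
    ∃! z, ∃ γ : C.G.Path r s, C.IsMinimalPath γ ∧ C.IsPeak γ z := by
  classical
  have hne : (Finset.univ.filter fun z => ∃ γ : C.G.Path r s, C.IsPeak γ z).Nonempty := by
    obtain ⟨w⟩ := C.connected.preconnected r s
    obtain ⟨z, hz⟩ := C.exists_peak w.toPath
    exact ⟨z, by simpa using ⟨w.toPath.1, w.toPath.2, hz⟩⟩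
  obtain ⟨z, hz, hmin⟩ := Finset.exists_min_image _ C.E hne
  simp only [Finset.mem_filter, Finset.mem_univ, true_and] at hz hmin
  obtain ⟨γ, hγ⟩ := hz
  refine ⟨z, ⟨γ, ?_, hγ⟩, ?_⟩
  · intro γ' y y' hy hy'
    exact (hγ.2 y hy.1).trans (hmin y' ⟨γ', hy'⟩)
  · rintro y ⟨γ', hγ', hy⟩
    exact C.E_injective (le_antisymm (hγ' γ y z hy hγ) (hmin y ⟨γ', hy⟩))

/-- The essential saddle `z*(r,s)`: the state of maximal energy on any minimal path from `r` to
`s`. In particular `z*(s,s) = s`. -/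
def saddle (r s : S) : S := (C.existsUnique_saddle r s).choose

/-- Uphill-downhill path: energies strictly increase up to some time and strictly decrease
afterwards (one of the two pieces may be trivial). -/
def IsUphillDownhill {r s : S} (γ : C.G.Path r s) : Prop :=
  ∃ j ≤ γ.1.length,
    (∀ k < j, C.E (γ.1.getVert k) < C.E (γ.1.getVert (k + 1))) ∧
    ∀ k, j ≤ k → k < γ.1.length → C.E (γ.1.getVert (k + 1)) < C.E (γ.1.getVert k)

/-- The set `M^(1)` of local minima of the energy function. -/
def localMinima : Set S := {s | ∀ r, C.G.Adj s r → C.E s < C.E r}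

/-- The outer boundary `∂⁺V`. -/
def outerBoundary (V : Set S) : Set S := {s | s ∉ V ∧ ∃ r ∈ V, C.G.Adj r s}

/-- The state of minimal energy on the outer boundary of `V` (a junk value if `∂⁺V = ∅`, that is,
if `V` is empty or everything). -/
def exitState [Nonempty S] (V : Set S) : S :=
  Classical.epsilon fun s => s ∈ C.outerBoundary V ∧ ∀ t ∈ C.outerBoundary V, C.E s ≤ C.E t

end Landscape

/-- An enumeration `m^(1), …, m^(n)` of the local minima in the order in which they are deleted to
obtain the filtration `M^(i) = {m^(i), …, m^(n)}` of metastable states: at each step a local minimum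
is deleted whose activation energy for a transition to another remaining minimum, that is
`min_{m' ≠ m} E(z*(m,m')) - E(m)`, is smallest (ties broken arbitrarily).
Only the values `m i` with `1 ≤ i ≤ n` matter. -/
structure MinimaOrder (C : EnergyChain S) where
  n : ℕ
  m : ℕ → S
  bijOn : Set.BijOn m (Set.Icc 1 n) C.localMinima
  order : ∀ i, 1 ≤ i → i < n → ∃ k, i < k ∧ k ≤ n ∧
    ∀ j j', i ≤ j → j ≤ n → i ≤ j' → j' ≤ n → j ≠ j' →
      C.E (C.saddle (m i) (m k)) - C.E (m i) ≤ C.E (C.saddle (m j) (m j')) - C.E (m j)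

namespace MinimaOrder

variable {C : EnergyChain S} (O : MinimaOrder C)

/-- The metastable states `M^(i)` at level `i`. -/
def metastable (i : ℕ) : Set S := O.m '' Set.Icc i O.n

/-- The set `V_<^(i)(m)` of states strongly attracted by `m` at level `i`. -/
def strongValley (i : ℕ) (m : S) : Set S :=
  {s | ∀ m' ∈ O.metastable i, m' ≠ m → C.E (C.saddle s m) < C.E (C.saddle s m')}

/-- `s ⇝ m` at level `i`: state `s` is attracted by `m ∈ M^(i)` at level `i`. -/
def Attracted (i : ℕ) (s m : S) : Prop :=
  m ∈ O.metastable i ∧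
  (∀ m' ∈ O.metastable i, C.E (C.saddle s m) ≤ C.E (C.saddle s m')) ∧
  ∀ m' ∈ O.metastable i, m' ≠ m → C.E (C.saddle s m') = C.E (C.saddle s m) →
    ∀ γ : C.G.Path s m', C.IsMinimalPath γ → ∃ t ∈ γ.1.support, t ∈ O.strongValley i m

/-- `l(j)`: the first level `k > j`, `k ≤ n`, at which `m^(j)` is attracted by some `m ∈ M^(k)`
(infinite if there is none). -/
def mergeLevel (j : ℕ) : ℕ∞ :=
  sInf {k : ℕ∞ | ∃ k' : ℕ, k = k' ∧ j < k' ∧ k' ≤ O.n ∧ ∃ m, O.Attracted k' (O.m j) m}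

/-- `O.valley i j` is `V^(i ∧ j)(m^(j))` for `1 ≤ j ≤ n`: the valley of `m^(j)`, which is built by
the recursion up to level `j` and frozen afterwards, `m^(j)` being no longer in `M^(i)` for `i > j`.
At level `i + 1`, the valley of `m^(j)`, `j > i`, acquires the states not assigned at level `i` and
the frozen valleys whose bottom state is first attracted at level `i + 1`. Level `0` (empty valleys)
is a convention which makes level `1` the set of states attracted at level `1`. -/
def valley : ℕ → ℕ → Set S
  | 0, _ => ∅
  | i + 1, j =>
    if j ≤ i then valley i j
    else valley i j
      ∪ {s | (∀ k, 1 ≤ k → k ≤ O.n → s ∉ valley i k) ∧ O.Attracted (i + 1) s (O.m j)}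
      ∪ {s | ∃ k, 1 ≤ k ∧ k ≤ i ∧ O.mergeLevel k = (i + 1 : ℕ) ∧
          O.Attracted (i + 1) (O.m k) (O.m j) ∧ s ∈ valley i k}

/-- The set `N^(i)` of non-assigned states at level `i`. -/
def nonAssigned (i : ℕ) : Set S := {s | ∀ k, 1 ≤ k → k ≤ O.n → s ∉ O.valley i k}

/-- The set `S^(i) \ N^(i)` of those local minima whose valleys are not yet merged into a larger
one at level `i`. -/
def metaMinima (i : ℕ) : Set S :=
  {s | ∃ j, 1 ≤ j ∧ j ≤ O.n ∧ s = O.m j ∧ (i : ℕ∞) < O.mergeLevel j}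

/-- The level `i` metastates `S^(i)`. -/
def metastates (i : ℕ) : Set S := O.metaMinima i ∪ O.nonAssigned i

/-- `V^(i)(s)` for a level `i` metastate `s`: the valley with bottom `s` if `s` is a local minimum,
and `{s}` if `s` is non-assigned. -/
def cell (i : ℕ) (s : S) : Set S :=
  {x | (∃ j, 1 ≤ j ∧ j ≤ O.n ∧ s = O.m j ∧ x ∈ O.valley i j) ∨ (s ∈ O.nonAssigned i ∧ x = s)}

/-- `s_m`: the state of minimal energy on the outer boundary of the valley `V^(i)(m)`. -/
def exit [Nonempty S] (i : ℕ) (m : S) : S := C.exitState (O.cell i m)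

/-- The transition probabilities of the asymptotic jump chain at level `i`. -/
def jumpProb [Nonempty S] (i : ℕ) (r s : S) : ℝ :=
  open scoped Classical in
  if r ∈ O.nonAssigned i then
    (∑ x : S, if x ∈ O.cell i s ∧ x ≠ r then C.pLim r x else 0) / (1 - C.pLim r r)
  else if s = O.exit i r then 1 else 0

/-! ### Aggregated processes, as functionals of a trajectory `ω : ℕ → S` -/

/-- The level `i` metastate to whose cell the state `x` belongs. -/
def toMetastate [Nonempty S] (i : ℕ) (x : S) : S :=
  Classical.epsilon fun s => s ∈ O.metastates i ∧ x ∈ O.cell i s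

/-- The aggregated chain `Ȳ^(i)`. -/
def aggregated [Nonempty S] (i : ℕ) (k : ℕ) (ω : ℕ → S) : S := O.toMetastate i (ω k)

/-- The jump times `σ_k^(i)` of the aggregated chain. -/
def jumpTime [Nonempty S] (i : ℕ) : ℕ → (ℕ → S) → ℕ∞
  | 0, _ => 0
  | k + 1, ω => sInf {t : ℕ∞ | ∃ t' : ℕ, t = (t' : ℕ∞) ∧ jumpTime i k ω < t ∧
      O.aggregated i t' ω ≠ O.aggregated i (t' - 1) ω}

/-- The position `X_{σ_k}` at the `k`-th jump time (junk on the event `σ_k = ∞`). -/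
def entrance [Nonempty S] (i : ℕ) (k : ℕ) (ω : ℕ → S) : S := ω (O.jumpTime i k ω).toNat

/-- The accelerated aggregated chain `Y^(i)` (junk on the event `σ_k = ∞`). -/
def accelerated [Nonempty S] (i : ℕ) (k : ℕ) (ω : ℕ → S) : S :=
  O.aggregated i (O.jumpTime i k ω).toNat ω

end MinimaOrder

/-- The first time `t ≥ a` with `ω t ∈ A` (infinite if there is none). -/
def hitFrom (a : ℕ∞) (A : Set S) (ω : ℕ → S) : ℕ∞ :=
  sInf {t : ℕ∞ | ∃ t' : ℕ, t = (t' : ℕ∞) ∧ a ≤ t ∧ ω t' ∈ A}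

namespace MinimaOrder

variable {C : EnergyChain S} (O : MinimaOrder C)

/-- `ζ_0`: the first exit time from a valley of level `i`. -/
def firstExit (i : ℕ) (ω : ℕ → S) : ℕ∞ :=
  hitFrom (hitFrom 0 (O.nonAssigned i)ᶜ ω) (O.nonAssigned i) ω

/-- `ξ_1`: the first time after `ζ_0` at which a valley of level `i` is entered. -/
def secondEntrance (i : ℕ) (ω : ℕ → S) : ℕ∞ :=
  hitFrom (O.firstExit i ω) (O.nonAssigned i)ᶜ ω

end MinimaOrder

/-! ### The law of the chain -/

section Law

variable [MeasurableSpace S] [MeasurableSingletonClass S] (C : EnergyChain S)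

/-- The conditional law of the `(k+1)`-st state given the first `k` steps. -/
def stepKernel (β : ℝ) (k : ℕ) : Kernel (Finset.Iic k → S) S where
  toFun h := (C.P β (h ⟨k, Finset.mem_Iic.2 le_rfl⟩)).toMeasure
  measurable' := .of_discrete

instance (β : ℝ) (k : ℕ) : IsMarkovKernel (C.stepKernel β k) :=
  ⟨fun _ => PMF.toMeasure.isProbabilityMeasure _⟩

/-- The law of the trajectory of the chain at inverse temperature `β` started at `x`, a probability
measure on `ℕ → S`. -/
def law (β : ℝ) (x : S) : Measure (ℕ → S) :=
  Kernel.traj (X := fun _ => S) (C.stepKernel β) 0 (fun _ => x)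

end Law

/-! ### Reciprocating jumps and metabasins -/

namespace MinimaOrder

variable {C : EnergyChain S} (O : MinimaOrder C)

/-- `P_m(X_{ξ_1} ∈ V^(i)(m'))`: the probability that, after leaving the valley where it starts, the
chain enters the valley of `m'` next. -/
def valleyTransition [MeasurableSpace S] [MeasurableSingletonClass S]
    (i : ℕ) (β : ℝ) (m m' : S) : ℝ≥0∞ :=
  C.law β m {ω | ∃ t : ℕ, O.secondEntrance i ω = t ∧ ω t ∈ O.cell i m'}

/-- Reciprocating jumps of order `δ` at level `i`. Logarithms of probabilities are taken in
`[-∞, ∞]`, with `log 0 = -∞` and `-∞ - (-∞) = -∞`. -/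
def ReciprocatingJumps [MeasurableSpace S] [MeasurableSingletonClass S] (i : ℕ) (δ : ℝ) : Prop :=
  ∃ A : Set S, A.Nonempty ∧ A ⊂ O.metaMinima i ∧
    ∀ m₁ ∈ A, ∃ m₂ ∈ A, ∀ m ∈ O.metaMinima i \ A,
      (δ : EReal) ≤ liminf (fun β : ℝ => ((1 / β : ℝ) : EReal) *
        (ENNReal.log (O.valleyTransition i β m₁ m₂) -
          ENNReal.log (O.valleyTransition i β m₁ m))) atTop

/-- There is a minimal uphill-downhill path from `s_m` to `m'` which hits no valley of level `i`
other than that of `m'`. -/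
def HasDirectPath [Nonempty S] (i : ℕ) (m m' : S) : Prop :=
  ∃ γ : C.G.Path (O.exit i m) m', C.IsMinimalPath γ ∧ C.IsUphillDownhill γ ∧
    ∀ m'' ∈ O.metaMinima i, m'' ≠ m' → ∀ t ∈ γ.1.support, t ∉ O.cell i m''

/-- The chain has metabasins of order `ε` at aggregation level `i`. -/
structure HasMetabasins [Nonempty S] (i : ℕ) (ε : ℝ) : Prop where
  level_pos : 1 ≤ i
  level_lt : i + 1 < O.n
  mb1 : ∀ m ∈ O.metaMinima i, ∀ m' ∈ O.metaMinima i, m' ≠ m →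
    C.E (C.saddle m m') - C.E (O.exit i m) ≤ ε
  mb2 : ∀ m ∈ O.metaMinima i, ∃ m₁ ∈ O.metaMinima i, ∃ m₂ ∈ O.metaMinima i,
    m₁ ≠ m ∧ m₂ ≠ m ∧ m₁ ≠ m₂ ∧ O.HasDirectPath i m m₁ ∧ O.HasDirectPath i m m₂

end MinimaOrder

end EnergyChain

end

/-! Everything probabilistic rests on the Green function G of the chain killed on leaving a set D. A
Dirichlet energy bound gives G(y,y) ≤ length² · w(y) / κ along any walk from y out of D whose
conductances are at least κ. Conductances w(x)p(x,x') behave like exp(-β max(E(x),E(x'))), so G(y,y)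
is at most of order exp(β(c - E(y))) if D can be left below height c (`Approx.green_self_le`).
Reversibility and the maximum principle turn this into an exit estimate: leaving D at w has
probability at most of order exp(-β(E(w) - c)) (`Approx.exitProb_le`). Conversely, exit
probabilities sum to one, which forces G(m,m) to be at least of order exp(β(c - E(m))) if all
boundary states of D have energy at least c (`Approx.le_green_self`).

The rest is the geometry of valleys. By induction on the level, the bottom of a valley can be
reached inside it without exceeding the communication height to any outside state (`reachesBottom`).
Hence valleys are closed under downhill moves, two unmerged valleys are never adjacent, and the exit
state s_m is non-assigned. The order of deletion of the minima shows that climbing out of a valley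
from any of its states costs at most the depth (`valley_depth`, `reach_exit`). Finally, from every
state of a valley the bottom is visited before the valley is left, with probability tending to one
(`funnel_valley`).

Part (1): from the bottom only s_m is a non-negligible exit, and funnelling transfers this to every
entrance state. The strong Markov property at the jump times makes the probability conditional on a
history a mixture, over entrance states, of such one-jump probabilities. Part (3): the expected
residence time is a row sum of the Green function of the valley, and the two bounds above enclose it
between exponentials with rate equal to the depth. Part (2): for any splitting of the valleys into A
and the rest, some a in A and b outside A are joined through non-assigned states by a climb from a,
at most one crossing step, and a descent to b, all below their communication height h(a,b). The
transition a → b therefore has probability at least of order exp(-β(h(a,b) - E(s_a))); comparing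
with a probability at most one bounds the order of reciprocation by h(a,b) - E(s_a), which (MB1)
controls. Part (4) follows from (MB1), the inequality E(s_m) ≤ h(m,m') and the symmetry of h. -/

/-! ### Trajectories: cylinder probabilities, first-step analysis, Markov property. -/

/-- The trajectory which starts in `x` and then follows `ω`. -/
def prepend {S : Type*} (x : S) (ω : ℕ → S) : ℕ → S
  | 0 => x
  | n + 1 => ω n

@[simp] theorem prepend_zero {S : Type*} (x : S) (ω : ℕ → S) : prepend x ω 0 = x := rfl

@[simp] theorem prepend_succ {S : Type*} (x : S) (ω : ℕ → S) (n : ℕ) :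
    prepend x ω (n + 1) = ω n := rfl

theorem measurable_prepend {S : Type*} [MeasurableSpace S] (x : S) :
    Measurable (prepend x : (ℕ → S) → ℕ → S) := by
  refine measurable_pi_iff.2 fun n => ?_
  cases n with
  | zero => exact measurable_const
  | succ n => exact measurable_pi_apply n

namespace EnergyChain

variable {S : Type*} [Fintype S]

section Trajectories

variable [MeasurableSpace S] [MeasurableSingletonClass S]

/-- A set of trajectories is determined by the coordinates up to time `n`. -/
def DeterminedBy (n : ℕ) (B : Set (ℕ → S)) : Prop :=
  ∀ ω ω' : ℕ → S, (∀ j ≤ n, ω j = ω' j) → ω ∈ B → ω' ∈ B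

/-- Finitely many coordinates with values in a finite space: the set is the preimage of a subset of
a finite discrete space. -/
theorem DeterminedBy.measurableSet {n : ℕ} {B : Set (ℕ → S)} (hB : DeterminedBy n B) :
    MeasurableSet B := by
  have h : B = Preorder.frestrictLe (π := fun _ => S) n ⁻¹'
      (Preorder.frestrictLe (π := fun _ => S) n '' B) := by
    refine Set.Subset.antisymm (Set.subset_preimage_image _ _) ?_
    rintro ω ⟨ω', hω', h⟩
    exact hB ω' ω (fun j hj => congrFun h ⟨j, Finset.mem_Iic.2 hj⟩) hω'
  rw [h]
  exact Preorder.measurable_frestrictLe n (Set.toFinite _).measurableSet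

theorem measurableSet_coord_eq (t : ℕ) (x : S) : MeasurableSet {ω : ℕ → S | ω t = x} :=
  DeterminedBy.measurableSet (n := t) fun _ _ h hω => (h t le_rfl).symm.trans hω

variable (C : EnergyChain S)

instance (β : ℝ) (x : S) : IsProbabilityMeasure (C.law β x) := by
  unfold law; infer_instance

theorem law_start (β : ℝ) (x : S) : C.law β x {ω | ω 0 = x} = 1 := by
  have h := Kernel.traj_map_frestrictLe_apply (X := fun _ => S) (κ := C.stepKernel β) 0 0
    (fun _ => x)
  rw [Kernel.partialTraj_self, Kernel.id_apply] at h
  have h2 := congrArg (fun μ => μ {f | f ⟨0, by simp⟩ = x}) h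
  rw [Measure.map_apply (by fun_prop) (Set.toFinite _).measurableSet] at h2
  rw [Measure.dirac_apply' _ (Set.toFinite _).measurableSet] at h2
  simpa [law] using h2

/-- The first n + 1 coordinates and the next one have as joint law the composition-product of the
partial trajectory with the step kernel; this is evaluated at a single point. -/
theorem law_cylinder_succ (β : ℝ) (x : S) (a : ℕ → S) (n : ℕ) :
    C.law β x {ω | ∀ j ≤ n + 1, ω j = a j} =
      C.law β x {ω | ∀ j ≤ n, ω j = a j} * C.P β (a n) (a (n + 1)) := by
  have h := Kernel.partialTraj_compProd_eq_map_traj (X := fun _ => S) (κ := C.stepKernel β)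
    (Nat.zero_le n) (x₀ := fun _ => x)
  have hms : MeasurableSet ({(fun j => a j.1, a (n + 1))} : Set ((Finset.Iic n → S) × S)) :=
    (Set.toFinite _).measurableSet
  have h2 := congrArg (fun μ => μ {((fun j => a j.1 : Finset.Iic n → S), a (n + 1))}) h
  rw [Measure.map_apply (by fun_prop) hms, Measure.compProd_apply hms] at h2
  have e1 : ∀ f : Finset.Iic n → S, C.stepKernel β n f
      (Prod.mk f ⁻¹' {((fun j => a j.1 : Finset.Iic n → S), a (n + 1))}) =
      Set.indicator {(fun j => a j.1 : Finset.Iic n → S)}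
        (fun _ => C.P β (a n) (a (n + 1))) f := by
    intro f
    by_cases hf : f = fun j => a j.1
    · subst hf
      rw [Set.indicator_of_mem (Set.mem_singleton _)]
      have : (Prod.mk (fun j => a j.1 : Finset.Iic n → S) ⁻¹'
          {((fun j => a j.1 : Finset.Iic n → S), a (n + 1))}) = {a (n + 1)} := by
        ext y; simp
      rw [this]
      simp only [stepKernel, Kernel.coe_mk]
      rw [PMF.toMeasure_apply_singleton _ _ (measurableSet_singleton _)]
    · rw [Set.indicator_of_notMem (by simpa using hf)]
      have : (Prod.mk f ⁻¹' {((fun j => a j.1 : Finset.Iic n → S), a (n + 1))}) = ∅ := by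
        ext y; simp [hf]
      rw [this, measure_empty]
  simp_rw [e1] at h2
  rw [lintegral_indicator (Set.toFinite _).measurableSet, lintegral_const,
    Measure.restrict_apply_univ, ← Kernel.traj_map_frestrictLe_apply,
    Measure.map_apply (by fun_prop) (Set.toFinite _).measurableSet, mul_comm] at h2
  unfold law
  convert h2.symm using 2
  · ext ω
    simp only [Set.mem_ofPred_eq, Set.mem_preimage, Set.mem_singleton_iff, Prod.mk.injEq,
      funext_iff, Subtype.forall, Finset.mem_Iic, Preorder.frestrictLe_apply]
    constructor
    · intro h; exact ⟨fun j hj => h j (by omega), h _ le_rfl⟩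
    · rintro ⟨h, h'⟩ j hj
      rcases Nat.lt_or_ge n j with h1 | h1
      · obtain rfl : j = n + 1 := by omega
        exact h'
      · exact h j h1
  · congr 1
    ext ω
    simp [funext_iff]

theorem law_cylinder (β : ℝ) (x : S) (a : ℕ → S) (n : ℕ) :
    C.law β x {ω | ∀ j ≤ n, ω j = a j} =
      open scoped Classical in
      if a 0 = x then ∏ j ∈ Finset.range n, C.P β (a j) (a (j + 1)) else 0 := by
  induction n with
  | zero =>
    have e : {ω : ℕ → S | ∀ j ≤ 0, ω j = a j} = {ω | ω 0 = a 0} := by ext; simp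
    rw [e]
    split_ifs with h
    · rw [h]; simpa using C.law_start β x
    · refine measure_mono_null (t := {ω | ω 0 = x}ᶜ) ?_ ?_
      · intro ω hω h'
        exact h (hω.symm.trans h')
      · rw [prob_compl_eq_zero_iff]
        · exact C.law_start β x
        · exact measurableSet_coord_eq 0 x
  | succ n ih =>
    rw [law_cylinder_succ, ih]
    split_ifs
    · rw [Finset.prod_range_succ]
    · simp

/-- Both sides agree on cylinders by the product formula, hence have the same finite-dimensional
marginals, and a projective limit of finite measures is unique. -/
theorem law_eq_sum_map (β : ℝ) (x : S) :
    C.law β x = ∑ y, C.P β x y • (C.law β y).map (prepend x) := by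
  classical
  -- Cylinders reaching at least to time one suffice, and for them removing the first coordinate
  -- leaves a cylinder.
  have hcyl : ∀ (a : ℕ → S) n, C.law β x {ω | ∀ j ≤ n + 1, ω j = a j} =
      (∑ y, C.P β x y • (C.law β y).map (prepend x)) {ω | ∀ j ≤ n + 1, ω j = a j} := by
    intro a n
    have hm : MeasurableSet {ω : ℕ → S | ∀ j ≤ n + 1, ω j = a j} :=
      DeterminedBy.measurableSet (n := n + 1)
        (fun ω ω' h hω j hj => (h j hj).symm.trans (hω j hj))
    rw [law_cylinder]
    simp only [Measure.coe_finsetSum, Finset.sum_apply, Measure.smul_apply, smul_eq_mul,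
      Measure.map_apply (measurable_prepend x) hm]
    have e : (prepend x ⁻¹' {ω : ℕ → S | ∀ j ≤ n + 1, ω j = a j}) =
        {ω | a 0 = x ∧ ∀ j ≤ n, ω j = a (j + 1)} := by
      ext ω
      simp only [Set.mem_preimage, Set.mem_ofPred_eq]
      constructor
      · intro h
        exact ⟨(h 0 (by omega)).symm, fun j hj => h (j + 1) (by omega)⟩
      · rintro ⟨h, h'⟩ j hj
        cases j with
        | zero => exact h.symm
        | succ j => exact h' j (by omega)
    rw [e]
    split_ifs with h
    · simp only [h, true_and]
      simp_rw [C.law_cylinder β _ (fun j => a (j + 1)) n]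
      simp [Finset.prod_range_succ', h, mul_comm]
    · simp [h]
  have hIic : ∀ n, (C.law β x).map (Preorder.frestrictLe (π := fun _ => S) (n + 1)) =
      (∑ y, C.P β x y • (C.law β y).map (prepend x)).map
        (Preorder.frestrictLe (π := fun _ => S) (n + 1)) := by
    intro n
    refine Measure.ext_of_singleton fun h => ?_
    rw [Measure.map_apply (by fun_prop) (measurableSet_singleton _),
      Measure.map_apply (by fun_prop) (measurableSet_singleton _)]
    have := hcyl (fun j => if hj : j ≤ n + 1 then h ⟨j, Finset.mem_Iic.2 hj⟩ else x) n
    convert this using 2 <;>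
    · ext ω
      simp only [Set.mem_preimage, Set.mem_singleton_iff, funext_iff, Subtype.forall,
        Finset.mem_Iic, Preorder.frestrictLe_apply, Set.mem_ofPred_eq]
      refine forall_congr' fun j => forall_congr' fun hj => ?_
      rw [dif_pos hj]
  have : ∀ I : Finset ℕ, (C.law β x).map (I.restrict (π := fun _ => S)) =
      (∑ y, C.P β x y • (C.law β y).map (prepend x)).map (I.restrict (π := fun _ => S)) := by
    intro I
    obtain ⟨n, hn⟩ : ∃ n, I ⊆ Finset.Iic (n + 1) :=
      ⟨I.sup id, fun j hj => Finset.mem_Iic.2 ((Finset.le_sup (f := id) hj).trans (Nat.le_succ _))⟩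
    have e : I.restrict (π := fun _ : ℕ => S) =
        Finset.restrict₂ (π := fun _ : ℕ => S) hn ∘ Preorder.frestrictLe (π := fun _ => S) (n + 1) := rfl
    rw [e, ← Measure.map_map (by fun_prop) (by fun_prop), hIic n,
      Measure.map_map (by fun_prop) (by fun_prop)]
  exact IsProjectiveLimit.unique (P := fun I : Finset ℕ =>
    (C.law β x).map (I.restrict (π := fun _ => S))) (fun _ => rfl) (fun I => (this I).symm)

/-- First step analysis. -/
theorem law_apply_eq_sum (β : ℝ) (x : S) {B : Set (ℕ → S)} (hB : MeasurableSet B) :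
    C.law β x B = ∑ y, C.P β x y * C.law β y (prepend x ⁻¹' B) := by
  conv_lhs => rw [law_eq_sum_map]
  simp [Measure.map_apply (measurable_prepend x) hB]

theorem law_congr (β : ℝ) (x : S) {A B : Set (ℕ → S)}
    (h : ∀ ω : ℕ → S, ω 0 = x → (ω ∈ A ↔ ω ∈ B)) : C.law β x A = C.law β x B := by
  refine measure_congr ?_
  have h0 : ∀ᵐ ω ∂(C.law β x), ω 0 = x := by
    rw [ae_iff, ← Set.compl_ofPred, prob_compl_eq_zero_iff]
    · exact C.law_start β x
    · exact measurableSet_coord_eq 0 x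
  filter_upwards [h0] with ω hω
  exact propext (h ω hω)

/-- The Markov property at a fixed time. -/
theorem law_inter_shift (β : ℝ) (x : S) {B : Set (ℕ → S)} (hB : MeasurableSet B) (t : ℕ) :
    ∀ (x₀ : S) {A : Set (ℕ → S)}, DeterminedBy t A →
      C.law β x₀ {ω | ω ∈ A ∧ ω t = x ∧ (fun k => ω (t + k)) ∈ B} =
        C.law β x₀ {ω | ω ∈ A ∧ ω t = x} * C.law β x B := by
  have hshift : ∀ t : ℕ, Measurable fun (ω : ℕ → S) k => ω (t + k) := fun t =>
    measurable_pi_iff.2 fun k => measurable_pi_apply _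
  have hm : ∀ t, MeasurableSet {ω : ℕ → S | ω t = x} := fun t =>
    measurableSet_coord_eq t x
  induction t with
  | zero =>
    intro x₀ A hA
    by_cases hx : x₀ = x
    · subst hx
      by_cases hA' : (fun _ => x₀) ∈ A
      · have hmem : ∀ ω : ℕ → S, ω 0 = x₀ → ω ∈ A := fun ω hω =>
          hA _ _ (fun j hj => by simp [Nat.le_zero.1 hj, hω]) hA'
        rw [C.law_congr β x₀ (B := B), C.law_congr β x₀ (A := {ω | ω ∈ A ∧ ω 0 = x₀})
          (B := Set.univ)]
        · simp
        · intro ω hω; simp [hω, hmem ω hω]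
        · intro ω hω; simp [hω, hmem ω hω]
      · have hmem : ∀ ω : ℕ → S, ω 0 = x₀ → ω ∉ A := fun ω hω h =>
          hA' (hA _ _ (fun j hj => by simp [Nat.le_zero.1 hj, hω]) h)
        rw [C.law_congr β x₀ (B := ∅), C.law_congr β x₀ (A := {ω | ω ∈ A ∧ ω 0 = x₀})
          (B := ∅)]
        · simp
        · intro ω hω; simp [hmem ω hω]
        · intro ω hω; simp [hmem ω hω]
    · rw [C.law_congr β x₀ (B := ∅), C.law_congr β x₀ (A := {ω | ω ∈ A ∧ ω 0 = x}) (B := ∅)]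
      · simp
      · intro ω hω; simp [hω, hx]
      · intro ω hω; simp [hω, hx]
  | succ t ih =>
    intro x₀ A hA
    -- First-step analysis lowers t by one: once the initial state is fixed, an event determined up
    -- to time t + 1 becomes an event of the shifted path determined up to time t.
    have hA' : DeterminedBy t (prepend x₀ ⁻¹' A) := by
      intro ω ω' h hω
      refine hA _ _ (fun j hj => ?_) hω
      cases j with
      | zero => rfl
      | succ j => exact h j (by omega)
    have hmA := hA.measurableSet
    have h1 : MeasurableSet {ω | ω ∈ A ∧ ω (t + 1) = x} := hmA.inter (hm _)
    have h2 : MeasurableSet {ω | ω ∈ A ∧ ω (t + 1) = x ∧ (fun k => ω (t + 1 + k)) ∈ B} :=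
      hmA.inter ((hm _).inter (hshift (t + 1) hB))
    rw [C.law_apply_eq_sum β x₀ h1, C.law_apply_eq_sum β x₀ h2, Finset.sum_mul]
    refine Finset.sum_congr rfl fun y _ => ?_
    rw [mul_assoc]
    congr 1
    rw [show (prepend x₀ ⁻¹' {ω | ω ∈ A ∧ ω (t + 1) = x}) =
      {ω | ω ∈ prepend x₀ ⁻¹' A ∧ ω t = x} from rfl, ← ih y hA']
    congr 1
    ext ω
    simp only [Set.mem_preimage, Set.mem_ofPred_eq, prepend_succ, Nat.add_right_comm t 1]

end Trajectories

end EnergyChain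

/-! ### Reversible chains: Dirichlet energy, Green function, exit distribution. -/

/-- A reversible stochastic matrix on a finite set which charges all edges of a connected graph. -/
structure ReversibleMatrix (S : Type*) [Fintype S] where
  p : S → S → ℝ
  w : S → ℝ
  graph : SimpleGraph S
  connected : graph.Connected
  p_nonneg : ∀ x y, 0 ≤ p x y
  sum_p : ∀ x, ∑ y, p x y = 1
  w_pos : ∀ x, 0 < w x
  balance : ∀ x y, w x * p x y = w y * p y x
  adj_pos : ∀ x y, graph.Adj x y → 0 < p x y

namespace ReversibleMatrix

variable {S : Type*} [Fintype S] (R : ReversibleMatrix S)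

theorem sum_w_mul_p (x : S) : ∑ y, R.w y * R.p y x = R.w x := by
  simp_rw [R.balance _ x, ← Finset.mul_sum, R.sum_p, mul_one]

/-- Discrete integration by parts. After expanding the square, both quadratic terms equal ∑ w f²,
one by the row sums and one by stationarity. -/
theorem energy_identity (f : S → ℝ) :
    ∑ x, ∑ y, R.w x * R.p x y * (f x - f y) ^ 2 =
      2 * ∑ x, R.w x * f x * (f x - ∑ y, R.p x y * f y) := by
  have h1 : ∑ x, ∑ y, R.w x * R.p x y * f x ^ 2 = ∑ x, R.w x * f x ^ 2 := by
    refine Finset.sum_congr rfl fun x _ => ?_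
    rw [← Finset.sum_mul, ← Finset.mul_sum, R.sum_p, mul_one]
  have h2 : ∑ x, ∑ y, R.w x * R.p x y * f y ^ 2 = ∑ x, R.w x * f x ^ 2 := by
    rw [Finset.sum_comm]
    refine Finset.sum_congr rfl fun x _ => ?_
    rw [← Finset.sum_mul, R.sum_w_mul_p]
  have h3 : ∑ x, R.w x * f x * (f x - ∑ y, R.p x y * f y) =
      ∑ x, R.w x * f x ^ 2 - ∑ x, ∑ y, R.w x * R.p x y * (f x * f y) := by
    rw [← Finset.sum_sub_distrib]
    refine Finset.sum_congr rfl fun x _ => ?_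
    rw [mul_sub, Finset.mul_sum]
    congr 1
    · ring
    · exact Finset.sum_congr rfl fun y _ => by ring
  have h4 : ∑ x, ∑ y, R.w x * R.p x y * (f x - f y) ^ 2 =
      ∑ x, ∑ y, R.w x * R.p x y * f x ^ 2 + ∑ x, ∑ y, R.w x * R.p x y * f y ^ 2 -
        2 * ∑ x, ∑ y, R.w x * R.p x y * (f x * f y) := by
    simp_rw [Finset.mul_sum, ← Finset.sum_add_distrib, ← Finset.sum_sub_distrib]
    exact Finset.sum_congr rfl fun x _ => Finset.sum_congr rfl fun y _ => by ring
  rw [h4, h3, h1, h2]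
  ring

/-- An edge contributes to the double sum of `energy_identity` in both orientations, which absorbs
the factor 2. -/
theorem edge_energy_le (f : S → ℝ) (a b : S) :
    R.w a * R.p a b * (f a - f b) ^ 2 ≤ ∑ x, R.w x * f x * (f x - ∑ y, R.p x y * f y) := by
  classical
  have hnn : ∀ x y, 0 ≤ R.w x * R.p x y * (f x - f y) ^ 2 := fun x y =>
    mul_nonneg (mul_nonneg (R.w_pos x).le (R.p_nonneg x y)) (sq_nonneg _)
  have h := R.energy_identity f
  by_cases hab : a = b
  · subst hab
    have : 0 ≤ ∑ x, ∑ y, R.w x * R.p x y * (f x - f y) ^ 2 :=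
      Finset.sum_nonneg fun x _ => Finset.sum_nonneg fun y _ => hnn x y
    simp only [sub_self]
    linarith
  · have h1 : ∀ x y, R.w x * R.p x y * (f x - f y) ^ 2 ≤
        ∑ y, R.w x * R.p x y * (f x - f y) ^ 2 := fun x y =>
      Finset.single_le_sum (f := fun y => R.w x * R.p x y * (f x - f y) ^ 2)
        (fun y _ => hnn x y) (Finset.mem_univ y)
    have h2 : ∑ x ∈ {a, b}, ∑ y, R.w x * R.p x y * (f x - f y) ^ 2 ≤
        ∑ x, ∑ y, R.w x * R.p x y * (f x - f y) ^ 2 :=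
      Finset.sum_le_sum_of_subset_of_nonneg (Finset.subset_univ _)
        fun x _ _ => Finset.sum_nonneg fun y _ => hnn x y
    rw [Finset.sum_pair hab] at h2
    have h3 := h1 a b
    have h4 := h1 b a
    have h5 : R.w b * R.p b a * (f b - f a) ^ 2 = R.w a * R.p a b * (f a - f b) ^ 2 := by
      rw [R.balance b a]; ring
    linarith

/-- A function of small energy varies by at most √(A/κ) across an edge of conductance at least κ;
the increments are added along the walk. -/
theorem walk_energy_bound (f : S → ℝ) {A κ : ℝ} (hκ : 0 < κ)
    (hA : ∑ x, R.w x * f x * (f x - ∑ y, R.p x y * f y) ≤ A) {G : SimpleGraph S} {a b : S}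
    (γ : G.Walk a b) (hγ : ∀ x ∈ γ.support, ∀ y ∈ γ.support, G.Adj x y → κ ≤ R.w x * R.p x y) :
    |f a - f b| ≤ γ.length * √(A / κ) := by
  induction γ with
  | nil => simp
  | @cons u v t h γ ih =>
    have ih := ih fun x hx y hy => hγ x (by simp [hx]) y (by simp [hy])
    have he : κ ≤ R.w u * R.p u v := hγ u (by simp) v (by simp) h
    have h1 : |f u - f v| ≤ √(A / κ) := by
      refine Real.abs_le_sqrt ?_
      rw [le_div_iff₀ hκ]
      have := (R.edge_energy_le f u v).trans hA
      nlinarith [sq_nonneg (f u - f v)]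
    have : |f u - f t| ≤ |f u - f v| + |f v - f t| := abs_sub_le _ _ _
    simp only [SimpleGraph.Walk.length_cons, Nat.cast_add, Nat.cast_one]
    linarith

/-- The transition matrix of the chain killed on leaving `D`. -/
noncomputable def killed (D : Set S) : Matrix S S ℝ :=
  open scoped Classical in fun x y => if x ∈ D ∧ y ∈ D then R.p x y else 0

variable (D : Set S)

theorem killed_nonneg (x y : S) : 0 ≤ R.killed D x y := by
  unfold killed; split_ifs
  · exact R.p_nonneg x y
  · exact le_rfl

theorem killed_le (x y : S) : R.killed D x y ≤ R.p x y := by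
  unfold killed; split_ifs
  · exact le_rfl
  · exact R.p_nonneg x y

theorem killed_balance (x y : S) : R.w x * R.killed D x y = R.w y * R.killed D y x := by
  unfold killed
  by_cases h : x ∈ D ∧ y ∈ D
  · rw [if_pos h, if_pos h.symm, R.balance]
  · rw [if_neg h, if_neg (fun h' => h h'.symm)]
    simp

variable {D} in
theorem killed_of_mem {x y : S} (hx : x ∈ D) (hy : y ∈ D) : R.killed D x y = R.p x y :=
  if_pos ⟨hx, hy⟩

variable {D} in
theorem killed_of_notMem_left {x y : S} (hx : x ∉ D) : R.killed D x y = 0 :=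
  if_neg fun h => hx h.1

variable {D} in
theorem killed_of_notMem_right {x y : S} (hy : y ∉ D) : R.killed D x y = 0 :=
  if_neg fun h => hy h.2

open scoped Classical

theorem killed_pow_nonneg (n : ℕ) (x y : S) : 0 ≤ (R.killed D ^ n) x y := by
  induction n generalizing x with
  | zero => rw [pow_zero, Matrix.one_apply]; split_ifs <;> simp
  | succ n ih =>
    rw [pow_succ', Matrix.mul_apply]
    exact Finset.sum_nonneg fun z _ => mul_nonneg (R.killed_nonneg D x z) (ih z)

theorem killed_pow_balance (n : ℕ) (x y : S) :
    R.w x * (R.killed D ^ n) x y = R.w y * (R.killed D ^ n) y x := by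
  induction n generalizing x y with
  | zero =>
    simp only [pow_zero, Matrix.one_apply]
    by_cases h : x = y
    · simp [h]
    · simp [h, Ne.symm h]
  | succ n ih =>
    have e : (R.killed D ^ (n + 1)) y x = ∑ z, (R.killed D ^ n) y z * R.killed D z x := by
      rw [pow_succ, Matrix.mul_apply]
    rw [e, pow_succ', Matrix.mul_apply, Finset.mul_sum, Finset.mul_sum]
    refine Finset.sum_congr rfl fun z _ => ?_
    rw [← mul_assoc, R.killed_balance, mul_right_comm, ih z y]
    ring

variable {D} in
theorem killed_pow_of_notMem_left {n : ℕ} {x y : S} (hx : x ∉ D) (hy : y ∈ D) :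
    (R.killed D ^ n) x y = 0 := by
  cases n with
  | zero => rw [pow_zero, Matrix.one_apply, if_neg]; rintro rfl; exact hx hy
  | succ n =>
    rw [pow_succ', Matrix.mul_apply]
    exact Finset.sum_eq_zero fun z _ => by rw [R.killed_of_notMem_left hx, zero_mul]

variable {D} in
theorem killed_pow_of_notMem_right {n : ℕ} {x y : S} (hx : x ∈ D) (hy : y ∉ D) :
    (R.killed D ^ n) x y = 0 := by
  cases n with
  | zero => rw [pow_zero, Matrix.one_apply, if_neg]; rintro rfl; exact hy hx
  | succ n =>
    rw [pow_succ, Matrix.mul_apply]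
    exact Finset.sum_eq_zero fun z _ => by rw [R.killed_of_notMem_right hy, mul_zero]

theorem sum_range_killed_pow_succ (n : ℕ) (x y : S) :
    ∑ k ∈ Finset.range (n + 1), (R.killed D ^ k) x y =
      (if x = y then 1 else 0) +
        ∑ z, R.killed D x z * ∑ k ∈ Finset.range n, (R.killed D ^ k) z y := by
  rw [Finset.sum_range_succ', add_comm, pow_zero, Matrix.one_apply]
  congr 1
  simp_rw [Finset.mul_sum]
  rw [Finset.sum_comm]
  exact Finset.sum_congr rfl fun k _ => by rw [pow_succ', Matrix.mul_apply]

variable {D}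

/-- The truncated Green function f vanishes off D and satisfies f - Pf = δ_y - Kⁿ(·,y) ≤ δ_y on D,
with K the killed matrix. Truncation is needed because convergence of the series is deduced from
this bound. -/
theorem energy_partialGreen_le {y : S} (hy : y ∈ D) (n : ℕ) :
    let f := fun x => ∑ k ∈ Finset.range n, (R.killed D ^ k) x y
    ∑ x, R.w x * f x * (f x - ∑ z, R.p x z * f z) ≤ R.w y * f y := by
  intro f
  have hf0 : ∀ x, 0 ≤ f x := fun x => Finset.sum_nonneg fun k _ => R.killed_pow_nonneg D k x y
  have hfD : ∀ x ∉ D, f x = 0 := fun x hx =>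
    Finset.sum_eq_zero fun k _ => R.killed_pow_of_notMem_left hx hy
  have key : ∀ x, R.w x * f x * (f x - ∑ z, R.p x z * f z) ≤
      if x = y then R.w y * f y else 0 := by
    intro x
    by_cases hx : x ∈ D
    · have e : ∑ z, R.p x z * f z = ∑ z, R.killed D x z * f z := by
        refine Finset.sum_congr rfl fun z _ => ?_
        by_cases hz : z ∈ D
        · rw [R.killed_of_mem hx hz]
        · rw [hfD z hz, mul_zero, mul_zero]
      have e2 := R.sum_range_killed_pow_succ D n x y
      rw [Finset.sum_range_succ] at e2
      have h0 := R.killed_pow_nonneg D n x y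
      have e3 : f x - ∑ z, R.p x z * f z ≤ if x = y then 1 else 0 := by
        rw [e]
        change f x + _ = _ + ∑ z, R.killed D x z * f z at e2
        linarith
      have h1 : 0 ≤ R.w x * f x := mul_nonneg (R.w_pos x).le (hf0 x)
      refine (mul_le_mul_of_nonneg_left e3 h1).trans ?_
      split_ifs with h
      · rw [h, mul_one]
      · rw [mul_zero]
    · rw [hfD x hx, mul_zero, zero_mul]
      split_ifs
      · exact mul_nonneg (R.w_pos y).le (hf0 y)
      · exact le_rfl
  refine (Finset.sum_le_sum fun x _ => key x).trans ?_
  simp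

/-- A self-improving estimate: a = f(y) is also f(y) - f(z), so a ≤ length · √(w(y) a / κ), and one
factor a can be cancelled after squaring. The bound is uniform in n. -/
theorem partialGreen_self_le {y z : S} (hy : y ∈ D) (hz : z ∉ D) {G : SimpleGraph S}
    (γ : G.Walk y z) {κ : ℝ} (hκ : 0 < κ)
    (hγ : ∀ x ∈ γ.support, ∀ y ∈ γ.support, G.Adj x y → κ ≤ R.w x * R.p x y) (n : ℕ) :
    ∑ k ∈ Finset.range n, (R.killed D ^ k) y y ≤ γ.length ^ 2 * R.w y / κ := by
  have h := R.walk_energy_bound _ hκ (R.energy_partialGreen_le hy n) γ hγ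
  simp only at h
  have hz0 : ∑ k ∈ Finset.range n, (R.killed D ^ k) z y = 0 :=
    Finset.sum_eq_zero fun k _ => R.killed_pow_of_notMem_left hz hy
  set a := ∑ k ∈ Finset.range n, (R.killed D ^ k) y y with ha
  have ha0 : 0 ≤ a := Finset.sum_nonneg fun k _ => R.killed_pow_nonneg D k y y
  rw [hz0, sub_zero, abs_of_nonneg ha0] at h
  rcases ha0.eq_or_lt with h0 | h0
  · rw [← h0]
    have := R.w_pos y
    positivity
  · have h2 : a ^ 2 ≤ γ.length ^ 2 * (R.w y * a / κ) := by
      calc a ^ 2 ≤ (γ.length * √(R.w y * a / κ)) ^ 2 := by gcongr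
        _ = _ := by
          rw [mul_pow, Real.sq_sqrt]
          have := R.w_pos y
          positivity
    have h3 : a * a ≤ (γ.length ^ 2 * R.w y / κ) * a := by
      calc a * a = a ^ 2 := by ring
        _ ≤ _ := h2
        _ = _ := by ring
    exact le_of_mul_le_mul_right h3 h0

theorem exists_conductance_pos : ∃ κ > 0, ∀ x y, R.graph.Adj x y → κ ≤ R.w x * R.p x y := by
  classical
  by_cases h : ∃ e : S × S, R.graph.Adj e.1 e.2
  · obtain ⟨e, he, hmin⟩ := Finset.exists_min_image
      (Finset.univ.filter fun e : S × S => R.graph.Adj e.1 e.2) (fun e => R.w e.1 * R.p e.1 e.2)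
      (by obtain ⟨e, he⟩ := h; exact ⟨e, by simpa using he⟩)
    simp only [Finset.mem_filter, Finset.mem_univ, true_and] at he hmin
    exact ⟨_, mul_pos (R.w_pos _) (R.adj_pos _ _ he), fun x y hxy => hmin (x, y) hxy⟩
  · exact ⟨1, one_pos, fun x y hxy => (h ⟨(x, y), hxy⟩).elim⟩

/-- By connectedness some walk of positive conductance leaves D from y, which bounds the partial
sums at y; a second walk, from x, carries the bound over to x. -/
theorem summable_killed_pow (hD : D ≠ Set.univ) (x : S) {y : S} (hy : y ∈ D) :
    Summable fun n => (R.killed D ^ n) x y := by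
  obtain ⟨z, hz⟩ := (Set.ne_univ_iff_exists_notMem D).1 hD
  obtain ⟨κ, hκ, hadj⟩ := R.exists_conductance_pos
  obtain ⟨γ⟩ := R.connected.preconnected y z
  obtain ⟨γ'⟩ := R.connected.preconnected x z
  have h1 := R.partialGreen_self_le hy hz γ hκ (fun x _ y _ h => hadj x y h)
  refine summable_of_sum_range_le (c := γ'.length *
    √(R.w y * (γ.length ^ 2 * R.w y / κ) / κ)) (fun n => R.killed_pow_nonneg D n x y) fun n => ?_
  have h := R.walk_energy_bound _ hκ (R.energy_partialGreen_le hy n) γ' fun x _ y _ h => hadj x y h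
  simp only at h
  have hz0 : ∑ k ∈ Finset.range n, (R.killed D ^ k) z y = 0 :=
    Finset.sum_eq_zero fun k _ => R.killed_pow_of_notMem_left hz hy
  rw [hz0, sub_zero] at h
  refine (le_abs_self _).trans (h.trans ?_)
  have := R.w_pos y
  gcongr
  exact h1 n

variable (D) in
/-- The Green function of the chain killed on leaving `D`. -/
noncomputable def green (x y : S) : ℝ := ∑' n, (R.killed D ^ n) x y

theorem green_nonneg (x y : S) : 0 ≤ R.green D x y := tsum_nonneg fun n => R.killed_pow_nonneg D n x y

theorem green_balance (x y : S) : R.w x * R.green D x y = R.w y * R.green D y x := by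
  unfold green
  rw [← tsum_mul_left, ← tsum_mul_left]
  exact tsum_congr fun n => R.killed_pow_balance D n x y

theorem green_of_notMem_left {x y : S} (hx : x ∉ D) (hy : y ∈ D) : R.green D x y = 0 := by
  unfold green; simp [R.killed_pow_of_notMem_left hx hy]

theorem green_of_notMem_right {x y : S} (hx : x ∈ D) (hy : y ∉ D) : R.green D x y = 0 := by
  unfold green; simp [R.killed_pow_of_notMem_right hx hy]

theorem green_eq_left (hD : D ≠ Set.univ) (x : S) {y : S} (hy : y ∈ D) :
    R.green D x y = (if x = y then 1 else 0) + ∑ z, R.killed D x z * R.green D z y := by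
  unfold green
  rw [(R.summable_killed_pow hD x hy).tsum_eq_zero_add, pow_zero, Matrix.one_apply]
  congr 1
  simp_rw [← tsum_mul_left]
  rw [← Summable.tsum_finsetSum fun z _ => (R.summable_killed_pow hD z hy).mul_left _]
  exact tsum_congr fun n => by rw [pow_succ', Matrix.mul_apply]

theorem green_eq_right (hD : D ≠ Set.univ) (x : S) {y : S} (hy : y ∈ D) :
    R.green D x y = (if x = y then 1 else 0) + ∑ z, R.green D x z * R.killed D z y := by
  have hs : ∀ z, Summable fun n => (R.killed D ^ n) x z * R.killed D z y := by
    intro z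
    by_cases hz : z ∈ D
    · exact (R.summable_killed_pow hD x hz).mul_right _
    · simp [R.killed_of_notMem_left hz, summable_zero]
  unfold green
  rw [(R.summable_killed_pow hD x hy).tsum_eq_zero_add, pow_zero, Matrix.one_apply]
  congr 1
  simp_rw [← tsum_mul_right]
  rw [← Summable.tsum_finsetSum fun z _ => hs z]
  exact tsum_congr fun n => by rw [pow_succ, Matrix.mul_apply]

theorem green_self_le (hD : D ≠ Set.univ) {y z : S} (hy : y ∈ D) (hz : z ∉ D)
    {G : SimpleGraph S} (γ : G.Walk y z) {κ : ℝ} (hκ : 0 < κ)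
    (hγ : ∀ x ∈ γ.support, ∀ y ∈ γ.support, G.Adj x y → κ ≤ R.w x * R.p x y) :
    R.green D y y ≤ γ.length ^ 2 * R.w y / κ :=
  (R.summable_killed_pow hD y hy).tsum_le_of_sum_range_le
    fun n => R.partialGreen_self_le hy hz γ hκ hγ n

/-- The partial sums are the iterates of the recursion started from zero, so they stay below every
nonnegative supersolution. -/
theorem green_le_of_supersolution (hD : D ≠ Set.univ) {y : S} (hy : y ∈ D) {g : S → ℝ}
    (hg0 : ∀ x, 0 ≤ g x)
    (hg : ∀ x, (if x = y then 1 else 0) + ∑ z, R.killed D x z * g z ≤ g x) (x : S) :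
    R.green D x y ≤ g x := by
  refine (R.summable_killed_pow hD x hy).tsum_le_of_sum_range_le fun n => ?_
  induction n generalizing x with
  | zero => simpa using hg0 x
  | succ n ih =>
    rw [R.sum_range_killed_pow_succ]
    refine le_trans ?_ (hg x)
    gcongr with z
    · exact R.killed_nonneg D x z
    · exact ih z

/-- Maximum principle: the Green function truncated at its value on the diagonal is still a
supersolution. -/
theorem green_le_green_self (hD : D ≠ Set.univ) {y : S} (hy : y ∈ D) (x : S) :
    R.green D x y ≤ R.green D y y := by
  refine (R.green_le_of_supersolution hD hy (g := fun x => min (R.green D x y) (R.green D y y))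
    (fun x => le_min (R.green_nonneg x y) (R.green_nonneg y y)) ?_ x).trans (min_le_right _ _)
  intro x
  have h1 : (if x = y then 1 else 0) + ∑ z, R.killed D x z * min (R.green D z y) (R.green D y y) ≤
      R.green D x y := by
    rw [R.green_eq_left hD x hy]
    gcongr with z
    · exact R.killed_nonneg D x z
    · exact min_le_left _ _
  refine le_min h1 ?_
  by_cases hxy : x = y
  · subst hxy; exact h1
  · rw [if_neg hxy, zero_add]
    calc ∑ z, R.killed D x z * min (R.green D z y) (R.green D y y)
        ≤ ∑ z, R.p x z * R.green D y y := by
          gcongr with z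
          · exact le_min (R.green_nonneg z y) (R.green_nonneg y y)
          · exact R.p_nonneg x z
          · exact R.killed_le D x z
          · exact min_le_right _ _
      _ = R.green D y y := by rw [← Finset.sum_mul, R.sum_p, one_mul]

/-- The Green function inverts identity minus killed matrix on D; this is the last-step equation
`green_eq_right` summed against f. -/
theorem green_apply (hD : D ≠ Set.univ) (f : S → ℝ) {x : S} (hx : x ∈ D) :
    ∑ y, R.green D x y * (f y - ∑ z, R.killed D y z * f z) = f x := by
  simp_rw [mul_sub, Finset.sum_sub_distrib, Finset.mul_sum]
  rw [Finset.sum_comm (f := fun y z => R.green D x y * (R.killed D y z * f z)),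
    ← Finset.sum_sub_distrib]
  have : ∀ z, R.green D x z * f z - ∑ y, R.green D x y * (R.killed D y z * f z) =
      if x = z then f z else 0 := by
    intro z
    by_cases hz : z ∈ D
    · conv_lhs => rw [R.green_eq_right hD x hz]
      simp_rw [← mul_assoc, ← Finset.sum_mul, add_mul]
      simp
    · rw [R.green_of_notMem_right hx hz, if_neg (by rintro rfl; exact hz hx)]
      simp [R.killed_of_notMem_right hz]
  simp [this]

variable (D) in
/-- The probability that the chain started in `x` is in `w` when it leaves `D`. -/
noncomputable def exitProb (x w : S) : ℝ :=
  open scoped Classical in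
  if w ∈ D then 0 else if x ∈ D then ∑ y, R.green D x y * R.p y w else if x = w then 1 else 0

theorem exitProb_nonneg (x w : S) : 0 ≤ R.exitProb D x w := by
  unfold exitProb
  split_ifs
  · exact le_rfl
  · exact Finset.sum_nonneg fun y _ => mul_nonneg (R.green_nonneg x y) (R.p_nonneg y w)
  · exact zero_le_one
  · exact le_rfl

theorem exitProb_of_mem {x w : S} (hx : x ∈ D) (hw : w ∉ D) :
    R.exitProb D x w = ∑ y, R.green D x y * R.p y w := by
  unfold exitProb; rw [if_neg hw, if_pos hx]

theorem exitProb_of_mem_right {x w : S} (hw : w ∈ D) : R.exitProb D x w = 0 := if_pos hw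

theorem exitProb_of_notMem {x w : S} (hx : x ∉ D) :
    R.exitProb D x w = if x = w then 1 else 0 := by
  unfold exitProb
  by_cases hw : w ∈ D
  · rw [if_pos hw, if_neg]; rintro rfl; exact hx hw
  · rw [if_neg hw, if_neg hx]

theorem sum_exitProb_mul (f : S → ℝ) {x : S} (hx : x ∈ D) :
    ∑ w, R.exitProb D x w * f w =
      ∑ y, R.green D x y * (∑ w, R.p y w * f w - ∑ w, R.killed D y w * f w) := by
  simp_rw [← Finset.sum_sub_distrib, Finset.mul_sum]
  rw [Finset.sum_comm]
  refine Finset.sum_congr rfl fun w _ => ?_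
  by_cases hw : w ∈ D
  · rw [R.exitProb_of_mem_right hw, zero_mul, Finset.sum_eq_zero]
    intro y _
    by_cases hy : y ∈ D
    · rw [R.killed_of_mem hy hw]; ring
    · rw [R.green_of_notMem_right hx hy, zero_mul]
  · rw [R.exitProb_of_mem hx hw, Finset.sum_mul]
    refine Finset.sum_congr rfl fun y _ => ?_
    rw [R.killed_of_notMem_right hw]; ring

/-- Optional stopping for the supermartingale f at the exit time from D, obtained algebraically from
`green_apply`. -/
theorem sum_exitProb_mul_le (hD : D ≠ Set.univ) {f : S → ℝ}
    (hf : ∀ y ∈ D, ∑ z, R.p y z * f z ≤ f y) {x : S} (hx : x ∈ D) :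
    ∑ w, R.exitProb D x w * f w ≤ f x := by
  rw [R.sum_exitProb_mul f hx, ← R.green_apply hD f hx]
  refine Finset.sum_le_sum fun y _ => ?_
  by_cases hy : y ∈ D
  · gcongr
    · exact R.green_nonneg x y
    · exact hf y hy
  · simp [R.green_of_notMem_right hx hy]

theorem sum_exitProb_mul_eq (hD : D ≠ Set.univ) {f : S → ℝ}
    (hf : ∀ y ∈ D, ∑ z, R.p y z * f z = f y) (x : S) :
    ∑ w, R.exitProb D x w * f w = f x := by
  by_cases hx : x ∈ D
  · refine le_antisymm (R.sum_exitProb_mul_le hD (fun y hy => (hf y hy).le) hx) ?_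
    have := R.sum_exitProb_mul_le hD (f := fun y => - f y)
      (fun y hy => by simp [hf y hy]) hx
    simpa using this
  · simp [R.exitProb_of_notMem hx]

theorem sum_exitProb (hD : D ≠ Set.univ) (x : S) : ∑ w, R.exitProb D x w = 1 := by
  simpa using R.sum_exitProb_mul_eq hD (f := fun _ => 1) (fun y _ => by simp [R.sum_p]) x

theorem exitProb_le_one (hD : D ≠ Set.univ) (x w : S) : R.exitProb D x w ≤ 1 := by
  rw [← R.sum_exitProb hD x]
  exact Finset.single_le_sum (f := fun w => R.exitProb D x w)
    (fun w _ => R.exitProb_nonneg x w) (Finset.mem_univ w)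

theorem sum_p_mul_exitProb (hD : D ≠ Set.univ) {x : S} (hx : x ∈ D) (w : S) :
    ∑ y, R.p x y * R.exitProb D y w = R.exitProb D x w := by
  by_cases hw : w ∈ D
  · simp [R.exitProb_of_mem_right hw]
  rw [R.exitProb_of_mem hx hw]
  have h1 : ∀ y, R.p x y * R.exitProb D y w =
      (∑ z, R.killed D x y * R.green D y z * R.p z w) + if y = w then R.p x y else 0 := by
    intro y
    by_cases hy : y ∈ D
    · rw [R.exitProb_of_mem hy hw, R.killed_of_mem hx hy, if_neg (by rintro rfl; exact hw hy),
        add_zero, Finset.mul_sum]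
      exact Finset.sum_congr rfl fun z _ => by ring
    · rw [R.exitProb_of_notMem hy, R.killed_of_notMem_right hy]
      simp
  simp_rw [h1]
  rw [Finset.sum_add_distrib, Finset.sum_comm]
  simp_rw [← Finset.sum_mul]
  have h2 : ∀ z, R.green D x z * R.p z w =
      (∑ y, R.killed D x y * R.green D y z) * R.p z w + if x = z then R.p z w else 0 := by
    intro z
    by_cases hz : z ∈ D
    · conv_lhs => rw [R.green_eq_left hD x hz]
      split_ifs <;> ring
    · rw [R.green_of_notMem_right hx hz, if_neg (by rintro rfl; exact hz hx), Finset.sum_eq_zero]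
      · simp
      · intro y _
        by_cases hy : y ∈ D
        · rw [R.green_of_notMem_right hy hz, mul_zero]
        · rw [R.killed_of_notMem_right hy, zero_mul]
  simp_rw [h2]
  rw [Finset.sum_add_distrib]
  simp

/-- Time reversal: w(x) G(x,y) p(y,w) = w(w) p(w,y) G(y,x). Then G(y,x) ≤ G(x,x) by the maximum
principle, and the row of w sums to one. -/
theorem exitProb_le (hD : D ≠ Set.univ) {x w : S} (hx : x ∈ D) (hw : w ∉ D) :
    R.exitProb D x w ≤ R.w w / R.w x * R.green D x x := by
  rw [R.exitProb_of_mem hx hw, div_mul_eq_mul_div, le_div_iff₀ (R.w_pos x), Finset.sum_mul]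
  calc ∑ y, R.green D x y * R.p y w * R.w x
      = ∑ y, R.w w * (R.p w y * R.green D y x) := by
        refine Finset.sum_congr rfl fun y _ => ?_
        rw [mul_right_comm, mul_comm (R.green D x y), R.green_balance, mul_right_comm, R.balance]
        ring
    _ ≤ ∑ y, R.w w * (R.p w y * R.green D x x) := by
        gcongr with y
        · exact (R.w_pos w).le
        · exact R.p_nonneg w y
        · exact R.green_le_green_self hD hx y
    _ = _ := by rw [← Finset.mul_sum, ← Finset.sum_mul, R.sum_p, one_mul]

/-- Decomposition at the first visit to m: G(·,m) is harmonic on D \ {m} and vanishes off D, so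
optional stopping leaves only the term at m. -/
theorem green_eq_exitProb_mul (hD : D ≠ Set.univ) {m : S} (hm : m ∈ D) (x : S) :
    R.green D x m = R.exitProb (D \ {m}) x m * R.green D m m := by
  have hD' : D \ {m} ≠ Set.univ := fun h => by
    have : m ∈ D \ {m} := h ▸ Set.mem_univ m
    exact this.2 rfl
  rw [← R.sum_exitProb_mul_eq hD' (f := fun x => R.green D x m) _ x]
  · rw [Finset.sum_eq_single m]
    · intro w _ hw
      by_cases hwD : w ∈ D
      · rw [R.exitProb_of_mem_right (D := D \ {m}) (x := x) (w := w) ⟨hwD, hw⟩, zero_mul]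
      · rw [R.green_of_notMem_left hwD hm, mul_zero]
    · simp
  · intro y hy
    have hym : y ≠ m := hy.2
    rw [R.green_eq_left hD y hm, if_neg hym, zero_add]
    refine Finset.sum_congr rfl fun z _ => ?_
    by_cases hz : z ∈ D
    · rw [R.killed_of_mem hy.1 hz]
    · rw [R.green_of_notMem_left hz hm, mul_zero, mul_zero]

end ReversibleMatrix

/-! ### Exponential estimates of Green functions and exit probabilities for large β. -/

theorem sdiff_singleton_ne_univ {S : Type*} (V : Set S) (m : S) : V \ {m} ≠ Set.univ := fun h => by
  have : m ∈ V \ {m} := h ▸ Set.mem_univ m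
  exact this.2 rfl

namespace EnergyChain

variable {S : Type*} [Fintype S] (C : EnergyChain S)

/-- Detailed balance propagates a zero along edges, hence to every state, but a probability
distribution has nonempty support. -/
theorem stat_ne_zero {β : ℝ} (hβ : 0 < β) (x : S) : C.stat β x ≠ 0 := by
  intro hx
  have h : ∀ {y : S} (_ : C.G.Walk x y), C.stat β y = 0 := by
    intro y γ
    induction γ with
    | nil => exact hx
    | @cons u v t h γ ih =>
      refine ih ?_
      have hb := C.detailed_balance β hβ u v
      rw [hx, zero_mul] at hb
      exact (mul_eq_zero.1 hb.symm).resolve_right ((C.adj_iff β hβ v u h.ne').2 h.symm)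
  obtain ⟨y, hy⟩ := (C.stat β).support_nonempty
  obtain ⟨γ⟩ := C.connected.preconnected x y
  exact ((C.stat β).mem_support_iff y).1 hy (h γ)

theorem sum_toReal_P (β : ℝ) (x : S) : ∑ y, (C.P β x y).toReal = 1 := by
  rw [← ENNReal.toReal_sum fun y _ => (C.P β x).apply_ne_top y, ← tsum_fintype (L := .unconditional S),
    PMF.tsum_coe, ENNReal.toReal_one]

/-- The transition matrix at inverse temperature `β > 0`. -/
noncomputable def revOfPos {β : ℝ} (hβ : 0 < β) : ReversibleMatrix S where
  p x y := (C.P β x y).toReal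
  w x := (C.stat β x).toReal
  graph := C.G
  connected := C.connected
  p_nonneg _ _ := ENNReal.toReal_nonneg
  sum_p := C.sum_toReal_P β
  w_pos x := ENNReal.toReal_pos (C.stat_ne_zero hβ x) ((C.stat β).apply_ne_top x)
  balance x y := by
    rw [← ENNReal.toReal_mul, C.detailed_balance β hβ, ENNReal.toReal_mul]
  adj_pos x y h := ENNReal.toReal_pos ((C.adj_iff β hβ x y h.ne).2 h) ((C.P β x).apply_ne_top y)

/-- The transition matrix at inverse temperature `β`, with a default for `β ≤ 0`. -/
noncomputable def rev (β : ℝ) : ReversibleMatrix S :=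
  if h : 0 < β then C.revOfPos h else C.revOfPos one_pos

theorem rev_p {β : ℝ} (hβ : 0 < β) (x y : S) : (C.rev β).p x y = (C.P β x y).toReal := by
  rw [rev, dif_pos hβ]; rfl

theorem rev_p_eq_zero {β : ℝ} (hβ : 0 < β) {x y : S} (hxy : x ≠ y) (h : ¬ C.G.Adj x y) :
    (C.rev β).p x y = 0 := by
  rw [C.rev_p hβ, ENNReal.toReal_eq_zero_iff]
  exact Or.inl (by_contra fun h' => h ((C.adj_iff β hβ x y hxy).1 h'))

theorem tendsto_rev_p (x y : S) :
    Tendsto (fun β => (C.rev β).p x y) atTop (𝓝 (C.pLim x y)) := by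
  refine (C.tendsto_pLim x y).congr' ?_
  filter_upwards [eventually_gt_atTop 0] with β hβ
  rw [C.rev_p hβ]

/-- At `β`, transition probabilities and stationary weights agree with those of the Metropolis
chain up to factors `exp (± β η)`. -/
structure Approx (η β : ℝ) : Prop where
  pos : 0 < β
  le_p : ∀ r s, C.G.Adj r s → Real.exp (-β * (max (C.E s - C.E r) 0 + η)) ≤ (C.rev β).p r s
  w_le : ∀ r s, (C.rev β).w r ≤ (C.rev β).w s * Real.exp (β * (C.E s - C.E r + η))

/-- Detailed balance with the lower bound for p(r,s) and the upper bound for p(s,r): the difference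
of the two positive parts is exactly E(s) - E(r), and each bound costs one error γ/|S|. -/
theorem w_le_of_adj {β : ℝ} (hβ : 0 < β) {r s : S} (h : C.G.Adj r s) :
    (C.rev β).w r ≤
      (C.rev β).w s * Real.exp (β * (C.E s - C.E r + 2 * (C.gam β / Fintype.card S))) := by
  have hb := (C.rev β).balance r s
  have hl := C.lower β hβ r s h
  have hu := C.upper β hβ s r h.symm
  rw [← C.rev_p hβ] at hl hu
  have hw := (C.rev β).w_pos r
  have hw' := (C.rev β).w_pos s
  have h1 : (C.rev β).w r * Real.exp (-β * (max (C.E s - C.E r) 0 + C.gam β / Fintype.card S)) ≤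
      (C.rev β).w s * Real.exp (-β * (max (C.E r - C.E s) 0 - C.gam β / Fintype.card S)) :=
    (mul_le_mul_of_nonneg_left hl hw.le).trans
      (hb.le.trans (mul_le_mul_of_nonneg_left hu hw'.le))
  have h2 : Real.exp (β * (C.E s - C.E r + 2 * (C.gam β / Fintype.card S))) =
      Real.exp (-β * (max (C.E r - C.E s) 0 - C.gam β / Fintype.card S)) /
        Real.exp (-β * (max (C.E s - C.E r) 0 + C.gam β / Fintype.card S)) := by
    rw [← Real.exp_sub]
    congr 1
    have : max (C.E s - C.E r) 0 - max (C.E r - C.E s) 0 = C.E s - C.E r := by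
      rcases le_total (C.E s) (C.E r) with h | h
      · rw [max_eq_right (by linarith), max_eq_left (by linarith)]; ring
      · rw [max_eq_left (by linarith), max_eq_right (by linarith)]; ring
    linear_combination (-β) * this
  rw [h2, ← mul_div_assoc, le_div_iff₀ (Real.exp_pos _)]
  exact h1

theorem w_le_of_walk {β : ℝ} (hβ : 0 < β) {r s : S} (γ : C.G.Walk r s) :
    (C.rev β).w r ≤ (C.rev β).w s *
      Real.exp (β * (C.E s - C.E r + γ.length * (2 * (C.gam β / Fintype.card S)))) := by
  induction γ with
  | nil => simp
  | @cons u v t h γ ih =>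
    refine (C.w_le_of_adj hβ h).trans ((mul_le_mul_of_nonneg_right ih (Real.exp_pos _).le).trans ?_)
    rw [mul_assoc, ← Real.exp_add]
    refine mul_le_mul_of_nonneg_left (Real.exp_le_exp.2 ?_) ((C.rev β).w_pos t).le
    rw [SimpleGraph.Walk.length_cons]
    push_cast
    linarith

theorem eventually_approx {η : ℝ} (hη : 0 < η) : ∀ᶠ β in atTop, C.Approx η β := by
  classical
  -- A self-avoiding path has fewer than |S| edges, so the errors 2γ/|S| per edge add up to at most
  -- 2γ; this is why γ < η/2 is required.
  filter_upwards [eventually_gt_atTop 0,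
    C.gam_tendsto.eventually (gt_mem_nhds (show (0 : ℝ) < η / 2 by linarith))] with β hβ hγ
  have hN : ∀ _ : S, (1 : ℝ) ≤ Fintype.card S := fun r => by
    exact_mod_cast Fintype.card_pos_iff.2 ⟨r⟩
  have hg := C.gam_pos β hβ
  refine ⟨hβ, fun r s h => ?_, fun r s => ?_⟩
  · rw [C.rev_p hβ]
    refine le_trans (Real.exp_le_exp.2 ?_) (C.lower β hβ r s h)
    have h1 : C.gam β / Fintype.card S ≤ η := by
      have := div_le_self hg.le (hN r)
      linarith
    nlinarith
  · obtain ⟨γ⟩ := C.connected.preconnected r s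
    refine (C.w_le_of_walk hβ γ.toPath.1).trans ?_
    refine mul_le_mul_of_nonneg_left (Real.exp_le_exp.2 ?_) ((C.rev β).w_pos s).le
    have h1 : (γ.toPath.1.length : ℝ) * (C.gam β / Fintype.card S) ≤ C.gam β := by
      rw [← mul_div_assoc, div_le_iff₀ (by linarith [hN r]), mul_comm]
      have : (γ.toPath.1.length : ℝ) ≤ Fintype.card S := by
        exact_mod_cast γ.toPath.2.length_lt.le
      exact mul_le_mul_of_nonneg_left this hg.le
    refine mul_le_mul_of_nonneg_left ?_ hβ.le
    linarith

/-- `y` can be reached from `x` through states in `A`. -/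
def Reach (A : Set S) (x y : S) : Prop := ∃ γ : C.G.Walk x y, ∀ t ∈ γ.support, t ∈ A

section Green

open scoped Classical

variable {C} {D : Set S} {η β : ℝ}

/-- The conductance of an edge below height c is at least w(y) exp(-β(c - E(y))) up to error, since
climbing to x and then along the edge costs at most c - E(y). Loop erasure bounds the length of the
walk by |S|. -/
theorem Approx.green_self_le (h : C.Approx η β) {y z : S} (hy : y ∈ D) (hz : z ∉ D) {c : ℝ}
    (hr : C.Reach {t | C.E t ≤ c} y z) :
    (C.rev β).green D y y ≤ Fintype.card S ^ 2 * Real.exp (β * (c - C.E y + 2 * η)) := by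
  obtain ⟨γ, hγ⟩ := hr
  have hD : D ≠ Set.univ := fun h => hz (h ▸ Set.mem_univ z)
  have hw := (C.rev β).w_pos y
  have hγ' : ∀ t ∈ γ.bypass.support, C.E t ≤ c := fun t ht =>
    hγ t (γ.support_bypass_subset_support ht)
  refine ((C.rev β).green_self_le hD hy hz γ.bypass
    (κ := (C.rev β).w y * Real.exp (-(β * (c - C.E y + 2 * η)))) (by positivity) ?_).trans ?_
  · intro x hx x' hx' hadj
    have h1 := h.w_le y x
    have h2 := h.le_p x x' hadj
    have h3 : Real.exp (-(β * (c - C.E y + 2 * η))) ≤ Real.exp (-(β * (C.E x - C.E y + η))) *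
        Real.exp (-β * (max (C.E x' - C.E x) 0 + η)) := by
      rw [← Real.exp_add]
      refine Real.exp_le_exp.2 ?_
      have : max (C.E x' - C.E x) 0 ≤ c - C.E x :=
        max_le (by linarith [hγ' x' hx']) (by linarith [hγ' x hx])
      have := mul_le_mul_of_nonneg_left this h.pos.le
      linarith
    have h4 : (C.rev β).w y * Real.exp (-(β * (C.E x - C.E y + η))) ≤ (C.rev β).w x := by
      rw [Real.exp_neg, ← div_eq_mul_inv, div_le_iff₀ (Real.exp_pos _)]
      exact h1
    calc _ ≤ (C.rev β).w y * (Real.exp (-(β * (C.E x - C.E y + η))) *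
        Real.exp (-β * (max (C.E x' - C.E x) 0 + η))) := mul_le_mul_of_nonneg_left h3 hw.le
      _ = (C.rev β).w y * Real.exp (-(β * (C.E x - C.E y + η))) *
        Real.exp (-β * (max (C.E x' - C.E x) 0 + η)) := by ring
      _ ≤ _ := mul_le_mul h4 h2 (Real.exp_pos _).le ((C.rev β).w_pos x).le
  · rw [Real.exp_neg, mul_div_assoc, div_mul_cancel_left₀ hw.ne', inv_inv]
    have : (γ.bypass.length : ℝ) ≤ Fintype.card S := by
      exact_mod_cast (γ.bypass_isPath).length_lt.le
    gcongr

/-- In w(w)/w(x) · G(x,x) the energy of x cancels, so only the gap between the exit state and the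
escape height c remains. -/
theorem Approx.exitProb_le (h : C.Approx η β) {x z w : S} (hx : x ∈ D) (hz : z ∉ D) {c : ℝ}
    (hr : C.Reach {t | C.E t ≤ c} x z) (hw : w ∉ D) :
    (C.rev β).exitProb D x w ≤ Fintype.card S ^ 2 * Real.exp (β * (c - C.E w + 3 * η)) := by
  have hD : D ≠ Set.univ := fun h => hz (h ▸ Set.mem_univ z)
  refine ((C.rev β).exitProb_le hD hx hw).trans ?_
  have h1 : (C.rev β).w w / (C.rev β).w x ≤ Real.exp (β * (C.E x - C.E w + η)) := by
    rw [div_le_iff₀ ((C.rev β).w_pos x), mul_comm]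
    exact h.w_le w x
  refine (mul_le_mul h1 (h.green_self_le hx hz hr) ((C.rev β).green_nonneg x x)
    (Real.exp_pos _).le).trans (le_of_eq ?_)
  rw [mul_left_comm, ← Real.exp_add]
  congr 2
  ring

/-- The exit probabilities sum to one, yet each is at most of order exp(-β(c - E(m))) · G(m,m): the
chain must return to m often enough to make an exit at height c likely. -/
theorem Approx.le_green_self (h : C.Approx η β) (hD : D ≠ Set.univ) {m : S} (hm : m ∈ D) {c : ℝ}
    (hc : ∀ y ∈ D, ∀ w ∉ D, C.G.Adj y w → c ≤ C.E w) :
    Real.exp (β * (c - C.E m - η)) ≤ Fintype.card S * (C.rev β).green D m m := by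
  have hG := (C.rev β).green_nonneg (D := D) m m
  have key : ∀ w, (C.rev β).exitProb D m w ≤
      Real.exp (-(β * (c - C.E m - η))) * (C.rev β).green D m m := by
    intro w
    by_cases hw : w ∈ D
    · rw [(C.rev β).exitProb_of_mem_right hw]; positivity
    by_cases hadj : ∃ y ∈ D, C.G.Adj y w
    · obtain ⟨y, hy, hyw⟩ := hadj
      refine ((C.rev β).exitProb_le hD hm hw).trans (mul_le_mul_of_nonneg_right ?_ hG)
      rw [div_le_iff₀ ((C.rev β).w_pos m), mul_comm]
      refine (h.w_le w m).trans
        (mul_le_mul_of_nonneg_left (Real.exp_le_exp.2 ?_) ((C.rev β).w_pos m).le)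
      have := mul_le_mul_of_nonneg_left (hc y hy w hw hyw) h.pos.le
      linarith
    · rw [(C.rev β).exitProb_of_mem hm hw, Finset.sum_eq_zero]
      · positivity
      · intro y _
        by_cases hy : y ∈ D
        · rw [C.rev_p_eq_zero h.pos (ne_of_mem_of_not_mem hy hw) (fun h' => hadj ⟨y, hy, h'⟩),
            mul_zero]
        · rw [(C.rev β).green_of_notMem_right hm hy, zero_mul]
  have hsum : 1 ≤ Fintype.card S *
      (Real.exp (-(β * (c - C.E m - η))) * (C.rev β).green D m m) := by
    calc 1 = ∑ w, (C.rev β).exitProb D m w := ((C.rev β).sum_exitProb hD m).symm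
      _ ≤ ∑ w : S, Real.exp (-(β * (c - C.E m - η))) * (C.rev β).green D m m :=
        Finset.sum_le_sum fun w _ => key w
      _ = _ := by simp
  have := mul_le_mul_of_nonneg_left hsum (Real.exp_pos (β * (c - C.E m - η))).le
  rw [mul_one] at this
  refine this.trans (le_of_eq ?_)
  rw [mul_left_comm, ← mul_assoc (Real.exp _) (Real.exp _), ← Real.exp_add]
  simp

variable (C)

theorem tendsto_const_mul_exp_neg (K : ℝ) {a : ℝ} (ha : 0 < a) :
    Tendsto (fun β : ℝ => K * Real.exp (-(a * β))) atTop (𝓝 0) := by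
  have h : Tendsto (fun β : ℝ => Real.exp (-(a * β))) atTop (𝓝 0) :=
    Real.tendsto_exp_neg_atTop_nhds_zero.comp (tendsto_id.const_mul_atTop ha)
  simpa using h.const_mul K

theorem tendsto_exitProb_zero {x z w : S} (hx : x ∈ D) (hz : z ∉ D) {c : ℝ}
    (hr : C.Reach {t | C.E t ≤ c} x z) (hw : w ∉ D) (hc : c < C.E w) :
    Tendsto (fun β => (C.rev β).exitProb D x w) atTop (𝓝 0) := by
  refine squeeze_zero' (.of_forall fun β => (C.rev β).exitProb_nonneg x w) ?_
    (tendsto_const_mul_exp_neg (Fintype.card S ^ 2) (a := (C.E w - c) / 2) (by linarith))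
  filter_upwards [C.eventually_approx (η := (C.E w - c) / 6) (by linarith)] with β h
  refine (h.exitProb_le hx hz hr hw).trans (le_of_eq ?_)
  congr 2
  ring

/-- Started in `x`, the chain visits `m` before leaving `V` with probability tending to `1`. -/
def Funnel (V : Set S) (m x : S) : Prop :=
  Tendsto (fun β => (C.rev β).exitProb (V \ {m}) x m) atTop (𝓝 1)

theorem funnel_self (V : Set S) (m : S) : C.Funnel V m m := by
  have : ∀ β, (C.rev β).exitProb (V \ {m}) m m = 1 := fun β => by
    rw [(C.rev β).exitProb_of_notMem (fun h => h.2 rfl), if_pos rfl]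
  simp [Funnel, this]

/-- The probability of missing m is harmonic on V \ {m}, so it can be averaged over the exit
distribution of D; each term has a factor tending to zero and a bounded one. -/
theorem funnel_of_exit {V : Set S} {m x : S} (hD : D ⊆ V \ {m})
    (h : ∀ w ∉ D, Tendsto (fun β => (C.rev β).exitProb D x w) atTop (𝓝 0) ∨ C.Funnel V m w) :
    C.Funnel V m x := by
  have hV := sdiff_singleton_ne_univ V m
  have hD' : D ≠ Set.univ := fun h => hV (Set.univ_subset_iff.1 (h ▸ hD))
  have hf : ∀ β, 1 - (C.rev β).exitProb (V \ {m}) x m =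
      ∑ w, (C.rev β).exitProb D x w * (1 - (C.rev β).exitProb (V \ {m}) w m) := by
    intro β
    simp_rw [mul_sub, mul_one, Finset.sum_sub_distrib, (C.rev β).sum_exitProb hD']
    rw [(C.rev β).sum_exitProb_mul_eq hD']
    exact fun y hy => (C.rev β).sum_p_mul_exitProb hV (hD hy) m
  have hlim : Tendsto (fun β => 1 - (C.rev β).exitProb (V \ {m}) x m) atTop (𝓝 0) := by
    simp_rw [hf]
    rw [← Finset.sum_const_zero (s := (Finset.univ : Finset S))]
    refine tendsto_finsetSum _ fun w _ => ?_
    by_cases hw : w ∈ D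
    · simp [(C.rev _).exitProb_of_mem_right hw]
    · have h0 : ∀ β, 0 ≤ 1 - (C.rev β).exitProb (V \ {m}) w m := fun β =>
        sub_nonneg.2 ((C.rev β).exitProb_le_one hV w m)
      have h1 : ∀ β, 1 - (C.rev β).exitProb (V \ {m}) w m ≤ 1 := fun β =>
        sub_le_self _ ((C.rev β).exitProb_nonneg w m)
      have h2 : ∀ β, 0 ≤ (C.rev β).exitProb D x w := fun β => (C.rev β).exitProb_nonneg x w
      rcases h w hw with h | h
      · refine squeeze_zero (fun β => mul_nonneg (h2 β) (h0 β)) (fun β => ?_) h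
        exact mul_le_of_le_one_right (h2 β) (h1 β)
      · have h' := h.const_sub 1
        rw [sub_self] at h'
        refine squeeze_zero (fun β => mul_nonneg (h2 β) (h0 β)) (fun β => ?_) h'
        exact mul_le_of_le_one_left (h0 β) ((C.rev β).exitProb_le_one hD' x w)
  simpa [Funnel] using hlim.const_sub 1

/-- Once m is visited, the chain from x continues like the chain from m; the exit laws can differ
only on the event that V is left without visiting m. -/
theorem abs_exitProb_sub_le {V : Set S} (hV : V ≠ Set.univ) {m : S} (x w : S) (β : ℝ) :
    |(C.rev β).exitProb V x w - (C.rev β).exitProb V m w| ≤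
      1 - (C.rev β).exitProb (V \ {m}) x m := by
  have hD := sdiff_singleton_ne_univ V m
  have hf := (C.rev β).sum_exitProb_mul_eq hD (f := fun y => (C.rev β).exitProb V y w)
    (fun y hy => (C.rev β).sum_p_mul_exitProb hV hy.1 w) x
  have h1 := (C.rev β).sum_exitProb hD x
  have e : (C.rev β).exitProb V x w - (C.rev β).exitProb V m w =
      ∑ u, (C.rev β).exitProb (V \ {m}) x u *
        ((C.rev β).exitProb V u w - (C.rev β).exitProb V m w) := by
    simp_rw [mul_sub, Finset.sum_sub_distrib, ← Finset.sum_mul, h1, one_mul]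
    rw [hf]
  have e2 : 1 - (C.rev β).exitProb (V \ {m}) x m =
      ∑ u ∈ Finset.univ.erase m, (C.rev β).exitProb (V \ {m}) x u := by
    rw [← h1, ← Finset.sum_erase_add _ _ (Finset.mem_univ m)]; ring
  rw [e, e2, ← Finset.sum_erase_add _ _ (Finset.mem_univ m), sub_self, mul_zero, add_zero]
  refine (Finset.abs_sum_le_sum_abs _ _).trans (Finset.sum_le_sum fun u _ => ?_)
  rw [abs_mul, abs_of_nonneg ((C.rev β).exitProb_nonneg x u)]
  refine mul_le_of_le_one_right ((C.rev β).exitProb_nonneg x u) (abs_le.2 ⟨?_, ?_⟩)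
  · linarith [(C.rev β).exitProb_le_one hV m w, (C.rev β).exitProb_nonneg (D := V) u w]
  · linarith [(C.rev β).exitProb_le_one hV u w, (C.rev β).exitProb_nonneg (D := V) m w]

/-- From m, the set V can be left without exceeding E(s), and by injectivity of E every other
boundary state is strictly higher, hence negligible. The funnel property replaces m by x. -/
theorem tendsto_exitProb_one {V : Set S} {m s x : S} (hm : m ∈ V) (hs : s ∉ V)
    (hr : C.Reach {t | C.E t ≤ C.E s} m s)
    (hmin : ∀ y ∈ V, ∀ w ∉ V, C.G.Adj y w → C.E s ≤ C.E w) (hx : C.Funnel V m x) :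
    Tendsto (fun β => (C.rev β).exitProb V x s) atTop (𝓝 1) := by
  have hV : V ≠ Set.univ := fun h => hs (h ▸ Set.mem_univ s)
  have h0 : ∀ w, w ≠ s → Tendsto (fun β => (C.rev β).exitProb V m w) atTop (𝓝 0) := by
    intro w hws
    by_cases hw : w ∈ V
    · simp [(C.rev _).exitProb_of_mem_right hw]
    by_cases hadj : ∃ y ∈ V, C.G.Adj y w
    · obtain ⟨y, hy, hyw⟩ := hadj
      exact C.tendsto_exitProb_zero hm hs hr hw
        (lt_of_le_of_ne (hmin y hy w hw hyw) fun h => hws (C.E_injective h).symm)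
    · refine Tendsto.congr' ?_ tendsto_const_nhds
      filter_upwards [eventually_gt_atTop 0] with β hβ
      rw [(C.rev β).exitProb_of_mem hm hw, Finset.sum_eq_zero]
      intro y _
      by_cases hy : y ∈ V
      · rw [C.rev_p_eq_zero hβ (ne_of_mem_of_not_mem hy hw) (fun h' => hadj ⟨y, hy, h'⟩), mul_zero]
      · rw [(C.rev β).green_of_notMem_right hm hy, zero_mul]
  have h1 : Tendsto (fun β => (C.rev β).exitProb V m s) atTop (𝓝 1) := by
    have e : ∀ β, (C.rev β).exitProb V m s =
        1 - ∑ w ∈ Finset.univ.erase s, (C.rev β).exitProb V m w := fun β => by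
      rw [← (C.rev β).sum_exitProb hV m, ← Finset.sum_erase_add _ _ (Finset.mem_univ s)]; ring
    have : Tendsto (fun β => 1 - ∑ w ∈ Finset.univ.erase s, (C.rev β).exitProb V m w) atTop
        (𝓝 (1 - ∑ w ∈ Finset.univ.erase s, (0 : ℝ))) :=
      (tendsto_finsetSum _ fun w hw => h0 w (Finset.ne_of_mem_erase hw)).const_sub 1
    simp only [Finset.sum_const_zero, sub_zero] at this
    exact this.congr fun β => (e β).symm
  have h2 := Tendsto.const_sub 1 hx
  rw [sub_self] at h2
  have h3 := squeeze_zero (fun β => abs_nonneg _) (C.abs_exitProb_sub_le hV (m := m) x s) h2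
  have h4 := (tendsto_zero_iff_abs_tendsto_zero _).2 h3
  simpa using h4.add h1

theorem tendsto_log_div {f : ℝ → ℝ} {c K₁ K₂ : ℝ} (hK₁ : 0 < K₁) (hK₂ : 0 < K₂)
    (hl : ∀ η > 0, ∀ᶠ β in atTop, K₁ * Real.exp (β * (c - η)) ≤ f β)
    (hu : ∀ η > 0, ∀ᶠ β in atTop, f β ≤ K₂ * Real.exp (β * (c + η))) :
    Tendsto (fun β => 1 / β * Real.log (f β)) atTop (𝓝 c) := by
  rw [Metric.tendsto_atTop']
  intro ε hε
  have hK : ∀ K : ℝ, ∀ᶠ β : ℝ in atTop, |Real.log K / β| < ε / 2 := fun K => by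
    have : Tendsto (fun β : ℝ => Real.log K / β) atTop (𝓝 0) := tendsto_const_nhds.div_atTop tendsto_id
    have := this.abs
    rw [abs_zero] at this
    exact this.eventually (gt_mem_nhds (half_pos hε))
  have : ∀ᶠ β : ℝ in atTop, dist (1 / β * Real.log (f β)) c < ε := by
    filter_upwards [hl (ε / 2) (half_pos hε), hu (ε / 2) (half_pos hε), hK K₁, hK K₂,
      eventually_gt_atTop 0] with β h1 h2 h3 h4 hβ
    have hf : 0 < f β := lt_of_lt_of_le (by positivity) h1
    have h5 := Real.log_le_log (by positivity) h1
    have h6 := Real.log_le_log hf h2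
    rw [Real.log_mul hK₁.ne' (Real.exp_pos _).ne', Real.log_exp] at h5
    rw [Real.log_mul hK₂.ne' (Real.exp_pos _).ne', Real.log_exp] at h6
    have h7 := mul_le_mul_of_nonneg_left h5 (one_div_pos.2 hβ).le
    have h8 := mul_le_mul_of_nonneg_left h6 (one_div_pos.2 hβ).le
    have e1 : 1 / β * (Real.log K₁ + β * (c - ε / 2)) = Real.log K₁ / β + (c - ε / 2) := by
      field_simp
    have e2 : 1 / β * (Real.log K₂ + β * (c + ε / 2)) = Real.log K₂ / β + (c + ε / 2) := by
      field_simp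
    rw [e1] at h7
    rw [e2] at h8
    rw [Real.dist_eq, abs_lt]
    rw [abs_lt] at h3 h4
    constructor <;> linarith [h3.1, h3.2, h4.1, h4.2]
  obtain ⟨a, ha⟩ := (this.and (eventually_gt_atTop 0)).exists_forall_of_atTop
  exact ⟨a, fun β hβ => (ha β hβ.le).1⟩

end Green

end EnergyChain

namespace EnergyChain

variable {S : Type*} [Fintype S] {C : EnergyChain S}

/-! ### Reachability and communication heights -/

section Reach

variable {A B : Set S} {x y z : S}

theorem Reach.refl (hx : x ∈ A) : C.Reach A x x := ⟨.nil, by simpa using hx⟩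

theorem Reach.symm (h : C.Reach A x y) : C.Reach A y x := by
  obtain ⟨γ, hγ⟩ := h
  exact ⟨γ.reverse, fun t ht => hγ t (by simpa using ht)⟩

theorem Reach.trans (h : C.Reach A x y) (h' : C.Reach A y z) : C.Reach A x z := by
  obtain ⟨γ, hγ⟩ := h
  obtain ⟨γ', hγ'⟩ := h'
  refine ⟨γ.append γ', fun t ht => ?_⟩
  rcases (SimpleGraph.Walk.mem_support_append_iff _ _).1 ht with h | h
  exacts [hγ t h, hγ' t h]

theorem Reach.mono (h : C.Reach A x y) (hAB : A ⊆ B) : C.Reach B x y := by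
  obtain ⟨γ, hγ⟩ := h
  exact ⟨γ, fun t ht => hAB (hγ t ht)⟩

theorem Reach.left_mem (h : C.Reach A x y) : x ∈ A := by
  obtain ⟨γ, hγ⟩ := h
  exact hγ x γ.start_mem_support

theorem Reach.right_mem (h : C.Reach A x y) : y ∈ A := h.symm.left_mem

theorem reach_of_adj (h : C.G.Adj x y) (hx : x ∈ A) (hy : y ∈ A) : C.Reach A x y := by
  refine ⟨.cons h .nil, fun t ht => ?_⟩
  simp only [SimpleGraph.Walk.support_cons, SimpleGraph.Walk.support_nil, List.mem_cons,
    List.not_mem_nil, or_false] at ht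
  rcases ht with rfl | rfl
  exacts [hx, hy]

theorem reach_of_mem_support {γ : C.G.Walk x y} (hγ : ∀ t ∈ γ.support, t ∈ A) {u : S}
    (hu : u ∈ γ.support) : C.Reach A x u ∧ C.Reach A u y := by
  classical
  exact ⟨⟨γ.takeUntil u hu, fun t ht => hγ t (γ.support_takeUntil_subset_support hu ht)⟩,
    ⟨γ.dropUntil u hu, fun t ht => hγ t (γ.support_dropUntil_subset_support hu ht)⟩⟩

/-- A walk in `A` stays in the component of its end points. -/
theorem Reach.in_component (h : C.Reach A x y) :
    C.Reach {u | C.Reach A x u ∧ C.Reach A u y} x y := by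
  obtain ⟨γ, hγ⟩ := h
  exact ⟨γ, fun t ht => reach_of_mem_support hγ ht⟩

theorem Reach.avoid_or_hit (h : C.Reach A x y) (B : Set S) :
    C.Reach (A \ B) x y ∨ ∃ t ∈ B, C.Reach A x t ∧ C.Reach A t y := by
  obtain ⟨γ, hγ⟩ := h
  by_cases hB : ∃ t ∈ γ.support, t ∈ B
  · obtain ⟨t, ht, htB⟩ := hB
    exact Or.inr ⟨t, htB, reach_of_mem_support hγ ht⟩
  · exact Or.inl ⟨γ, fun t ht => ⟨hγ t ht, fun h => hB ⟨t, ht, h⟩⟩⟩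

theorem Reach.exists_first_hit (h : C.Reach A x y) (hx : x ∉ B) (hy : y ∈ B) :
    ∃ u t, C.Reach (A \ B) x u ∧ C.G.Adj u t ∧ t ∈ B ∧ C.Reach A t y := by
  obtain ⟨γ, hγ⟩ := h
  induction γ with
  | nil => exact (hx hy).elim
  | @cons a b c hab γ ih =>
    have ha : a ∈ A := hγ a (by simp)
    have hγ' : ∀ t ∈ γ.support, t ∈ A := fun t ht => hγ t (by simp [ht])
    by_cases hb : b ∈ B
    · exact ⟨a, b, .refl (A := A \ B) ⟨ha, hx⟩, hab, hb, ⟨γ, hγ'⟩⟩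
    · obtain ⟨u, t, h1, h2, h3, h4⟩ := ih hb hy hγ'
      exact ⟨u, t, (reach_of_adj (A := A \ B) hab ⟨ha, hx⟩ h1.left_mem).trans h1, h2, h3, h4⟩

end Reach

section Height

variable (C)

/-- The communication height of two states: the energy of their essential saddle. -/
noncomputable def height (x y : S) : ℝ := C.E (C.saddle x y)

theorem saddle_spec (x y : S) :
    ∃ γ : C.G.Path x y, C.IsMinimalPath γ ∧ C.IsPeak γ (C.saddle x y) :=
  (C.existsUnique_saddle x y).choose_spec.1

variable {C}

/-- Communication heights are connectivity thresholds of sublevel sets. Loop erasure passes from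
walks to self-avoiding paths, so that minimal paths can henceforth be treated by reachability. -/
theorem height_le_iff {x y : S} {c : ℝ} : C.height x y ≤ c ↔ C.Reach {t | C.E t ≤ c} x y := by
  classical
  obtain ⟨γ, hmin, hp⟩ := C.saddle_spec x y
  constructor
  · exact fun h => ⟨γ.1, fun t ht => (hp.2 t ht).trans h⟩
  · rintro ⟨γ', hγ'⟩
    obtain ⟨z, hz⟩ := C.exists_peak γ'.toPath
    exact (hmin γ'.toPath _ z hp hz).trans (hγ' z (γ'.support_bypass_subset_support hz.1))

theorem reach_height (x y : S) : C.Reach {t | C.E t ≤ C.height x y} x y := height_le_iff.1 le_rfl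

theorem isMinimalPath_iff {x y : S} (γ : C.G.Path x y) :
    C.IsMinimalPath γ ↔ ∀ t ∈ γ.1.support, C.E t ≤ C.height x y := by
  constructor
  · intro h t ht
    obtain ⟨z, hz⟩ := C.exists_peak γ
    obtain ⟨γ', -, hp⟩ := C.saddle_spec x y
    exact (hz.2 t ht).trans (h γ' z _ hz hp)
  · intro h γ' z z' hz hz'
    exact (h z hz.1).trans (height_le_iff.2 ⟨γ'.1, hz'.2⟩)

theorem height_comm (x y : S) : C.height x y = C.height y x :=
  le_antisymm (height_le_iff.2 (reach_height y x).symm) (height_le_iff.2 (reach_height x y).symm)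

theorem left_le_height (x y : S) : C.E x ≤ C.height x y := (reach_height x y).left_mem

theorem right_le_height (x y : S) : C.E y ≤ C.height x y := (reach_height x y).right_mem

theorem height_self (x : S) : C.height x x = C.E x :=
  le_antisymm (height_le_iff.2 (.refl (Set.mem_ofPred_eq ▸ le_rfl))) (left_le_height x x)

theorem height_le_trans {x y z : S} {c : ℝ} (h : C.height x y ≤ c) (h' : C.height y z ≤ c) :
    C.height x z ≤ c :=
  height_le_iff.2 ((height_le_iff.1 h).trans (height_le_iff.1 h'))

theorem height_le_max (x y z : S) : C.height x z ≤ max (C.height x y) (C.height y z) :=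
  height_le_trans (le_max_left _ _) (le_max_right _ _)

theorem height_le_of_adj {x y : S} {c : ℝ} (h : C.G.Adj x y) (hx : C.E x ≤ c) (hy : C.E y ≤ c) :
    C.height x y ≤ c :=
  height_le_iff.2 (reach_of_adj h hx hy)

theorem lt_height_of_mem_localMinima {x y : S} (hx : x ∈ C.localMinima) (hxy : x ≠ y) :
    C.E x < C.height x y := by
  refine lt_of_not_ge fun h => ?_
  obtain ⟨γ, hγ⟩ := height_le_iff.1 h
  cases γ with
  | nil => exact hxy rfl
  | cons h' γ => exact absurd (hx _ h') (not_lt.2 (hγ _ (by simp)))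

end Height

/-! ### Strong valleys and attraction. -/

namespace MinimaOrder

variable {O : C.MinimaOrder}

theorem mem_strongValley {i : ℕ} {m s : S} :
    s ∈ O.strongValley i m ↔ ∀ m' ∈ O.metastable i, m' ≠ m → C.height s m < C.height s m' :=
  Iff.rfl

/-- The height satisfies the ultrametric inequality: if x were as close to a competitor m' as to m,
then m', being no higher from m than t is, would be as close to t as m is. -/
theorem strongValley_of_height_le {i : ℕ} {m t x : S} (ht : t ∈ O.strongValley i m)
    (h : C.height m x ≤ C.height m t) : x ∈ O.strongValley i m := by
  intro m' hm' hne
  change C.height x m < C.height x m'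
  by_contra! h'
  have h1 : C.height m m' ≤ C.height m t :=
    height_le_trans h (h'.trans (by rw [height_comm]; exact h))
  have h2 : C.height t m' ≤ C.height t m :=
    height_le_trans le_rfl (by rw [height_comm t m]; exact h1)
  exact absurd (ht m' hm' hne) (not_lt.2 h2)

theorem height_lt_of_notMem_strongValley {i : ℕ} {m t x : S} (ht : t ∈ O.strongValley i m)
    (hx : x ∉ O.strongValley i m) : C.height m t < C.height m x :=
  lt_of_not_ge fun h => hx (strongValley_of_height_le ht h)

theorem reach_strongValley {i : ℕ} {m t : S} (ht : t ∈ O.strongValley i m) :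
    C.Reach ({u | C.E u ≤ C.height t m} ∩ O.strongValley i m) t m := by
  refine (reach_height t m).in_component.mono fun u hu => ⟨hu.1.right_mem, ?_⟩
  refine strongValley_of_height_le ht ?_
  rw [height_comm m u, height_comm m t]
  exact height_le_iff.2 hu.2

theorem m_mem_localMinima {j : ℕ} (h1 : 1 ≤ j) (hn : j ≤ O.n) : O.m j ∈ C.localMinima :=
  O.bijOn.mapsTo ⟨h1, hn⟩

theorem m_injective {j k : ℕ} (h1 : 1 ≤ j) (hn : j ≤ O.n) (h1' : 1 ≤ k) (hn' : k ≤ O.n)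
    (h : O.m j = O.m k) : j = k :=
  O.bijOn.injOn ⟨h1, hn⟩ ⟨h1', hn'⟩ h

theorem m_mem_metastable {i j : ℕ} (hij : i ≤ j) (hn : j ≤ O.n) : O.m j ∈ O.metastable i :=
  ⟨j, ⟨hij, hn⟩, rfl⟩

theorem metastable_subset_localMinima {i : ℕ} (hi : 1 ≤ i) :
    O.metastable i ⊆ C.localMinima := by
  rintro _ ⟨j, hj, rfl⟩
  exact m_mem_localMinima (hi.trans hj.1) hj.2

theorem self_mem_strongValley {i : ℕ} {m : S} (hm : m ∈ C.localMinima) :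
    m ∈ O.strongValley i m := by
  intro m' _ hne
  change C.height m m < C.height m m'
  rw [height_self]
  exact lt_height_of_mem_localMinima hm hne.symm

/-- A walk to m' below the height of s and m already forces equality of the two heights, so the
clause on minimal paths becomes non-reachability outside the strong valley. -/
theorem attracted_iff {i : ℕ} {s m : S} : O.Attracted i s m ↔ m ∈ O.metastable i ∧
    (∀ m' ∈ O.metastable i, C.height s m ≤ C.height s m') ∧
    ∀ m' ∈ O.metastable i, m' ≠ m →
      ¬ C.Reach ({u | C.E u ≤ C.height s m} \ O.strongValley i m) s m' := by
  classical
  refine and_congr_right fun hm => and_congr_right fun hmin => forall_congr' fun m' =>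
    forall_congr' fun hm' => forall_congr' fun hne => ?_
  constructor
  · rintro h ⟨γ, hγ⟩
    have hγ' : ∀ t ∈ γ.toPath.1.support, t ∈ {u | C.E u ≤ C.height s m} \ O.strongValley i m :=
      fun t ht => hγ t (γ.support_bypass_subset_support ht)
    have he : C.height s m' = C.height s m :=
      le_antisymm (height_le_iff.2 ⟨γ, fun t ht => (hγ t ht).1⟩) (hmin m' hm')
    obtain ⟨t, ht, ht'⟩ := h he γ.toPath
      ((isMinimalPath_iff _).2 fun t ht => (hγ' t ht).1.trans he.ge)
    exact (hγ' t ht).2 ht'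
  · intro h he γ hγ
    by_contra! hno
    rw [isMinimalPath_iff] at hγ
    exact h ⟨γ.1, fun t ht => ⟨(hγ t ht).trans (le_of_eq he), hno t ht⟩⟩

theorem attracted_of_mem_strongValley {i : ℕ} {s m : S} (hm : m ∈ O.metastable i)
    (hs : s ∈ O.strongValley i m) : O.Attracted i s m := by
  refine attracted_iff.2 ⟨hm, fun m' hm' => ?_, fun m' hm' hne h => h.left_mem.2 hs⟩
  by_cases hne : m' = m
  · rw [hne]
  · exact (hs m' hm' hne).le

/-- Two attracting minima have the same height from s and disjoint strong valleys. A walk from s to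
m below that height enters one of the two valleys first; continuing inside it to its minimum avoids
the other valley, against attraction by the other minimum. -/
theorem Attracted.unique {i : ℕ} (hi : 1 ≤ i) {s m m' : S} (h : O.Attracted i s m)
    (h' : O.Attracted i s m') : m = m' := by
  by_contra hne
  rw [attracted_iff] at h h'
  have he : C.height s m = C.height s m' := le_antisymm (h.2.1 _ h'.1) (h'.2.1 _ h.1)
  have hdisj : ∀ t ∈ O.strongValley i m, t ∉ O.strongValley i m' := fun t ht ht' =>
    lt_asymm (ht m' h'.1 (Ne.symm hne)) (ht' m h.1 hne)
  have hm := self_mem_strongValley (O := O) (i := i) (metastable_subset_localMinima hi h.1)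
  have key : ∀ {m m'}, O.strongValley i m ∩ O.strongValley i m' = ∅ → C.height s m = C.height s m' →
      ¬ C.Reach ({u | C.E u ≤ C.height s m'} \ O.strongValley i m') s m → ∀ u t,
      C.Reach ({u | C.E u ≤ C.height s m} \ (O.strongValley i m ∪ O.strongValley i m')) s u →
      C.G.Adj u t → t ∈ O.strongValley i m → C.Reach {u | C.E u ≤ C.height s m} t m → False := by
    intro m m' hd he hno u t hu hut ht htm
    refine hno ((hu.mono fun v hv => ?_).trans ((reach_of_adj hut ?_ ?_).trans
      ((reach_strongValley ht).mono fun v hv => ?_)))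
    · exact ⟨hv.1.trans he.le, fun h => hv.2 (Or.inr h)⟩
    · exact ⟨hu.right_mem.1.trans he.le, fun h => hu.right_mem.2 (Or.inr h)⟩
    · exact ⟨htm.left_mem.trans he.le, fun h => (Set.ext_iff.1 hd t).1 ⟨ht, h⟩⟩
    · exact ⟨(hv.1.trans (height_le_iff.2 htm)).trans he.le,
        fun h => (Set.ext_iff.1 hd v).1 ⟨hv.2, h⟩⟩
  have hd : O.strongValley i m ∩ O.strongValley i m' = ∅ :=
    Set.eq_empty_of_forall_notMem fun t ht => hdisj t ht.1 ht.2
  by_cases hs : s ∈ O.strongValley i m ∪ O.strongValley i m'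
  · rcases hs with hs | hs
    · exact absurd (hs m' h'.1 (Ne.symm hne)) (not_lt.2 (h'.2.1 _ h.1))
    · exact absurd (hs m h.1 hne) (not_lt.2 (h.2.1 _ h'.1))
  · obtain ⟨u, t, hu, hut, ht, htm⟩ := (reach_height s m).exists_first_hit hs (Or.inl hm)
    rcases ht with ht | ht
    · exact key hd he (h'.2.2 m h.1 hne) u t hu hut ht htm
    · refine key (Set.inter_comm _ _ ▸ hd) he.symm (h.2.2 m' h'.1 (Ne.symm hne)) u t
        (hu.mono fun v hv => ⟨hv.1.trans he.le, fun h => hv.2 h.symm⟩) hut ht ?_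
      refine height_le_iff.1 (height_le_trans (y := s) ?_ le_rfl)
      rw [← he]
      refine height_le_trans (height_le_iff.2 htm) ?_
      rw [height_comm]

/-- Attraction is inherited along paths below the communication height which avoid the strong
valley. -/
theorem Attracted.of_reach {i : ℕ} {y m x : S} (h : O.Attracted i y m)
    (hr : C.Reach ({u | C.E u ≤ C.height y m} \ O.strongValley i m) y x) : O.Attracted i x m := by
  have h' := attracted_iff.1 h
  have hxm : C.height x m ≤ C.height y m :=
    height_le_trans (height_le_iff.2 (hr.symm.mono fun u hu => hu.1)) le_rfl
  have hit : ∀ m' ∈ O.metastable i, m' ≠ m → ∀ {c}, c ≤ C.height y m →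
      C.Reach {u | C.E u ≤ c} x m' → ∃ t ∈ O.strongValley i m,
        C.Reach {u | C.E u ≤ c} x t ∧ C.Reach {u | C.E u ≤ c} t m' := by
    intro m' hm' hne c hc hr'
    rcases hr'.avoid_or_hit (O.strongValley i m) with h1 | h1
    · exact (h'.2.2 m' hm' hne (hr.trans (h1.mono fun u hu => ⟨hu.1.trans hc, hu.2⟩))).elim
    · exact h1
  refine attracted_iff.2 ⟨h'.1, fun m' hm' => ?_, fun m' hm' hne hr' => ?_⟩
  · by_cases hne : m' = m
    · rw [hne]
    by_contra! hlt
    obtain ⟨t, ht, h1, h2⟩ := hit m' hm' hne (hlt.le.trans hxm) (reach_height x m')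
    refine absurd hlt (not_lt.2 (height_le_trans (height_le_iff.2 h1) ?_))
    exact (ht m' hm' hne).le.trans (height_le_iff.2 h2)
  · exact h'.2.2 m' hm' hne (hr.trans (hr'.mono fun u hu => ⟨hu.1.trans hxm, hu.2⟩))

end MinimaOrder

end EnergyChain

namespace EnergyChain

variable {S : Type*} [Fintype S] {C : EnergyChain S}

namespace MinimaOrder

variable {O : C.MinimaOrder}

/-! ### The recursion for the valleys -/

theorem mem_valley_succ {i j : ℕ} {s : S} : s ∈ O.valley (i + 1) j ↔ s ∈ O.valley i j ∨
    i < j ∧ (s ∈ O.nonAssigned i ∧ O.Attracted (i + 1) s (O.m j) ∨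
      ∃ k, 1 ≤ k ∧ k ≤ i ∧ O.mergeLevel k = (i + 1 : ℕ) ∧
        O.Attracted (i + 1) (O.m k) (O.m j) ∧ s ∈ O.valley i k) := by
  rw [valley]
  split_ifs with h
  · simp [not_lt.2 h]
  · simp only [not_le.1 h, true_and, Set.mem_union, Set.mem_ofPred_eq, or_assoc]
    rfl

theorem valley_mono {i i' : ℕ} (h : i ≤ i') (j : ℕ) : O.valley i j ⊆ O.valley i' j := by
  induction i', h using Nat.le_induction with
  | base => exact subset_rfl
  | succ k _ ih => exact ih.trans fun s hs => mem_valley_succ.2 (Or.inl hs)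

theorem valley_of_le {i j : ℕ} (h : j ≤ i) : O.valley i j = O.valley j j := by
  induction i, h using Nat.le_induction with
  | base => rfl
  | succ k hk ih => rw [valley, if_pos hk, ih]

theorem valley_eq_min (i j : ℕ) : O.valley i j = O.valley (min i j) j := by
  rcases le_total i j with h | h
  · rw [min_eq_left h]
  · rw [min_eq_right h, valley_of_le h]

theorem lt_mergeLevel (j : ℕ) : (j : ℕ∞) < O.mergeLevel j := by
  unfold mergeLevel
  refine lt_of_lt_of_le (ENat.natCast_lt_natCast.2 (Nat.lt_succ_self j)) (le_sInf ?_)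
  rintro k ⟨k', rfl, h, -⟩
  exact ENat.natCast_le_natCast.2 h

theorem mergeLevel_le {j k : ℕ} {m : S} (hjk : j < k) (hk : k ≤ O.n)
    (h : O.Attracted k (O.m j) m) : O.mergeLevel j ≤ k :=
  sInf_le ⟨k, rfl, hjk, hk, m, h⟩

theorem exists_attracted_of_mergeLevel_eq {j k : ℕ} (h : O.mergeLevel j = k) :
    j < k ∧ k ≤ O.n ∧ ∃ l, k ≤ l ∧ l ≤ O.n ∧ O.Attracted k (O.m j) (O.m l) := by
  have hne : {k : ℕ∞ | ∃ k' : ℕ, k = k' ∧ j < k' ∧ k' ≤ O.n ∧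
      ∃ m, O.Attracted k' (O.m j) m}.Nonempty := by
    by_contra h'
    rw [Set.not_nonempty_iff_eq_empty] at h'
    rw [mergeLevel, h', sInf_empty] at h
    exact ENat.top_ne_natCast k h
  have := csInf_mem hne
  rw [← mergeLevel, h] at this
  obtain ⟨k', hk', h1, h2, m, hm⟩ := this
  obtain rfl : k = k' := ENat.natCast_inj.1 hk'
  obtain ⟨l, hl, rfl⟩ := hm.1
  exact ⟨h1, h2, l, hl.1, hl.2, hm⟩

theorem mergeLevel_eq_succ {i j : ℕ} (h : (i : ℕ∞) < O.mergeLevel j)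
    (h' : ¬ ((i + 1 : ℕ) : ℕ∞) < O.mergeLevel j) : O.mergeLevel j = (i + 1 : ℕ) :=
  le_antisymm (not_lt.1 h') (by push_cast; exact Order.add_one_le_of_lt h)

theorem bottom_mem_valley {i j : ℕ} (hi : 1 ≤ i) (hj : 1 ≤ j) (hn : j ≤ O.n) :
    O.m j ∈ O.valley i j := by
  refine valley_mono hi j (mem_valley_succ.2 (Or.inr ⟨hj, Or.inl ⟨fun k _ _ h => h, ?_⟩⟩))
  exact attracted_of_mem_strongValley (m_mem_metastable hj hn)
    (self_mem_strongValley (m_mem_localMinima hj hn))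

/-- Distinct valleys which are not yet merged are disjoint. -/
theorem valley_disjoint (i : ℕ) : ∀ {j j' : ℕ} {y : S}, 1 ≤ j → j ≤ O.n → 1 ≤ j' → j' ≤ O.n →
    (i : ℕ∞) < O.mergeLevel j → (i : ℕ∞) < O.mergeLevel j' →
    y ∈ O.valley i j → y ∈ O.valley i j' → j = j' := by
  induction i with
  | zero => intro j j' y _ _ _ _ _ _ h; exact h.elim
  | succ i ih =>
    have hlt : ∀ {j}, ((i + 1 : ℕ) : ℕ∞) < O.mergeLevel j → (i : ℕ∞) < O.mergeLevel j :=
      fun h => lt_trans (ENat.natCast_lt_natCast.2 (Nat.lt_succ_self i)) h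
    have hlt' : ∀ {k}, O.mergeLevel k = (i + 1 : ℕ) → (i : ℕ∞) < O.mergeLevel k :=
      fun h => h ▸ ENat.natCast_lt_natCast.2 (Nat.lt_succ_self i)
    intro j j' y hj hn hj' hn' hl hl' h h'
    have old_merged : ∀ {j k}, 1 ≤ j → j ≤ O.n → ((i + 1 : ℕ) : ℕ∞) < O.mergeLevel j → 1 ≤ k →
        k ≤ i → O.mergeLevel k = (i + 1 : ℕ) → y ∈ O.valley i j → y ∈ O.valley i k → False := by
      intro j k hj hn hl hk hki hm h1 h2
      have hkn := (exists_attracted_of_mergeLevel_eq hm).2.1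
      obtain rfl := ih hj hn hk (by omega) (hlt hl) (hlt' hm) h1 h2
      exact absurd hm hl.ne'
    rw [mem_valley_succ] at h h'
    rcases h with h | ⟨hij, ⟨h, ha⟩ | ⟨k, hk, hki, hm, ha, h⟩⟩ <;>
    rcases h' with h' | ⟨hij', ⟨h', ha'⟩ | ⟨k', hk', hki', hm', ha', h'⟩⟩
    · exact ih hj hn hj' hn' (hlt hl) (hlt hl') h h'
    · exact (h' j hj hn h).elim
    · exact (old_merged hj hn hl hk' hki' hm' h h').elim
    · exact (h j' hj' hn' h').elim
    · exact m_injective hj hn hj' hn' (ha.unique (by omega) ha')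
    · have := (exists_attracted_of_mergeLevel_eq hm').2.1
      exact (h k' hk' (by omega) h').elim
    · exact (old_merged hj' hn' hl' hk hki hm h' h).elim
    · have := (exists_attracted_of_mergeLevel_eq hm).2.1
      exact (h' k hk (by omega) h).elim
    · have := (exists_attracted_of_mergeLevel_eq hm).2.1
      obtain rfl := ih hk (by omega) hk' (by omega) (hlt' hm) (hlt' hm') h h'
      exact m_injective hj hn hj' hn' (ha.unique (by omega) ha')

/-- Every assigned state belongs to a valley which is not yet merged. -/
theorem exists_unmerged_valley (i : ℕ) : ∀ {k : ℕ} {y : S}, 1 ≤ k → k ≤ O.n →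
    y ∈ O.valley i k → ∃ j, 1 ≤ j ∧ j ≤ O.n ∧ (i : ℕ∞) < O.mergeLevel j ∧ y ∈ O.valley i j := by
  induction i with
  | zero => intro k y _ _ h; exact h.elim
  | succ i ih =>
    intro k y hk hn h
    by_cases hN : y ∈ O.nonAssigned i
    · rcases mem_valley_succ.1 h with h' | ⟨hik, h'⟩
      · exact (hN k hk hn h').elim
      · exact ⟨k, hk, hn, lt_of_le_of_lt (ENat.natCast_le_natCast.2 hik) (lt_mergeLevel k), h⟩
    · have hN' : ∃ k, 1 ≤ k ∧ k ≤ O.n ∧ y ∈ O.valley i k := by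
        by_contra! h'
        exact hN fun k h1 h2 => h' k h1 h2
      obtain ⟨k', hk', hkn', hyk'⟩ := hN'
      obtain ⟨j, hj, hjn, hl, hy⟩ := ih hk' hkn' hyk'
      by_cases hl' : ((i + 1 : ℕ) : ℕ∞) < O.mergeLevel j
      · exact ⟨j, hj, hjn, hl', valley_mono (Nat.le_succ i) j hy⟩
      · have he := mergeLevel_eq_succ hl hl'
        obtain ⟨hji, -, l, hl1, hl2, hatt⟩ := exists_attracted_of_mergeLevel_eq he
        exact ⟨l, by omega, hl2, lt_of_le_of_lt (ENat.natCast_le_natCast.2 hl1) (lt_mergeLevel l),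
          mem_valley_succ.2 (Or.inr ⟨hl1, Or.inr ⟨j, hj, by omega, he, hatt, hy⟩⟩)⟩

/-! ### Attraction and valleys -/

/-- From a state of the valley of `m^(j)`, the bottom can be reached inside the valley without
exceeding the communication height to any state outside. -/
def ReachesBottom (O : C.MinimaOrder) (i : ℕ) : Prop := ∀ j, 1 ≤ j → j ≤ O.n →
  ∀ y ∈ O.valley i j, ∀ w ∉ O.valley i j,
    C.Reach (O.valley i j ∩ {u | C.E u ≤ C.height y w}) y (O.m j)

/-- The recursion assigns attracted states directly only if they were non-assigned. If y already
lies in the unmerged valley of another minimum m_k, then m_k is reachable from y below the height of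
y and m_j. For k > i this makes m_k a competitor contradicting attraction; for k ≤ i the bottom m_k
is itself attracted, so its whole valley merges at this level. -/
theorem Attracted.mem_valley_of_reachesBottom {i : ℕ} (hb : O.ReachesBottom i) {j : ℕ}
    (hij : i < j) (hn : j ≤ O.n) {y : S} (ha : O.Attracted (i + 1) y (O.m j)) :
    y ∈ O.valley (i + 1) j := by
  by_cases hN : y ∈ O.nonAssigned i
  · exact mem_valley_succ.2 (Or.inr ⟨hij, Or.inl ⟨hN, ha⟩⟩)
  have hN' : ∃ k, 1 ≤ k ∧ k ≤ O.n ∧ y ∈ O.valley i k := by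
    by_contra! h'
    exact hN fun k h1 h2 => h' k h1 h2
  obtain ⟨k', hk', hkn', hyk'⟩ := hN'
  obtain ⟨k, hk, hkn, hl, hyk⟩ := exists_unmerged_valley i hk' hkn' hyk'
  by_cases hkj : k = j
  · rw [← hkj]; exact valley_mono (Nat.le_succ i) k hyk
  have hi : 1 ≤ i := by
    rcases Nat.eq_zero_or_pos i with rfl | h
    · exact hyk.elim
    · exact h
  have hmj : O.m j ∉ O.valley i k := fun h => hkj
    (valley_disjoint i hk hkn (by omega) hn hl
      (lt_trans (ENat.natCast_lt_natCast.2 hij) (lt_mergeLevel j)) h (bottom_mem_valley hi (by omega) hn))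
  have ha' := attracted_iff.1 ha
  have hr := hb k hk hkn y hyk _ hmj
  rcases le_or_gt (i + 1) k with hik | hik
  · exfalso
    have hne : O.m k ≠ O.m j := fun h => hkj (m_injective hk hkn (by omega) hn h)
    -- A meeting point t with the strong valley still lies in the valley of m_k, so m_k is at most
    -- as high from t as m_j, contradicting strict attraction.
    rcases hr.avoid_or_hit (O.strongValley (i + 1) (O.m j)) with h | ⟨t, ht, h1, -⟩
    · exact ha'.2.2 _ (m_mem_metastable hik hkn) hne (h.mono fun u hu => ⟨hu.1.2, hu.2⟩)
    · have h2 := hb k hk hkn t h1.right_mem.1 _ hmj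
      exact absurd (ht _ (m_mem_metastable hik hkn) hne)
        (not_lt.2 (height_le_iff.2 (h2.mono fun u hu => hu.2)))
  · -- the bottom of the frozen valley is attracted as well
    have hym : C.height (O.m k) y ≤ C.height y (O.m j) :=
      height_le_iff.2 (hr.symm.mono fun u hu => hu.2)
    -- The walk from y to m_k followed by one from m_k to m' must meet the strong valley of m_j. If
    -- it does so on the first piece, then m_k itself is strongly attracted and serves as the
    -- meeting point.
    have hit : ∀ m' ∈ O.metastable (i + 1), m' ≠ O.m j → ∀ {c}, c ≤ C.height y (O.m j) →
        C.Reach {u | C.E u ≤ c} (O.m k) m' → ∃ t ∈ O.strongValley (i + 1) (O.m j),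
          C.Reach {u | C.E u ≤ c} (O.m k) t ∧ C.Reach {u | C.E u ≤ c} t m' := by
      intro m' hm' hne c hc hr'
      rcases hr'.avoid_or_hit (O.strongValley (i + 1) (O.m j)) with h1 | h1
      · rcases hr.avoid_or_hit (O.strongValley (i + 1) (O.m j)) with h | ⟨t, ht, h2, -⟩
        · exact (ha'.2.2 m' hm' hne (.trans (h.mono fun u hu => ⟨hu.1.2, hu.2⟩)
            (h1.mono fun u hu => ⟨hu.1.trans hc, hu.2⟩))).elim
        · have h3 := hb k hk hkn t h2.right_mem.1 _ hmj
          refine ⟨O.m k, strongValley_of_height_le ht ?_, .refl hr'.left_mem, hr'⟩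
          rw [height_comm, height_comm _ t]
          refine height_le_trans ?_ le_rfl
          rw [height_comm]
          exact height_le_iff.2 (h3.mono fun u hu => hu.2)
      · exact h1
    have hkm : C.height (O.m k) (O.m j) ≤ C.height y (O.m j) := height_le_trans hym le_rfl
    have hatt : O.Attracted (i + 1) (O.m k) (O.m j) := by
      refine attracted_iff.2 ⟨ha'.1, fun m' hm' => ?_, fun m' hm' hne hr' => ?_⟩
      · by_cases hne : m' = O.m j
        · rw [hne]
        by_contra! hlt
        obtain ⟨t, ht, h1, h2⟩ := hit m' hm' hne (hlt.le.trans hkm) (reach_height _ m')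
        refine absurd hlt (not_lt.2 (height_le_trans (height_le_iff.2 h1) ?_))
        exact (ht m' hm' hne).le.trans (height_le_iff.2 h2)
      · by_cases hmk : O.m k ∈ O.strongValley (i + 1) (O.m j)
        · exact hr'.left_mem.2 hmk
        rcases hr.avoid_or_hit (O.strongValley (i + 1) (O.m j)) with h | ⟨t, ht, h2, -⟩
        · exact ha'.2.2 m' hm' hne (.trans (h.mono fun u hu => ⟨hu.1.2, hu.2⟩)
            (hr'.mono fun u hu => ⟨hu.1.trans hkm, hu.2⟩))
        · have h3 := hb k hk hkn t h2.right_mem.1 _ hmj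
          refine hmk (strongValley_of_height_le ht ?_)
          rw [height_comm, height_comm _ t]
          refine height_le_trans ?_ le_rfl
          rw [height_comm]
          exact height_le_iff.2 (h3.mono fun u hu => hu.2)
    have he : O.mergeLevel k = (i + 1 : ℕ) :=
      mergeLevel_eq_succ hl (not_lt.2 (mergeLevel_le hik (by omega) hatt))
    exact mem_valley_succ.2 (Or.inr ⟨hij, Or.inr ⟨k, hk, by omega, he, hatt, hyk⟩⟩)

/-- A walk from y below its height to m passes through attracted states (`Attracted.of_reach`) until
it enters the strong valley, inside which m can be reached. Both stretches lie in V, so it remains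
to compare the heights of m and w from y. -/
theorem Attracted.reach_bottom {i : ℕ} (hi : 1 ≤ i) {V : Set S} {m y w : S}
    (hV : ∀ x, O.Attracted i x m → x ∈ V) (ha : O.Attracted i y m) (hw : w ∉ V) :
    C.Reach (V ∩ {u | C.E u ≤ C.height y w}) y m := by
  have hsV : O.strongValley i m ⊆ V := fun x hx => hV x (attracted_of_mem_strongValley ha.1 hx)
  have hws : w ∉ O.strongValley i m := fun h => hw (hsV h)
  have hm := self_mem_strongValley (O := O) (i := i) (metastable_subset_localMinima hi ha.1)
  by_cases hy : y ∈ O.strongValley i m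
  · refine (reach_strongValley hy).mono fun u hu =>
      ⟨hsV hu.2, show C.E u ≤ _ from hu.1.trans ?_⟩
    have h1 := height_lt_of_notMem_strongValley hy hws
    rw [height_comm m y] at h1
    rcases le_max_iff.1 (height_le_max m y w) with h | h
    · rw [height_comm m y] at h; exact absurd h1 (not_lt.2 h)
    · exact h1.le.trans h
  · obtain ⟨u, t, h1, hut, ht, h2⟩ := (reach_height y m).exists_first_hit hy hm
    -- If w were strictly lower than m from y, a walk to w avoiding the strong valley would make w
    -- attracted; one hitting it at t' would give, by the ultrametric inequality, a height from m to
    -- t' at least that to y, but y is not strongly attracted.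
    have hle : C.height y m ≤ C.height y w := by
      by_contra! hlt
      rcases (reach_height y w).avoid_or_hit (O.strongValley i m) with h | ⟨t', ht', h3, -⟩
      · exact hw (hV w (ha.of_reach (h.mono fun u hu => ⟨hu.1.trans hlt.le, hu.2⟩)))
      · have h4 := height_lt_of_notMem_strongValley ht' hy
        rw [height_comm m y] at h4
        rcases le_max_iff.1 (height_le_max y t' m) with h | h
        · exact absurd (h.trans (height_le_iff.2 h3)) (not_le.2 hlt)
        · rw [height_comm t' m] at h; exact absurd h (not_le.2 h4)
    refine .trans (h1.in_component.mono fun v hv => ⟨hV v (ha.of_reach hv.1), ?_⟩)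
      (.trans (reach_of_adj hut ⟨hV u (ha.of_reach h1), ?_⟩ ⟨hsV ht, ?_⟩)
        ((reach_strongValley ht).mono fun v hv => ⟨hsV hv.2, ?_⟩))
    · exact hv.1.right_mem.1.trans hle
    · exact h1.right_mem.1.trans hle
    · exact h2.left_mem.trans hle
    · exact (hv.1.trans (height_le_iff.2 h2)).trans hle

/-- Induction along the three ways of entering a valley. From a merged valley, first its own bottom
is reached inside it, and that bottom is an attracted state. -/
theorem reachesBottom (i : ℕ) : O.ReachesBottom i := by
  induction i with
  | zero => intro j _ _ y hy; exact hy.elim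
  | succ i ih =>
    intro j hj hn y hy w hw
    rcases le_or_gt j i with hji | hij
    · rw [valley_of_le (hji.trans (Nat.le_succ i)), ← valley_of_le hji] at hy hw ⊢
      exact ih j hj hn y hy w hw
    have hV : ∀ x, O.Attracted (i + 1) x (O.m j) → x ∈ O.valley (i + 1) j := fun x hx =>
      hx.mem_valley_of_reachesBottom ih hij hn
    rcases mem_valley_succ.1 hy with h | ⟨-, ⟨-, ha⟩ | ⟨k, hk, hki, hm, ha, h⟩⟩
    · refine (ih j hj hn y h w fun h' => hw (valley_mono (Nat.le_succ i) j h')).mono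
        fun u hu => ⟨valley_mono (Nat.le_succ i) j hu.1, hu.2⟩
    · exact ha.reach_bottom (by omega) hV hw
    · have hsub : O.valley i k ⊆ O.valley (i + 1) j := fun x hx =>
        mem_valley_succ.2 (Or.inr ⟨hij, Or.inr ⟨k, hk, hki, hm, ha, hx⟩⟩)
      have h1 := ih k hk (by omega) y h w fun h' => hw (hsub h')
      refine .trans (h1.mono fun u hu => ⟨hsub hu.1, hu.2⟩)
        ((ha.reach_bottom (by omega) hV hw).mono fun u hu =>
          ⟨hu.1, show C.E u ≤ _ from hu.2.trans ?_⟩)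
      exact height_le_trans (height_le_iff.2 (h1.symm.mono fun u hu => hu.2)) le_rfl

theorem Attracted.mem_valley {i j : ℕ} (hi : 1 ≤ i) (hij : i ≤ j) (hn : j ≤ O.n) {y : S}
    (ha : O.Attracted i y (O.m j)) : y ∈ O.valley i j := by
  obtain ⟨i, rfl⟩ := Nat.exists_eq_succ_of_ne_zero (Nat.one_le_iff_ne_zero.1 hi)
  exact ha.mem_valley_of_reachesBottom (reachesBottom i) hij hn

theorem height_bottom_le {i j : ℕ} (hj : 1 ≤ j) (hn : j ≤ O.n) {y w : S}
    (hy : y ∈ O.valley i j) (hw : w ∉ O.valley i j) : C.height y (O.m j) ≤ C.height y w :=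
  height_le_iff.2 ((reachesBottom i j hj hn y hy w hw).mono fun _ hu => hu.2)

/-- Valleys are closed under downhill moves. -/
theorem mem_valley_of_adj (i : ℕ) : ∀ {j : ℕ} {x z : S}, 1 ≤ j → j ≤ O.n → x ∈ O.valley i j →
    C.G.Adj x z → C.E z < C.E x → z ∈ O.valley i j := by
  induction i with
  | zero => intro j x z _ _ h; exact h.elim
  | succ i ih =>
    intro j x z hj hn hx hxz hE
    rcases le_or_gt j i with hji | hij
    · rw [valley_of_le (hji.trans (Nat.le_succ i)), ← valley_of_le hji] at hx ⊢
      exact ih hj hn hx hxz hE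
    rcases mem_valley_succ.1 hx with h | ⟨-, ⟨-, ha⟩ | ⟨k, hk, hki, hm, ha, h⟩⟩
    · exact valley_mono (Nat.le_succ i) j (ih hj hn h hxz hE)
    · refine Attracted.mem_valley (by omega) hij hn ?_
      by_cases hz : z ∈ O.strongValley (i + 1) (O.m j)
      · exact attracted_of_mem_strongValley ha.1 hz
      have hxs : x ∉ O.strongValley (i + 1) (O.m j) := fun hxs => by
        refine hz (strongValley_of_height_le hxs (height_le_trans le_rfl ?_))
        exact height_le_of_adj hxz (right_le_height _ _) (hE.le.trans (right_le_height _ _))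
      exact ha.of_reach (reach_of_adj hxz ⟨left_le_height _ _, hxs⟩
        ⟨hE.le.trans (left_le_height _ _), hz⟩)
    · exact mem_valley_succ.2 (Or.inr ⟨hij, Or.inr ⟨k, hk, hki, hm, ha,
        ih hk (by omega) h hxz hE⟩⟩)

theorem energy_lt_of_adj {i j : ℕ} (hj : 1 ≤ j) (hn : j ≤ O.n) {x z : S} (hx : x ∈ O.valley i j)
    (hz : z ∉ O.valley i j) (h : C.G.Adj x z) : C.E x < C.E z := by
  rcases lt_trichotomy (C.E x) (C.E z) with h' | h' | h'
  · exact h'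
  · exact absurd (C.E_injective h') h.ne
  · exact absurd (mem_valley_of_adj i hj hn hx h h') hz

theorem height_bottom_of_adj {i j : ℕ} (hj : 1 ≤ j) (hn : j ≤ O.n) {x z : S}
    (hx : x ∈ O.valley i j) (hz : z ∉ O.valley i j) (h : C.G.Adj x z) :
    C.height (O.m j) z ≤ C.E z := by
  have h1 : C.height x z ≤ C.E z := height_le_of_adj h (energy_lt_of_adj hj hn hx hz h).le le_rfl
  refine height_le_trans ?_ h1
  rw [height_comm]
  exact (height_bottom_le hj hn hx hz).trans h1

end MinimaOrder

end EnergyChain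

namespace EnergyChain

variable {S : Type*} [Fintype S] {C : EnergyChain S}

namespace MinimaOrder

variable {O : C.MinimaOrder}

/-! ### Depths of valleys -/

theorem exists_localMinimum_reach (y : S) :
    ∃ m ∈ C.localMinima, C.Reach {t | C.E t ≤ C.E y} y m := by
  classical
  obtain ⟨m, hm, hmin⟩ := Finset.exists_min_image
    (Finset.univ.filter fun m => C.Reach {t | C.E t ≤ C.E y} y m) C.E
    ⟨y, by simpa using Reach.refl (C := C) (A := {t | C.E t ≤ C.E y}) (x := y) (le_refl (C.E y))⟩
  simp only [Finset.mem_filter, Finset.mem_univ, true_and] at hm hmin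
  refine ⟨m, fun r hr => ?_, hm⟩
  by_contra! h
  refine absurd (C.E_injective (le_antisymm h (hmin r ?_))) hr.ne'
  exact hm.trans (reach_of_adj hr hm.right_mem (h.trans hm.right_mem))

/-- At level one, a local minimum can be reached from y without climbing. When the current minimum
is deleted, it is replaced by its cheapest target k'; the extra climb is the deleted activation
energy, which the order makes no larger than any remaining one. -/
theorem exists_metastable_below {i : ℕ} (hi : 1 ≤ i) (hn : i ≤ O.n) (y : S) :
    ∃ k, i ≤ k ∧ k ≤ O.n ∧ C.E (O.m k) ≤ C.E y ∧ ∀ j j', i ≤ j → j ≤ O.n → i ≤ j' → j' ≤ O.n →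
      j ≠ j' → C.height y (O.m k) - C.E y ≤ C.height (O.m j) (O.m j') - C.E (O.m j) := by
  induction i, hi using Nat.le_induction with
  | base =>
    obtain ⟨m, hm, hr⟩ := exists_localMinimum_reach (C := C) y
    obtain ⟨k, hk, rfl⟩ := O.bijOn.surjOn hm
    refine ⟨k, hk.1, hk.2, hr.right_mem, fun j j' _ _ _ _ _ => ?_⟩
    linarith [height_le_iff.2 hr, left_le_height (C := C) (O.m j) (O.m j')]
  | succ i hi ih =>
    obtain ⟨k, hik, hkn, hE, hk⟩ := ih (by omega)
    rcases hik.eq_or_lt with rfl | hik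
    · obtain ⟨k', hk', hkn', ho⟩ := O.order i hi (by omega)
      -- The same barrier seen from k' is at least as high as from i, whence E(m_k') ≤ E(m_i).
      have h1 : C.height (O.m i) (O.m k') - C.E (O.m i) ≤
          C.height (O.m k') (O.m i) - C.E (O.m k') :=
        ho k' i hk'.le hkn' le_rfl hkn hk'.ne'
      rw [height_comm (O.m k')] at h1
      refine ⟨k', hk', hkn', by linarith, fun j j' hj hjn hj' hjn' hne => ?_⟩
      have h2 : C.height (O.m i) (O.m k') - C.E (O.m i) ≤ C.height (O.m j) (O.m j') - C.E (O.m j) :=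
        ho j j' (by omega) hjn (by omega) hjn' hne
      have h3 := hk j j' (by omega) hjn (by omega) hjn' hne
      rcases le_max_iff.1 (height_le_max y (O.m i) (O.m k')) with h | h <;> linarith
    · exact ⟨k, hik, hkn, hE, fun j j' hj hjn hj' hjn' hne =>
        hk j j' (by omega) hjn (by omega) hjn' hne⟩

theorem unmerged_of_le {i j : ℕ} (h : i ≤ j) : (i : ℕ∞) < O.mergeLevel j :=
  lt_of_le_of_lt (ENat.natCast_le_natCast.2 h) (lt_mergeLevel j)

theorem strongValley_subset_valley {i j : ℕ} (hi : 1 ≤ i) (hij : i ≤ j) (hn : j ≤ O.n) :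
    O.strongValley i (O.m j) ⊆ O.valley i j := fun _ hx =>
  (attracted_of_mem_strongValley (m_mem_metastable hij hn) hx).mem_valley hi hij hn

/-- Let m_k be the metastable state below y from `exists_metastable_below`. If k = j, the climb is
bounded by the activation energy of m_j, hence by the climb from m_j to w. Otherwise m_k lies
outside the valley, and by `height_bottom_le` it is no closer to y than m_j; comparing with the
activation energy from m_j to m_k gives E(m_j) ≤ E(y), and the barrier towards w gives the second
inequality. -/
theorem valley_depth {i j : ℕ} (hi : 1 ≤ i) (hj : 1 ≤ j) (hn : j ≤ O.n) {y w : S}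
    (hy : y ∈ O.valley i j) (hw : w ∉ O.valley i j) :
    C.E (O.m j) ≤ C.E y ∧
      C.height y (O.m j) - C.E y ≤ C.height (O.m j) w - C.E (O.m j) := by
  -- Passing to level i ∧ j does not change the valley and makes m_j metastable at that level.
  rw [valley_eq_min] at hy hw
  have hi' : 1 ≤ min i j := le_min hi hj
  have hij : min i j ≤ j := min_le_right i j
  generalize min i j = i at *
  obtain ⟨k, hik, hkn, hE, hk⟩ := exists_metastable_below (O := O) hi' (hij.trans hn) y
  have hws : w ∉ O.strongValley i (O.m j) := fun h => hw (strongValley_subset_valley hi' hij hn h)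
  have hact : ∃ j', i ≤ j' ∧ j' ≤ O.n ∧ j ≠ j' ∧
      C.height (O.m j) (O.m j') ≤ C.height (O.m j) w := by
    rw [mem_strongValley] at hws
    push Not at hws
    obtain ⟨_, ⟨j', hj', rfl⟩, hne, hle⟩ := hws
    exact ⟨j', hj'.1, hj'.2, fun h => hne (h ▸ rfl),
      height_le_trans le_rfl (hle.trans (by rw [height_comm]))⟩
  obtain ⟨j', hj', hjn', hne, hact⟩ := hact
  have h1 := hk j j' hij hn hj' hjn' hne
  by_cases hkj : k = j
  · subst hkj
    exact ⟨hE, by linarith⟩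
  · have hmk : O.m k ∉ O.valley i j := fun h => hkj
      (valley_disjoint i (by omega) hkn hj hn (unmerged_of_le hik) (unmerged_of_le hij)
        (bottom_mem_valley hi' (by omega) hkn) h)
    have h2 := height_bottom_le hj hn hy hmk
    have h3 := hk j k hij hn hik hkn (Ne.symm hkj)
    have h4 : C.height (O.m j) (O.m k) ≤ C.height y (O.m k) :=
      height_le_trans (by rw [height_comm]; exact h2) le_rfl
    exact ⟨by linarith, by linarith⟩

/-! ### Funnelling towards the bottom of a valley -/

end MinimaOrder

section Funnel

open scoped Classical

theorem exitProb_eq_zero_of_not_adj {β : ℝ} (hβ : 0 < β) {D : Set S} {x w : S} (hx : x ∈ D)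
    (h : ∀ u ∈ D, w ∉ D → ¬ C.G.Adj u w) : (C.rev β).exitProb D x w = 0 := by
  by_cases hw : w ∈ D
  · exact (C.rev β).exitProb_of_mem_right hw
  rw [(C.rev β).exitProb_of_mem hx hw]
  refine Finset.sum_eq_zero fun u _ => ?_
  by_cases hu : u ∈ D
  · rw [C.rev_p_eq_zero hβ (ne_of_mem_of_not_mem hu hw) (h u hu hw), mul_zero]
  · rw [(C.rev β).green_of_notMem_right hx hu, zero_mul]

/-- Exits from D above the escape height c are negligible, and exits to states not adjacent to D
have probability zero; only low adjacent states need to be funnelled further. -/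
theorem funnel_of_barrier {V D : Set S} {m x z : S} (hD : D ⊆ V \ {m}) (hx : x ∈ D) (hz : z ∉ D)
    {c : ℝ} (hr : C.Reach {t | C.E t ≤ c} x z)
    (h : ∀ u ∈ D, ∀ w ∉ D, C.G.Adj u w → C.E w ≤ c → C.Funnel V m w) : C.Funnel V m x := by
  refine C.funnel_of_exit hD fun w hw => ?_
  by_cases hadj : ∃ u ∈ D, C.G.Adj u w
  · obtain ⟨u, hu, huw⟩ := hadj
    rcases le_or_gt (C.E w) c with hc | hc
    · exact Or.inr (h u hu w hw huw hc)
    · exact Or.inl (C.tendsto_exitProb_zero hx hz hr hw hc)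
  · refine Or.inl (Tendsto.congr' ?_ tendsto_const_nhds)
    filter_upwards [eventually_gt_atTop 0] with β hβ
    exact (exitProb_eq_zero_of_not_adj hβ hx fun u hu _ h => hadj ⟨u, hu, h⟩).symm

/-- The smaller set leads to m' before it is left, and m' leads to m. The condition on m keeps V' \
{m'} inside V \ {m}. -/
theorem Funnel.trans {V V' : Set S} {m m' x : S} (hV : V' ⊆ V) (hm : m = m' ∨ m ∉ V')
    (h : C.Funnel V' m' x) (h' : C.Funnel V m m') : C.Funnel V m x := by
  refine C.funnel_of_exit (D := V' \ {m'}) (fun u hu => ⟨hV hu.1, ?_⟩) fun w _ => ?_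
  · rintro rfl
    rcases hm with rfl | hm
    · exact hu.2 rfl
    · exact hm hu.1
  · by_cases hw : w = m'
    · exact Or.inr (hw ▸ h')
    · left
      have h1 := Tendsto.const_sub 1 h
      rw [sub_self] at h1
      refine squeeze_zero (fun β => (C.rev β).exitProb_nonneg x w) (fun β => ?_) h1
      have hs := (C.rev β).sum_exitProb (sdiff_singleton_ne_univ V' m') x
      have h2 : ∑ u ∈ {w, m'}, (C.rev β).exitProb (V' \ {m'}) x u ≤ 1 := by
        rw [← hs]
        exact Finset.sum_le_sum_of_subset_of_nonneg (Finset.subset_univ _)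
          fun u _ _ => (C.rev β).exitProb_nonneg x u
      rw [Finset.sum_pair hw] at h2
      linarith

end Funnel

namespace MinimaOrder

variable {O : C.MinimaOrder}

/-- Inside the strong valley, every adjacent outside state is higher than the communication height
to m, so m is visited first. An attracted y outside it starts in the component of its sublevel set
off the strong valley; this component consists of attracted states, and its only low exits lead into
the strong valley. -/
theorem Attracted.funnel {i : ℕ} (hi : 1 ≤ i) {V : Set S} {m y : S}
    (hV : ∀ x, O.Attracted i x m → x ∈ V) (ha : O.Attracted i y m) : C.Funnel V m y := by
  have hsV : O.strongValley i m ⊆ V := fun x hx => hV x (attracted_of_mem_strongValley ha.1 hx)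
  have hm := self_mem_strongValley (O := O) (i := i) (metastable_subset_localMinima hi ha.1)
  have hs : ∀ y ∈ O.strongValley i m, C.Funnel V m y := by
    intro y hy
    by_cases hym : y = m
    · rw [hym]; exact C.funnel_self V m
    refine funnel_of_barrier (D := O.strongValley i m \ {m}) (z := m)
      (fun u hu => ⟨hsV hu.1, hu.2⟩) ⟨hy, hym⟩ (fun h => h.2 rfl) (reach_height y m) ?_
    intro u hu w hw huw hc
    by_cases hwm : w = m
    · rw [hwm]; exact C.funnel_self V m
    · have hws : w ∉ O.strongValley i m := fun h => hw ⟨h, hwm⟩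
      have h1 := height_lt_of_notMem_strongValley hy hws
      have h2 := height_lt_of_notMem_strongValley hu.1 hws
      have h3 : C.height m w ≤ max (C.height m u) (C.E w) := by
        refine height_le_trans (le_max_left _ _) (height_le_of_adj huw ?_ (le_max_right _ _))
        exact (right_le_height m u).trans (le_max_left _ _)
      rcases le_max_iff.1 h3 with h | h
      · exact absurd h2 (not_lt.2 h)
      · rw [height_comm] at hc
        exact absurd (h1.trans_le (h.trans hc)) (lt_irrefl _)
  by_cases hy : y ∈ O.strongValley i m
  · exact hs y hy
  set D := {x | C.Reach ({u | C.E u ≤ C.height y m} \ O.strongValley i m) y x} with hDdef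
  have hyD : y ∈ D := Reach.refl (A := {u | C.E u ≤ C.height y m} \ O.strongValley i m)
    ⟨left_le_height y m, hy⟩
  refine funnel_of_barrier (D := D) (z := m) (fun u hu => ⟨hV u (ha.of_reach hu), ?_⟩) hyD ?_
    (reach_height y m) ?_
  · rintro rfl
    exact (Reach.right_mem hu).2 hm
  · intro h
    exact (Reach.right_mem h).2 hm
  · intro u hu w hw huw hc
    by_cases hws : w ∈ O.strongValley i m
    · exact hs w hws
    · exact (hw (Reach.trans hu (reach_of_adj huw (Reach.right_mem hu) ⟨hc, hws⟩))).elim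

theorem funnel_valley (i : ℕ) : ∀ {j : ℕ} {x : S}, 1 ≤ j → j ≤ O.n → x ∈ O.valley i j →
    C.Funnel (O.valley i j) (O.m j) x := by
  induction i with
  | zero => intro j x _ _ h; exact h.elim
  | succ i ih =>
    intro j x hj hn hx
    rcases le_or_gt j i with hji | hij
    · rw [valley_of_le (hji.trans (Nat.le_succ i)), ← valley_of_le hji] at hx ⊢
      exact ih hj hn hx
    have hV : ∀ x, O.Attracted (i + 1) x (O.m j) → x ∈ O.valley (i + 1) j := fun x hx =>
      hx.mem_valley (by omega) hij hn
    rcases mem_valley_succ.1 hx with h | ⟨-, ⟨-, ha⟩ | ⟨k, hk, hki, hm, ha, h⟩⟩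
    · exact (ih hj hn h).trans (valley_mono (Nat.le_succ i) j) (Or.inl rfl) (C.funnel_self _ _)
    · exact ha.funnel (by omega) hV
    · refine (ih hk (by omega) h).trans (fun y hy => mem_valley_succ.2
        (Or.inr ⟨hij, Or.inr ⟨k, hk, hki, hm, ha, hy⟩⟩)) (Or.inr fun hmem => ?_)
        (ha.funnel (by omega) hV)
      have : k = j := valley_disjoint i hk (by omega) hj hn
        (hm ▸ ENat.natCast_lt_natCast.2 (Nat.lt_succ_self i)) (unmerged_of_le hij.le) hmem
        (bottom_mem_valley (by omega) hj hn)
      omega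

/-! ### Cells -/

theorem cell_m {i j : ℕ} (hi : 1 ≤ i) (hj : 1 ≤ j) (hn : j ≤ O.n) :
    O.cell i (O.m j) = O.valley i j := by
  ext x
  constructor
  · rintro (⟨j', hj', hn', he, hx⟩ | ⟨hN, -⟩)
    · rwa [m_injective hj hn hj' hn' he]
    · exact (hN j hj hn (bottom_mem_valley hi hj hn)).elim
  · exact fun hx => Or.inl ⟨j, hj, hn, rfl, hx⟩

theorem cell_nonAssigned {i : ℕ} (hi : 1 ≤ i) {s : S} (hs : s ∈ O.nonAssigned i) :
    O.cell i s = {s} := by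
  ext x
  constructor
  · rintro (⟨j, hj, hn, rfl, -⟩ | ⟨-, hx⟩)
    · exact (hs j hj hn (bottom_mem_valley hi hj hn)).elim
    · exact hx
  · exact fun hx => Or.inr ⟨hs, hx⟩

theorem self_mem_cell {i : ℕ} (hi : 1 ≤ i) {s : S} (hs : s ∈ O.metastates i) :
    s ∈ O.cell i s := by
  rcases hs with ⟨j, hj, hn, rfl, -⟩ | hs
  · exact Or.inl ⟨j, hj, hn, rfl, bottom_mem_valley hi hj hn⟩
  · exact Or.inr ⟨hs, rfl⟩

theorem notMem_nonAssigned_of_mem_cell {i : ℕ} (hi : 1 ≤ i) {m x : S} (hm : m ∈ O.metaMinima i)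
    (hx : x ∈ O.cell i m) : x ∉ O.nonAssigned i := by
  obtain ⟨j, hj, hn, rfl, -⟩ := hm
  rw [cell_m hi hj hn] at hx
  exact fun h => h j hj hn hx

theorem metaMinima_notMem_nonAssigned {i : ℕ} (hi : 1 ≤ i) {m : S} (hm : m ∈ O.metaMinima i) :
    m ∉ O.nonAssigned i :=
  notMem_nonAssigned_of_mem_cell hi hm (self_mem_cell hi (Or.inl hm))

theorem exists_cell_of_notMem_nonAssigned {i : ℕ} (hi : 1 ≤ i) {x : S}
    (hx : x ∉ O.nonAssigned i) : ∃ m ∈ O.metaMinima i, x ∈ O.cell i m := by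
  have hN' : ∃ k, 1 ≤ k ∧ k ≤ O.n ∧ x ∈ O.valley i k := by
    by_contra! h'
    exact hx fun k h1 h2 => h' k h1 h2
  obtain ⟨k, hk, hkn, hxk⟩ := hN'
  obtain ⟨j, hj, hn, hl, hxj⟩ := exists_unmerged_valley i hk hkn hxk
  exact ⟨O.m j, ⟨j, hj, hn, rfl, hl⟩, by rwa [cell_m hi hj hn]⟩

theorem exists_metastate {i : ℕ} (hi : 1 ≤ i) (x : S) : ∃ s ∈ O.metastates i, x ∈ O.cell i s := by
  by_cases hx : x ∈ O.nonAssigned i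
  · exact ⟨x, Or.inr hx, Or.inr ⟨hx, rfl⟩⟩
  · obtain ⟨m, hm, hxm⟩ := exists_cell_of_notMem_nonAssigned hi hx
    exact ⟨m, Or.inl hm, hxm⟩

theorem cell_unique {i : ℕ} (hi : 1 ≤ i) {x s s' : S} (hs : s ∈ O.metastates i)
    (hs' : s' ∈ O.metastates i) (h : x ∈ O.cell i s) (h' : x ∈ O.cell i s') : s = s' := by
  rcases hs with hs | hs <;> rcases hs' with hs' | hs'
  · obtain ⟨j, hj, hn, rfl, hl⟩ := hs
    obtain ⟨j', hj', hn', rfl, hl'⟩ := hs'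
    rw [cell_m hi hj hn] at h
    rw [cell_m hi hj' hn'] at h'
    rw [valley_disjoint i hj hn hj' hn' hl hl' h h']
  · rw [cell_nonAssigned hi hs'] at h'
    exact (notMem_nonAssigned_of_mem_cell hi hs h (h' ▸ hs')).elim
  · rw [cell_nonAssigned hi hs] at h
    exact (notMem_nonAssigned_of_mem_cell hi hs' h' (h ▸ hs)).elim
  · rw [cell_nonAssigned hi hs] at h
    rw [cell_nonAssigned hi hs'] at h'
    exact h.symm.trans h'

theorem exists_adj_of_ne_univ {V : Set S} {x : S} (hx : x ∈ V) (hV : V ≠ Set.univ) :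
    ∃ y ∈ V, ∃ w ∉ V, C.G.Adj y w := by
  obtain ⟨z, hz⟩ := (Set.ne_univ_iff_exists_notMem V).1 hV
  obtain ⟨γ⟩ := C.connected.preconnected z x
  obtain ⟨u, t, h1, h2, h3, -⟩ := Reach.exists_first_hit (C := C) (A := Set.univ) (B := V)
    ⟨γ, fun _ _ => trivial⟩ hz hx
  exact ⟨t, h3, u, h1.right_mem.2, h2.symm⟩

/-- Valleys of unmerged minima are not adjacent to each other. -/
theorem nonAssigned_of_adj_cell {i : ℕ} {m : S} (hi : 1 ≤ i) (hm : m ∈ O.metaMinima i) {y w : S}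
    (hy : y ∈ O.cell i m) (hw : w ∉ O.cell i m) (h : C.G.Adj y w) : w ∈ O.nonAssigned i := by
  by_contra hN
  obtain ⟨m', hm', hw'⟩ := exists_cell_of_notMem_nonAssigned hi hN
  have hy' : y ∉ O.cell i m' := fun h' => hw
    (cell_unique hi (Or.inl hm) (Or.inl hm') hy h' ▸ hw')
  obtain ⟨j, hj, hn, rfl, -⟩ := hm
  obtain ⟨j', hj', hn', rfl, -⟩ := hm'
  rw [cell_m hi hj hn] at hy hw
  rw [cell_m hi hj' hn'] at hy' hw'
  exact lt_asymm (energy_lt_of_adj hj hn hy hw h) (energy_lt_of_adj hj' hn' hw' hy' h.symm)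

theorem funnel_cell {i : ℕ} {m : S} (hi : 1 ≤ i) (hm : m ∈ O.metaMinima i) {y : S}
    (hy : y ∈ O.cell i m) : C.Funnel (O.cell i m) m y := by
  obtain ⟨j, hj, hn, rfl, -⟩ := hm
  rw [cell_m hi hj hn] at hy ⊢
  exact funnel_valley i hj hn hy

section Metastate

variable [Nonempty S]

theorem toMetastate_spec {i : ℕ} (hi : 1 ≤ i) (x : S) :
    O.toMetastate i x ∈ O.metastates i ∧ x ∈ O.cell i (O.toMetastate i x) :=
  Classical.epsilon_spec (p := fun s => s ∈ O.metastates i ∧ x ∈ O.cell i s)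
    (exists_metastate hi x)

theorem toMetastate_eq_iff {i : ℕ} (hi : 1 ≤ i) {x s : S} (hs : s ∈ O.metastates i) :
    O.toMetastate i x = s ↔ x ∈ O.cell i s := by
  have h := toMetastate_spec (O := O) hi x
  exact ⟨fun he => he ▸ h.2, fun hx => cell_unique hi h.1 hs h.2 hx⟩

theorem exitState_spec {V : Set S} {x : S} (hx : x ∈ V) (hV : V ≠ Set.univ) :
    C.exitState V ∈ C.outerBoundary V ∧ ∀ t ∈ C.outerBoundary V, C.E (C.exitState V) ≤ C.E t := by
  classical
  refine Classical.epsilon_spec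
    (p := fun s => s ∈ C.outerBoundary V ∧ ∀ t ∈ C.outerBoundary V, C.E s ≤ C.E t) ?_
  obtain ⟨y, hy, w, hw, hyw⟩ := exists_adj_of_ne_univ (C := C) hx hV
  obtain ⟨s, hs, hmin⟩ := Finset.exists_min_image
    (Finset.univ.filter fun s => s ∈ C.outerBoundary V) C.E ⟨w, by simpa using ⟨hw, y, hy, hyw⟩⟩
  simp only [Finset.mem_filter, Finset.mem_univ, true_and] at hs hmin
  exact ⟨s, hs, hmin⟩

variable {i : ℕ} {m : S}

theorem exit_mem_nonAssigned (hi : 1 ≤ i) (hm : m ∈ O.metaMinima i)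
    (hne : O.cell i m ≠ Set.univ) : O.exit i m ∈ O.nonAssigned i := by
  obtain ⟨⟨hs, y, hy, hadj⟩, -⟩ := exitState_spec (C := C) (self_mem_cell hi (Or.inl hm)) hne
  exact nonAssigned_of_adj_cell hi hm hy hs hadj

theorem exit_notMem_cell (hi : 1 ≤ i) (hm : m ∈ O.metaMinima i)
    (hne : O.cell i m ≠ Set.univ) : O.exit i m ∉ O.cell i m :=
  (exitState_spec (C := C) (self_mem_cell hi (Or.inl hm)) hne).1.1

theorem exit_le_of_adj (hi : 1 ≤ i) (hm : m ∈ O.metaMinima i) {y w : S}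
    (hy : y ∈ O.cell i m) (hw : w ∉ O.cell i m) (h : C.G.Adj y w) :
    C.E (O.exit i m) ≤ C.E w :=
  (exitState_spec (C := C) (self_mem_cell hi (Or.inl hm))
    (Set.ne_univ_iff_exists_notMem _ |>.2 ⟨w, hw⟩)).2 w ⟨hw, y, hy, h⟩

theorem height_exit (hi : 1 ≤ i) (hm : m ∈ O.metaMinima i) (hne : O.cell i m ≠ Set.univ) :
    C.height m (O.exit i m) ≤ C.E (O.exit i m) := by
  obtain ⟨⟨hs, y, hy, hadj⟩, -⟩ := exitState_spec (C := C) (self_mem_cell hi (Or.inl hm)) hne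
  obtain ⟨j, hj, hn, rfl, -⟩ := hm
  unfold exit
  rw [cell_m hi hj hn] at hs hy hadj ⊢
  exact height_bottom_of_adj hj hn hy hs hadj

theorem exit_le_height (hi : 1 ≤ i) (hm : m ∈ O.metaMinima i) {x w : S} (hx : x ∈ O.cell i m)
    (hw : w ∉ O.cell i m) : C.E (O.exit i m) ≤ C.height x w := by
  obtain ⟨u, t, h1, h2, h3, -⟩ := (reach_height x w).symm.exists_first_hit hw hx
  exact (exit_le_of_adj hi hm h3 h1.right_mem.2 h2.symm).trans h1.right_mem.1

/-- From every state of a valley there is a path out of it whose height above the starting point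
does not exceed the depth. -/
theorem reach_exit (hi : 1 ≤ i) (hm : m ∈ O.metaMinima i) (hne : O.cell i m ≠ Set.univ) {y : S}
    (hy : y ∈ O.cell i m) :
    C.Reach {t | C.E t ≤ C.E y + (C.E (O.exit i m) - C.E m)} y (O.exit i m) := by
  have h1 := height_exit hi hm hne
  have h2 := exit_notMem_cell hi hm hne
  obtain ⟨j, hj, hn, rfl, -⟩ := hm
  rw [cell_m hi hj hn] at hy h2
  obtain ⟨h3, h4⟩ := valley_depth hi hj hn hy h2
  exact height_le_iff.1 (height_le_trans (by linarith) (h1.trans (by linarith)))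

theorem tendsto_exitProb_exit (hi : 1 ≤ i) (hm : m ∈ O.metaMinima i)
    (hne : O.cell i m ≠ Set.univ) {x : S} (hx : x ∈ O.cell i m) :
    Tendsto (fun β => (C.rev β).exitProb (O.cell i m) x (O.exit i m)) atTop (𝓝 1) :=
  C.tendsto_exitProb_one (self_mem_cell hi (Or.inl hm)) (exit_notMem_cell hi hm hne)
    (height_le_iff.1 (height_exit hi hm hne)) (fun _ hy _ hw h => exit_le_of_adj hi hm hy hw h)
    (funnel_cell hi hm hx)

end Metastate

end MinimaOrder

end EnergyChain

/-! ### Integer-valued random times. -/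

theorem ENat.sInf_natCast_le_iff {p : ℕ → Prop} {n : ℕ} :
    sInf {t : ℕ∞ | ∃ t' : ℕ, t = (t' : ℕ∞) ∧ p t'} ≤ n ↔ ∃ t ≤ n, p t := by
  constructor
  · intro h
    by_contra! hno
    have : ((n + 1 : ℕ) : ℕ∞) ≤ sInf {t : ℕ∞ | ∃ t' : ℕ, t = (t' : ℕ∞) ∧ p t'} := by
      refine le_sInf ?_
      rintro t ⟨t', rfl, ht'⟩
      by_contra hlt
      have h1 := ENat.natCast_lt_natCast.1 (not_le.1 hlt)
      exact hno t' (by omega) ht'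
    have := ENat.natCast_le_natCast.1 (this.trans h)
    omega
  · rintro ⟨t, ht, hp⟩
    refine le_trans (sInf_le ?_) (ENat.natCast_le_natCast.2 ht)
    exact ⟨t, rfl, hp⟩

theorem ENat.sInf_natCast_eq_iff {p : ℕ → Prop} {n : ℕ} :
    sInf {t : ℕ∞ | ∃ t' : ℕ, t = (t' : ℕ∞) ∧ p t'} = n ↔ p n ∧ ∀ t < n, ¬ p t := by
  constructor
  · intro h
    obtain ⟨t, ht, hp⟩ := ENat.sInf_natCast_le_iff.1 h.le
    have hmin : ∀ t < n, ¬ p t := fun t ht hp => by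
      have := ENat.sInf_natCast_le_iff.2 ⟨t, le_rfl, hp⟩
      rw [h] at this
      have := ENat.natCast_le_natCast.1 this
      omega
    refine ⟨?_, hmin⟩
    rcases ht.eq_or_lt with rfl | ht
    · exact hp
    · exact (hmin t ht hp).elim
  · rintro ⟨hp, hmin⟩
    refine le_antisymm (ENat.sInf_natCast_le_iff.2 ⟨n, le_refl n, hp⟩) (le_sInf ?_)
    rintro t ⟨t', rfl, ht'⟩
    by_contra hlt
    exact hmin t' (ENat.natCast_lt_natCast.1 (not_le.1 hlt)) ht'

theorem ENat.toENNReal_eq_tsum (a : ℕ∞) :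
    (a : ℝ≥0∞) = ∑' n : ℕ, open scoped Classical in if (n : ℕ∞) < a then (1 : ℝ≥0∞) else 0 := by
  classical
  induction a using ENat.recTopCoe with
  | top => simp
  | coe a =>
    rw [tsum_eq_sum (s := Finset.range a)]
    · rw [Finset.sum_congr rfl fun n hn => if_pos
        (ENat.natCast_lt_natCast.2 (Finset.mem_range.1 hn))]
      simp
    · intro n hn
      exact if_neg fun h => hn (Finset.mem_range.2 (ENat.natCast_lt_natCast.1 h))

open scoped Classical in
theorem measurable_of_forall_natCast {Ω : Type*} [MeasurableSpace Ω] {T : Ω → ℕ∞}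
    (h : ∀ n : ℕ, MeasurableSet {ω | (n : ℕ∞) < T ω}) : Measurable fun ω => (T ω : ℝ≥0∞) := by
  simp_rw [ENat.toENNReal_eq_tsum]
  exact Measurable.tsum fun n => Measurable.ite (h n) measurable_const measurable_const

open scoped Classical in
theorem lintegral_eq_tsum_measure_lt {Ω : Type*} [MeasurableSpace Ω] (μ : Measure Ω)
    {T : Ω → ℕ∞}
    (h : ∀ n : ℕ, MeasurableSet {ω | (n : ℕ∞) < T ω}) :
    ∫⁻ ω, (T ω : ℝ≥0∞) ∂μ = ∑' n : ℕ, μ {ω | (n : ℕ∞) < T ω} := by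
  simp_rw [ENat.toENNReal_eq_tsum]
  rw [lintegral_tsum fun n =>
    (Measurable.ite (h n) measurable_const measurable_const).aemeasurable]
  refine tsum_congr fun n => ?_
  rw [← lintegral_indicator_one (h n)]
  exact lintegral_congr fun ω => by simp [Set.indicator_apply]

namespace EnergyChain

theorem hitFrom_le_iff {S : Type*} {a : ℕ∞} {A : Set S} {ω : ℕ → S} {n : ℕ} :
    hitFrom a A ω ≤ n ↔ ∃ t ≤ n, a ≤ (t : ℕ∞) ∧ ω t ∈ A := by
  rw [← ENat.sInf_natCast_le_iff (p := fun t => a ≤ (t : ℕ∞) ∧ ω t ∈ A), hitFrom]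
  refine iff_of_eq (congrArg (fun s => sInf s ≤ (n : ℕ∞)) (Set.ext fun t => exists_congr fun t' => ?_))
  exact and_congr_right fun h => by rw [h]

theorem hitFrom_eq_iff {S : Type*} {a : ℕ∞} {A : Set S} {ω : ℕ → S} {n : ℕ} :
    hitFrom a A ω = n ↔ (a ≤ (n : ℕ∞) ∧ ω n ∈ A) ∧ ∀ t < n, a ≤ (t : ℕ∞) → ω t ∉ A := by
  have := ENat.sInf_natCast_eq_iff (p := fun t => a ≤ (t : ℕ∞) ∧ ω t ∈ A) (n := n)
  simp only [not_and] at this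
  rw [← this, hitFrom]
  refine iff_of_eq (congrArg (fun s => sInf s = (n : ℕ∞)) (Set.ext fun t => exists_congr fun t' => ?_))
  exact and_congr_right fun h => by rw [h]

variable {S : Type*} [Fintype S] {C : EnergyChain S}

namespace MinimaOrder

variable {O : C.MinimaOrder} {i : ℕ}

theorem firstExit_le_iff {ω : ℕ → S} {n : ℕ} :
    O.firstExit i ω ≤ n ↔ ∃ t ≤ n, ω t ∈ O.nonAssigned i ∧ ∃ s ≤ t, ω s ∉ O.nonAssigned i := by
  rw [firstExit, hitFrom_le_iff]
  refine exists_congr fun t => and_congr_right fun _ => ?_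
  rw [hitFrom_le_iff, and_comm]
  simp

section JumpTime

variable [Nonempty S]

theorem jumpTime_succ_le_iff {k n : ℕ} {ω : ℕ → S} : O.jumpTime i (k + 1) ω ≤ n ↔
    ∃ t ≤ n, O.jumpTime i k ω < (t : ℕ∞) ∧ O.aggregated i t ω ≠ O.aggregated i (t - 1) ω := by
  rw [← ENat.sInf_natCast_le_iff (p := fun t => O.jumpTime i k ω < (t : ℕ∞) ∧
    O.aggregated i t ω ≠ O.aggregated i (t - 1) ω), jumpTime]
  refine iff_of_eq (congrArg (fun s => sInf s ≤ (n : ℕ∞)) (Set.ext fun t => exists_congr fun t' => ?_))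
  exact and_congr_right fun h => by rw [h]

theorem jumpTime_succ_eq_iff {k n : ℕ} {ω : ℕ → S} : O.jumpTime i (k + 1) ω = n ↔
    (O.jumpTime i k ω < (n : ℕ∞) ∧ O.aggregated i n ω ≠ O.aggregated i (n - 1) ω) ∧
      ∀ t < n, O.jumpTime i k ω < (t : ℕ∞) → O.aggregated i t ω = O.aggregated i (t - 1) ω := by
  have := ENat.sInf_natCast_eq_iff (p := fun t => O.jumpTime i k ω < (t : ℕ∞) ∧
    O.aggregated i t ω ≠ O.aggregated i (t - 1) ω) (n := n)
  simp only [not_and, not_not] at this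
  rw [← this, jumpTime]
  refine iff_of_eq (congrArg (fun s => sInf s = (n : ℕ∞)) (Set.ext fun t => exists_congr fun t' => ?_))
  exact and_congr_right fun h => by rw [h]

/-- This is the stopping time property: whether σ_k equals t is decided by the coordinates up to t.
-/
theorem jumpTime_congr (k : ℕ) : ∀ {t : ℕ} {ω ω' : ℕ → S}, (∀ j ≤ t, ω j = ω' j) →
    O.jumpTime i k ω = t → O.jumpTime i k ω' = t := by
  induction k with
  | zero => intro t ω ω' _ h; exact h
  | succ k ih =>
    intro t ω ω' hω h
    rw [jumpTime_succ_eq_iff] at h ⊢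
    obtain ⟨⟨h1, h2⟩, h3⟩ := h
    obtain ⟨s, hs⟩ := ENat.ne_top_iff_exists.1 h1.ne_top
    have hst : s < t := by rw [← hs] at h1; exact ENat.natCast_lt_natCast.1 h1
    have hs' := ih (fun j hj => hω j (by omega)) hs.symm
    have hagg : ∀ j ≤ t, O.aggregated i j ω' = O.aggregated i j ω := fun j hj => by
      simp only [aggregated, hω j hj]
    refine ⟨⟨by rw [hs']; exact ENat.natCast_lt_natCast.2 hst, ?_⟩, fun u hu hlt => ?_⟩
    · rw [hagg t le_rfl, hagg _ (by omega)]; exact h2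
    · rw [hagg u hu.le, hagg _ (by omega)]
      exact h3 u hu (by rw [← hs]; rwa [hs'] at hlt)

theorem accelerated_eq (k : ℕ) (ω : ℕ → S) :
    O.accelerated i k ω = O.toMetastate i (O.entrance i k ω) := rfl

theorem jumpTime_one_eq_iff {n : ℕ} {ω : ℕ → S} : O.jumpTime i 1 ω = n ↔
    (0 < n ∧ O.aggregated i n ω ≠ O.aggregated i (n - 1) ω) ∧
      ∀ t < n, 0 < t → O.aggregated i t ω = O.aggregated i (t - 1) ω := by
  rw [jumpTime_succ_eq_iff]
  simp [jumpTime]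

theorem jumpTime_succ_eq_add_iff {k t u : ℕ} {ω : ℕ → S} (h : O.jumpTime i k ω = t) :
    O.jumpTime i (k + 1) ω = (t + u : ℕ) ↔ O.jumpTime i 1 (fun l => ω (t + l)) = u := by
  rw [jumpTime_succ_eq_iff, jumpTime_one_eq_iff, h]
  simp only [ENat.natCast_lt_natCast]
  have hagg : ∀ u, O.aggregated i u (fun l => ω (t + l)) = O.aggregated i (t + u) ω := fun _ => rfl
  simp only [hagg]
  constructor
  · rintro ⟨⟨h1, h2⟩, h3⟩
    refine ⟨⟨by omega, ?_⟩, fun v hv hv0 => ?_⟩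
    · rwa [← Nat.add_sub_assoc (by omega)]
    · rw [← Nat.add_sub_assoc (by omega)]
      exact h3 _ (by omega) (by omega)
  · rintro ⟨⟨h1, h2⟩, h3⟩
    refine ⟨⟨by omega, ?_⟩, fun v hv hv0 => ?_⟩
    · rwa [Nat.add_sub_assoc (by omega)]
    · obtain ⟨w, rfl⟩ := Nat.exists_eq_add_of_lt hv0
      have := h3 (w + 1) (by omega) (by omega)
      rwa [← Nat.add_sub_assoc (by omega)] at this

theorem le_jumpTime_succ {k t : ℕ} {ω : ℕ → S} (h : O.jumpTime i k ω = t) :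
    (t : ℕ∞) ≤ O.jumpTime i (k + 1) ω := by
  by_contra! hlt
  obtain ⟨s, hs⟩ := ENat.ne_top_iff_exists.1 hlt.ne_top
  have := (jumpTime_succ_eq_iff.1 hs.symm).1.1
  rw [h] at this
  rw [← hs] at hlt
  exact lt_asymm hlt this

theorem lt_jumpTime_one_iff {n : ℕ} {ω : ℕ → S} :
    (n : ℕ∞) < O.jumpTime i 1 ω ↔ ∀ t ≤ n, O.toMetastate i (ω t) = O.toMetastate i (ω 0) := by
  rw [← not_le, jumpTime_succ_le_iff]
  simp only [jumpTime, not_exists, not_and, not_not, aggregated]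
  constructor
  · intro h t
    induction t with
    | zero => intro _; rfl
    | succ t ih =>
      intro ht
      have := h (t + 1) ht (by simp)
      rw [this]
      exact ih (by omega)
  · intro h t ht _
    rw [h t ht, h (t - 1) (by omega)]

theorem accelerated_one_prepend_of_ne {x : S} {ω : ℕ → S}
    (h : O.toMetastate i (ω 0) ≠ O.toMetastate i x) :
    O.accelerated i 1 (prepend x ω) = O.toMetastate i (ω 0) := by
  have : O.jumpTime i 1 (prepend x ω) = (1 : ℕ) := by
    rw [jumpTime_one_eq_iff]
    refine ⟨⟨one_pos, h⟩, fun t ht ht0 => by omega⟩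
  simp only [accelerated, this, ENat.toNat_natCast]
  rfl

theorem accelerated_one_prepend_of_eq {x : S} {ω : ℕ → S}
    (h : O.toMetastate i (ω 0) = O.toMetastate i x) :
    O.accelerated i 1 (prepend x ω) = O.accelerated i 1 ω := by
  have hagg : ∀ t, O.aggregated i (t + 1) (prepend x ω) = O.aggregated i t ω := fun _ => rfl
  have hsucc : ∀ t : ℕ, O.jumpTime i 1 ω = t ↔ O.jumpTime i 1 (prepend x ω) = (t + 1 : ℕ) := by
    intro t
    rw [jumpTime_one_eq_iff, jumpTime_one_eq_iff]
    rcases t with _ | t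
    · simp [aggregated, h]
    · simp only [Nat.add_sub_cancel, hagg]
      refine and_congr (by simp) ⟨fun h' s hs hs0 => ?_, fun h' s hs hs0 => ?_⟩
      · rcases s with _ | _ | s
        · omega
        · exact h
        · exact h' (s + 1) (by omega) (by omega)
      · have := h' (s + 1) (by omega) (by omega)
        obtain ⟨s, rfl⟩ := Nat.exists_eq_succ_of_ne_zero hs0.ne'
        exact this
  -- On an infinite jump time `toNat` gives 0, so both sides are the metastate of the initial
  -- position, and these agree by hypothesis.
  by_cases htop : O.jumpTime i 1 ω = ⊤
  · have : O.jumpTime i 1 (prepend x ω) = ⊤ := by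
      by_contra hne
      obtain ⟨s, hs⟩ := ENat.ne_top_iff_exists.1 hne
      have hs0 := (jumpTime_one_eq_iff.1 hs.symm).1.1
      obtain ⟨s, rfl⟩ := Nat.exists_eq_succ_of_ne_zero hs0.ne'
      have := (hsucc s).2 hs.symm
      rw [htop] at this
      exact ENat.top_ne_natCast s this
    simp only [accelerated, this, htop]
    exact h.symm
  · obtain ⟨s, hs⟩ := ENat.ne_top_iff_exists.1 htop
    have := (hsucc s).1 hs.symm
    simp only [accelerated, this, ← hs, ENat.toNat_natCast]
    rfl

end JumpTime

end MinimaOrder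

/-! ### Exit times under the law of the chain. -/

section Law

variable [MeasurableSpace S] [MeasurableSingletonClass S]

open scoped Classical

theorem toReal_law_eq_sum {β : ℝ} (hβ : 0 < β) (x : S) {B : Set (ℕ → S)} (hB : MeasurableSet B) :
    (C.law β x B).toReal = ∑ y, (C.rev β).p x y * (C.law β y (prepend x ⁻¹' B)).toReal := by
  rw [C.law_apply_eq_sum β x hB, ENNReal.toReal_sum]
  · exact Finset.sum_congr rfl fun y _ => by rw [ENNReal.toReal_mul, C.rev_p hβ]
  · exact fun y _ => ENNReal.mul_ne_top ((C.P β x).apply_ne_top y) (measure_ne_top _ _)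

theorem law_univ_of_start (β : ℝ) {x : S} {A : Set (ℕ → S)} (h : ∀ ω : ℕ → S, ω 0 = x → ω ∈ A) :
    C.law β x A = 1 := by
  rw [C.law_congr β x (B := Set.univ) fun ω hω => by simp [h ω hω], measure_univ]

theorem law_empty_of_start (β : ℝ) {x : S} {A : Set (ℕ → S)} (h : ∀ ω : ℕ → S, ω 0 = x → ω ∉ A) :
    C.law β x A = 0 := by
  rw [C.law_congr β x (B := ∅) fun ω hω => by simp [h ω hω], measure_empty]

theorem measurableSet_stay (D : Set S) (n : ℕ) : MeasurableSet {ω : ℕ → S | ∀ t ≤ n, ω t ∈ D} :=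
  DeterminedBy.measurableSet (n := n) fun _ _ h hω t ht => h t ht ▸ hω t ht

theorem toReal_law_stay {β : ℝ} (hβ : 0 < β) {D : Set S} (n : ℕ) {x : S} (hx : x ∈ D) :
    (C.law β x {ω | ∀ t ≤ n, ω t ∈ D}).toReal = ∑ y, ((C.rev β).killed D ^ n) x y := by
  induction n generalizing x with
  | zero =>
    rw [law_univ_of_start β fun ω hω t ht => by rw [Nat.le_zero.1 ht, hω]; exact hx]
    simp [Matrix.one_apply]
  | succ n ih =>
    rw [toReal_law_eq_sum hβ x (measurableSet_stay D _)]
    simp_rw [pow_succ', Matrix.mul_apply]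
    rw [Finset.sum_comm]
    simp_rw [← Finset.mul_sum]
    refine Finset.sum_congr rfl fun y _ => ?_
    by_cases hy : y ∈ D
    · rw [(C.rev β).killed_of_mem hx hy, ← ih hy]
      congr 3
      ext ω
      constructor
      · intro h t ht
        exact h (t + 1) (by omega)
      · intro h t ht
        cases t with
        | zero => exact hx
        | succ t => exact h t (by omega)
    · rw [(C.rev β).killed_of_notMem_right hy, law_empty_of_start β]
      · simp
      · intro ω hω h
        exact hy (hω ▸ h 1 (by omega))

/-- The tail sum of the expectation is the series of row sums of powers of the killed matrix. Only
the probabilities of the tails enter, so the result covers both ζ_0, which is an exit time merely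
almost surely, and σ_1. -/
theorem lintegral_exitTime {β : ℝ} (hβ : 0 < β) {D : Set S} (hD : D ≠ Set.univ)
    {T : (ℕ → S) → ℕ∞} (hT : ∀ n : ℕ, MeasurableSet {ω | (n : ℕ∞) < T ω}) {x : S} (hx : x ∈ D)
    (h : ∀ n : ℕ, C.law β x {ω | (n : ℕ∞) < T ω} = C.law β x {ω | ∀ t ≤ n, ω t ∈ D}) :
    ∫⁻ ω, (T ω : ℝ≥0∞) ∂(C.law β x) = ENNReal.ofReal (∑ y, (C.rev β).green D x y) := by
  have hs : ∀ y, Summable fun n => ((C.rev β).killed D ^ n) x y := by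
    intro y
    by_cases hy : y ∈ D
    · exact (C.rev β).summable_killed_pow hD x hy
    · simp [(C.rev β).killed_pow_of_notMem_right hx hy, summable_zero]
  rw [lintegral_eq_tsum_measure_lt _ hT]
  unfold ReversibleMatrix.green
  rw [← Summable.tsum_finsetSum fun y _ => hs y, ENNReal.ofReal_tsum_of_nonneg]
  · refine tsum_congr fun n => ?_
    rw [h n, ← toReal_law_stay hβ n hx, ENNReal.ofReal_toReal (measure_ne_top _ _)]
  · exact fun n => Finset.sum_nonneg fun y _ => (C.rev β).killed_pow_nonneg D n x y
  · exact summable_sum fun y _ => hs y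

theorem law_coord_one (β : ℝ) (a b : S) : C.law β a {ω | ω 1 = b} = C.P β a b := by
  rw [C.law_apply_eq_sum β a (measurableSet_coord_eq 1 b), Finset.sum_eq_single b]
  · rw [law_univ_of_start β (A := prepend a ⁻¹' {ω | ω 1 = b}) fun ω hω => hω, mul_one]
  · intro y _ hy
    rw [law_empty_of_start β (A := prepend a ⁻¹' {ω | ω 1 = b}) fun ω hω h =>
      hy (hω.symm.trans h), mul_zero]
  · simp

/-- Needed to argue pathwise with adjacency: for positive β, almost every trajectory moves along
edges of the graph or stays put. -/
theorem ae_step_pos (β : ℝ) (x : S) :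
    ∀ᵐ ω ∂(C.law β x), ∀ t : ℕ, C.P β (ω t) (ω (t + 1)) ≠ 0 := by
  rw [ae_all_iff]
  intro t
  have h : ∀ a b, ∀ᵐ ω ∂(C.law β x), C.P β a b = 0 → ¬ (ω t = a ∧ ω (t + 1) = b) := by
    intro a b
    by_cases hab : C.P β a b = 0
    · have := C.law_inter_shift β a (measurableSet_coord_eq 1 b) t x (A := Set.univ)
        (fun _ _ _ _ => trivial)
      rw [law_coord_one, hab, mul_zero] at this
      rw [ae_iff]
      refine measure_mono_null ?_ this
      intro ω hω
      simp only [Set.mem_ofPred_eq, not_forall, not_not] at hω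
      exact ⟨trivial, hω.2⟩
    · exact .of_forall fun ω h => (hab h).elim
  have h' := ae_all_iff.2 fun a => ae_all_iff.2 fun b => h a b
  filter_upwards [h'] with ω hω h0
  exact hω _ _ h0 ⟨rfl, rfl⟩

end Law

end EnergyChain

/-! ### Residence times and jump probabilities of the cells. -/

namespace EnergyChain

variable {S : Type*} [Fintype S] {C : EnergyChain S}

namespace MinimaOrder

variable {O : C.MinimaOrder} {i : ℕ}

section Residence

open scoped Classical

theorem _root_.ReversibleMatrix.green_singleton (R : ReversibleMatrix S) {s : S}
    (hs : ({s} : Set S) ≠ Set.univ) :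
    R.green {s} s s = (1 - R.p s s)⁻¹ := by
  have hmem : s ∈ ({s} : Set S) := rfl
  have h := R.green_eq_left hs s hmem
  rw [if_pos rfl, Finset.sum_eq_single s, R.killed_of_mem hmem hmem] at h
  · exact eq_inv_of_mul_eq_one_left (by linarith)
  · intro y _ hy
    rw [R.killed_of_notMem_right (D := {s}) hy, zero_mul]
  · simp

theorem sum_pLim (r : S) : ∑ y, C.pLim r y = 1 := by
  refine tendsto_nhds_unique (tendsto_finsetSum _ fun y _ => C.tendsto_pLim r y) ?_
  simp_rw [C.sum_toReal_P]
  exact tendsto_const_nhds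

theorem pLim_nonneg (r s : S) : 0 ≤ C.pLim r s :=
  ge_of_tendsto' (C.tendsto_pLim r s) fun _ => ENNReal.toReal_nonneg

theorem measurableSet_lt_firstExit [MeasurableSpace S] [MeasurableSingletonClass S]
    (n : ℕ) :
    MeasurableSet {ω : ℕ → S | (n : ℕ∞) < O.firstExit i ω} := by
  refine DeterminedBy.measurableSet (n := n) fun ω ω' h hω => ?_
  simp only [Set.mem_ofPred_eq, ← not_le, firstExit_le_iff] at hω ⊢
  rintro ⟨t, ht, h1, s, hs, h2⟩
  exact hω ⟨t, ht, h t ht ▸ h1, s, hs, h s (hs.trans ht) ▸ h2⟩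

/-- Local minima are always assigned, so s has a neighbour of no larger energy, to which a positive
limiting probability goes. -/
theorem pLim_self_lt_one (hi : 1 ≤ i) {s : S} (hs : s ∈ O.nonAssigned i) : C.pLim s s < 1 := by
  have hmin : s ∉ C.localMinima := fun h => by
    obtain ⟨j, hj, rfl⟩ := O.bijOn.surjOn h
    exact hs j hj.1 hj.2 (bottom_mem_valley hi hj.1 hj.2)
  have hmin' : ∃ u, C.G.Adj s u ∧ C.E u ≤ C.E s := by
    by_contra! h
    exact hmin fun r hr => h r hr
  obtain ⟨u, hu, hE⟩ := hmin'
  have h1 := C.pLim_pos s u (Or.inr hu) hE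
  have h2 : ∑ y ∈ {s, u}, C.pLim s y ≤ 1 := by
    rw [← sum_pLim (C := C) s]
    exact Finset.sum_le_sum_of_subset_of_nonneg (Finset.subset_univ _)
      fun y _ _ => pLim_nonneg s y
  rw [Finset.sum_pair hu.ne] at h2
  linarith

theorem tendsto_sum_green_singleton (hi : 1 ≤ i) {s : S} (hs : s ∈ O.nonAssigned i)
    (hne : ({s} : Set S) ≠ Set.univ) :
    Tendsto (fun β => ∑ y, (C.rev β).green {s} s y) atTop (𝓝 (1 - C.pLim s s)⁻¹) := by
  have h : Tendsto (fun β => (1 - (C.rev β).p s s)⁻¹) atTop (𝓝 (1 - C.pLim s s)⁻¹) :=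
    ((C.tendsto_rev_p s s).const_sub 1).inv₀ (by linarith [pLim_self_lt_one hi hs])
  refine h.congr fun β => ?_
  rw [Finset.sum_eq_single s, (C.rev β).green_singleton hne]
  · exact fun y _ hy => (C.rev β).green_of_notMem_right (D := {s}) rfl hy
  · simp

theorem tendsto_log_sum_green_singleton (hi : 1 ≤ i) {s : S} (hs : s ∈ O.nonAssigned i)
    (hne : ({s} : Set S) ≠ Set.univ) :
    Tendsto (fun β => 1 / β * Real.log (∑ y, (C.rev β).green {s} s y)) atTop (𝓝 0) := by
  have hpos : (1 - C.pLim s s)⁻¹ ≠ 0 := inv_ne_zero (by linarith [pLim_self_lt_one hi hs])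
  have h := (tendsto_sum_green_singleton hi hs hne).log hpos
  have h' : Tendsto (fun β : ℝ => 1 / β) atTop (𝓝 0) := tendsto_const_nhds.div_atTop tendsto_id
  simpa using h'.mul h

/-- Almost surely a trajectory leaving the cell steps into a non-assigned state, because unmerged
valleys are not adjacent; thus ζ_0 is the exit time of the cell. -/
theorem lintegral_firstExit [MeasurableSpace S] [MeasurableSingletonClass S] (hi : 1 ≤ i)
    {m : S} (hm : m ∈ O.metaMinima i) (hne : O.cell i m ≠ Set.univ) {β : ℝ} (hβ : 0 < β) {r : S} (hr : r ∈ O.cell i m) :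
    ∫⁻ ω, (O.firstExit i ω : ℝ≥0∞) ∂(C.law β r) =
      ENNReal.ofReal (∑ y, (C.rev β).green (O.cell i m) r y) := by
  refine lintegral_exitTime hβ hne measurableSet_lt_firstExit hr fun n => measure_congr ?_
  have h0 : ∀ᵐ ω ∂(C.law β r), ω 0 = r := by
    rw [ae_iff, ← Set.compl_ofPred, prob_compl_eq_zero_iff (measurableSet_coord_eq 0 r)]
    exact C.law_start β r
  filter_upwards [h0, ae_step_pos β r] with ω hω hstep
  refine propext (?_ : (n : ℕ∞) < O.firstExit i ω ↔ ∀ t ≤ n, ω t ∈ O.cell i m)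
  rw [← not_le, firstExit_le_iff]
  constructor
  · intro h t
    induction t with
    | zero => intro _; rw [hω]; exact hr
    | succ t ih =>
      intro ht
      have h1 := ih (by omega)
      by_contra h2
      have hadj := (C.adj_iff β hβ _ _ (ne_of_mem_of_not_mem h1 h2)).1 (hstep t)
      exact h ⟨t + 1, ht, nonAssigned_of_adj_cell hi hm h1 h2 hadj, t, Nat.le_succ t,
        notMem_nonAssigned_of_mem_cell hi hm h1⟩
  · rintro h ⟨t, ht, h1, -⟩
    exact notMem_nonAssigned_of_mem_cell hi hm (h t ht) h1

variable [Nonempty S]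

/-- Each term is at most G(y,y), and by `reach_exit` the escape from y climbs no more than the
depth, so the energy of y drops out of the bound. -/
theorem sum_green_cell_le (hi : 1 ≤ i) {m : S} (hm : m ∈ O.metaMinima i)
    (hne : O.cell i m ≠ Set.univ) {η β : ℝ} (h : C.Approx η β) {r : S} (hr : r ∈ O.cell i m) :
    ∑ y, (C.rev β).green (O.cell i m) r y ≤
      (Fintype.card S * Fintype.card S ^ 2) *
        Real.exp (β * (C.E (O.exit i m) - C.E m + 2 * η)) := by
  have key : ∀ y, (C.rev β).green (O.cell i m) r y ≤
      Fintype.card S ^ 2 * Real.exp (β * (C.E (O.exit i m) - C.E m + 2 * η)) := by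
    intro y
    by_cases hy : y ∈ O.cell i m
    · refine ((C.rev β).green_le_green_self hne hy r).trans ?_
      refine (h.green_self_le hy (exit_notMem_cell hi hm hne)
        (reach_exit hi hm hne hy)).trans (le_of_eq ?_)
      congr 3
      ring
    · rw [(C.rev β).green_of_notMem_right hr hy]
      positivity
  refine (Finset.sum_le_sum fun y _ => key y).trans ?_
  simp [mul_assoc]

theorem le_green_bottom (hi : 1 ≤ i) {m : S} (hm : m ∈ O.metaMinima i)
    (hne : O.cell i m ≠ Set.univ) {η β : ℝ} (h : C.Approx η β) :
    Real.exp (β * (C.E (O.exit i m) - C.E m - η)) ≤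
      Fintype.card S * (C.rev β).green (O.cell i m) m m :=
  h.le_green_self hne (self_mem_cell hi (Or.inl hm)) fun _ hy _ hw hadj =>
    exit_le_of_adj hi hm hy hw hadj

/-- By the first-visit decomposition, G(r,m) is G(m,m) times the probability of visiting m before
leaving the cell, which eventually exceeds 1/2. -/
theorem eventually_le_green_bottom (hi : 1 ≤ i) {m : S} (hm : m ∈ O.metaMinima i)
    (hne : O.cell i m ≠ Set.univ) {r : S} (hr : r ∈ O.cell i m) {η : ℝ} (hη : 0 < η) :
    ∀ᶠ β in atTop, (2 * Fintype.card S : ℝ)⁻¹ *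
      Real.exp (β * (C.E (O.exit i m) - C.E m - η)) ≤ (C.rev β).green (O.cell i m) r m := by
  have hmem := self_mem_cell hi (Or.inl hm : m ∈ O.metastates i)
  have hN : (0 : ℝ) < Fintype.card S := by exact_mod_cast Fintype.card_pos
  filter_upwards [C.eventually_approx hη, (funnel_cell hi hm hr).eventually
    (lt_mem_nhds (show (1 / 2 : ℝ) < 1 by norm_num))] with β h h'
  rw [(C.rev β).green_eq_exitProb_mul hne hmem]
  have h1 := le_green_bottom hi hm hne h
  have h2 := (C.rev β).green_nonneg (D := O.cell i m) m m
  calc (2 * Fintype.card S : ℝ)⁻¹ * Real.exp (β * (C.E (O.exit i m) - C.E m - η))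
      ≤ (2 * Fintype.card S : ℝ)⁻¹ * (Fintype.card S * (C.rev β).green (O.cell i m) m m) := by
        gcongr
    _ = 1 / 2 * (C.rev β).green (O.cell i m) m m := by field_simp
    _ ≤ _ := by gcongr

theorem tendsto_log_sum_green (hi : 1 ≤ i) {m : S} (hm : m ∈ O.metaMinima i)
    (hne : O.cell i m ≠ Set.univ) {r : S} (hr : r ∈ O.cell i m) :
    Tendsto (fun β => 1 / β * Real.log (∑ y, (C.rev β).green (O.cell i m) r y)) atTop
      (𝓝 (C.E (O.exit i m) - C.E m)) := by
  have hN : (0 : ℝ) < Fintype.card S := by exact_mod_cast Fintype.card_pos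
  refine tendsto_log_div (K₁ := (2 * Fintype.card S : ℝ)⁻¹)
    (K₂ := Fintype.card S * Fintype.card S ^ 2) (by positivity) (by positivity) ?_ ?_
  · intro η hη
    filter_upwards [eventually_le_green_bottom hi hm hne hr hη] with β h
    exact h.trans (Finset.single_le_sum (f := fun y => (C.rev β).green (O.cell i m) r y)
      (fun y _ => (C.rev β).green_nonneg r y) (Finset.mem_univ m))
  · intro η hη
    filter_upwards [C.eventually_approx (half_pos hη)] with β h
    refine (sum_green_cell_le hi hm hne h hr).trans (le_of_eq ?_)
    congr 3
    ring

variable [MeasurableSpace S] [MeasurableSingletonClass S]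

theorem measurableSet_lt_jumpTime_one (n : ℕ) :
    MeasurableSet {ω : ℕ → S | (n : ℕ∞) < O.jumpTime i 1 ω} := by
  refine DeterminedBy.measurableSet (n := n) fun ω ω' h hω => ?_
  simp only [Set.mem_ofPred_eq, lt_jumpTime_one_iff] at hω ⊢
  intro t ht
  rw [← h t ht, ← h 0 (Nat.zero_le n)]
  exact hω t ht

theorem lintegral_jumpTime_one (hi : 1 ≤ i) {r : S} (hr : r ∈ O.metastates i)
    (hne : O.cell i r ≠ Set.univ) {β : ℝ} (hβ : 0 < β) {x : S} (hx : x ∈ O.cell i r) :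
    ∫⁻ ω, (O.jumpTime i 1 ω : ℝ≥0∞) ∂(C.law β x) =
      ENNReal.ofReal (∑ y, (C.rev β).green (O.cell i r) x y) := by
  refine lintegral_exitTime hβ hne measurableSet_lt_jumpTime_one hx fun n =>
    C.law_congr β x fun ω hω => ?_
  simp only [Set.mem_ofPred_eq, lt_jumpTime_one_iff]
  rw [hω, (toMetastate_eq_iff hi hr).2 hx]
  simp only [toMetastate_eq_iff hi hr]

theorem law_jumpTime_one_eq_top (hi : 1 ≤ i) (hne : ∀ r ∈ O.metastates i, O.cell i r ≠ Set.univ)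
    {β : ℝ} (hβ : 0 < β) (x : S) : C.law β x {ω | O.jumpTime i 1 ω = ⊤} = 0 := by
  obtain ⟨hr, hx⟩ := toMetastate_spec (O := O) hi x
  have h := lintegral_jumpTime_one hi hr (hne _ hr) hβ hx
  have h' := ae_lt_top (measurable_of_forall_natCast
    (measurableSet_lt_jumpTime_one (O := O) (i := i))) (h ▸ ENNReal.ofReal_ne_top)
  rw [ae_iff] at h'
  refine measure_mono_null (fun ω hω => ?_) h'
  simp only [Set.mem_ofPred_eq] at hω ⊢
  rw [hω]
  simp

theorem measurableSet_jumpTime_eq (k t : ℕ) :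
    MeasurableSet {ω : ℕ → S | O.jumpTime i k ω = t} :=
  DeterminedBy.measurableSet (n := t) fun _ _ h hω => jumpTime_congr k h hω

theorem measurable_jumpTime (k : ℕ) : Measurable (O.jumpTime i k) := by
  have h : ∀ t : ℕ, MeasurableSet (O.jumpTime i k ⁻¹' {(t : ℕ∞)}) := fun t =>
    measurableSet_jumpTime_eq k t
  refine measurable_to_countable' fun a => ?_
  induction a using ENat.recTopCoe with
  | coe t => exact h t
  | top =>
    have : O.jumpTime i k ⁻¹' {⊤} = (⋃ t : ℕ, O.jumpTime i k ⁻¹' {(t : ℕ∞)})ᶜ := by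
      ext ω
      simp only [Set.mem_preimage, Set.mem_singleton_iff, Set.mem_compl_iff, Set.mem_iUnion]
      rw [← not_iff_not, not_not, ← Ne, ENat.ne_top_iff_exists]
      simp only [eq_comm]
    rw [this]
    exact (MeasurableSet.iUnion h).compl

theorem measurable_entrance (k : ℕ) : Measurable (O.entrance i k) := by
  refine measurable_to_countable' fun x => ?_
  have : O.entrance i k ⁻¹' {x} = ⋃ t : ℕ, {ω | (O.jumpTime i k ω).toNat = t} ∩ {ω | ω t = x} := by
    ext ω
    simp [entrance]
  rw [this]
  refine MeasurableSet.iUnion fun t => MeasurableSet.inter ?_ (measurableSet_coord_eq t x)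
  exact (measurable_of_countable ENat.toNat).comp (measurable_jumpTime k) (measurableSet_singleton t)

theorem measurableSet_accelerated (k : ℕ) (s : S) :
    MeasurableSet {ω : ℕ → S | O.accelerated i k ω = s} :=
  (measurable_of_finite (O.toMetastate i)).comp (measurable_entrance k) (measurableSet_singleton s)

/-- As a function of the starting point, the left side is harmonic in the cell; extended by the
indicator of landing in s outside, it is determined by the exit distribution. -/
theorem law_accelerated_one (hi : 1 ≤ i) {r : S} (hr : r ∈ O.metastates i)
    (hne : O.cell i r ≠ Set.univ) {β : ℝ} (hβ : 0 < β) {x : S} (hx : x ∈ O.cell i r) (s : S) :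
    (C.law β x {ω | O.accelerated i 1 ω = s}).toReal =
      ∑ w, (C.rev β).exitProb (O.cell i r) x w * if O.toMetastate i w = s then 1 else 0 := by
  set D := O.cell i r
  have hD : ∀ y, O.toMetastate i y = r ↔ y ∈ D := fun y => toMetastate_eq_iff hi hr
  have h := (C.rev β).sum_exitProb_mul_eq hne (f := fun y =>
    if y ∈ D then (C.law β y {ω | O.accelerated i 1 ω = s}).toReal else
      if O.toMetastate i y = s then 1 else 0) ?_ x
  · simp only [if_pos hx] at h
    rw [← h]
    refine Finset.sum_congr rfl fun w _ => ?_
    by_cases hw : w ∈ D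
    · simp only [(C.rev β).exitProb_of_mem_right hw, zero_mul]
    · simp only [if_neg hw]
  · intro y hy
    simp only [if_pos hy]
    rw [toReal_law_eq_sum hβ y (measurableSet_accelerated 1 s)]
    refine Finset.sum_congr rfl fun z _ => ?_
    congr 1
    split_ifs with hz hzs
    · rw [C.law_congr β z (A := prepend y ⁻¹' _) (B := {ω | O.accelerated i 1 ω = s})]
      intro ω hω
      simp only [Set.mem_preimage, Set.mem_ofPred_eq]
      rw [accelerated_one_prepend_of_eq]
      rw [hω, (hD z).2 hz, (hD y).2 hy]
    · rw [law_univ_of_start β, ENNReal.toReal_one]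
      intro ω hω
      simp only [Set.mem_preimage, Set.mem_ofPred_eq]
      rw [accelerated_one_prepend_of_ne, hω, hzs]
      rw [hω, (hD y).2 hy]
      exact fun h => hz ((hD z).1 h)
    · rw [law_empty_of_start β, ENNReal.toReal_zero]
      intro ω hω
      simp only [Set.mem_preimage, Set.mem_ofPred_eq]
      rw [accelerated_one_prepend_of_ne, hω]
      · exact hzs
      rw [hω, (hD y).2 hy]
      exact fun h => hz ((hD z).1 h)

/-- The jump probabilities between cells do not depend on the point of entrance. -/
theorem tendsto_law_accelerated_one (hi : 1 ≤ i) {r s : S} (hr : r ∈ O.metastates i)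
    (hs : s ∈ O.metastates i) (hne : O.cell i r ≠ Set.univ) {x : S} (hx : x ∈ O.cell i r) :
    Tendsto (fun β => (C.law β x {ω | O.accelerated i 1 ω = s}).toReal) atTop
      (𝓝 (O.jumpProb i r s)) := by
  have hev : (fun β => ∑ w, (C.rev β).exitProb (O.cell i r) x w *
      if O.toMetastate i w = s then 1 else 0) =ᶠ[atTop]
      fun β => (C.law β x {ω | O.accelerated i 1 ω = s}).toReal := by
    filter_upwards [eventually_gt_atTop 0] with β hβ
    exact (law_accelerated_one hi hr hne hβ hx s).symm
  refine Tendsto.congr' hev ?_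
  rcases hr with hm | hN
  · have h1 := tendsto_exitProb_exit hi hm hne hx
    have h0 : ∀ w, w ≠ O.exit i r →
        Tendsto (fun β => (C.rev β).exitProb (O.cell i r) x w) atTop (𝓝 0) := by
      intro w hw
      have h2 := Tendsto.const_sub 1 h1
      rw [sub_self] at h2
      refine squeeze_zero (fun β => (C.rev β).exitProb_nonneg x w) (fun β => ?_) h2
      have h3 : ∑ u ∈ {w, O.exit i r}, (C.rev β).exitProb (O.cell i r) x u ≤ 1 := by
        rw [← (C.rev β).sum_exitProb hne x]
        exact Finset.sum_le_sum_of_subset_of_nonneg (Finset.subset_univ _)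
          fun u _ _ => (C.rev β).exitProb_nonneg x u
      rw [Finset.sum_pair hw] at h3
      linarith
    have hexit := exit_mem_nonAssigned hi hm hne
    -- The exit state is non-assigned and hence its own metastate, so concentration of the exit law
    -- at it selects exactly s = s_r.
    have htm : O.toMetastate i (O.exit i r) = O.exit i r :=
      (toMetastate_eq_iff hi (Or.inr hexit)).2 (self_mem_cell hi (Or.inr hexit))
    have hlim : O.jumpProb i r s = ∑ w, (if w = O.exit i r then (1 : ℝ) else 0) *
        if O.toMetastate i w = s then 1 else 0 := by
      simp only [ite_mul, one_mul, zero_mul, Finset.sum_ite_eq', Finset.mem_univ, if_true, htm]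
      rw [jumpProb, if_neg (metaMinima_notMem_nonAssigned hi hm)]
      simp only [eq_comm]
    rw [hlim]
    refine tendsto_finsetSum _ fun w _ => Tendsto.mul_const _ ?_
    split_ifs with hw
    · rw [hw]; exact h1
    · exact h0 w hw
  · have hc := cell_nonAssigned hi hN
    rw [hc] at hne hx ⊢
    obtain rfl : x = r := hx
    rw [jumpProb, if_pos hN, Finset.sum_div]
    refine tendsto_finsetSum _ fun w _ => ?_
    -- For a singleton cell the exit law is explicit: the holding time is geometric, so exit at w
    -- has probability p(x,w)/(1 - p(x,x)).
    have hlim : Tendsto (fun β => (1 - (C.rev β).p x x)⁻¹ * (C.rev β).p x w) atTop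
        (𝓝 ((1 - C.pLim x x)⁻¹ * C.pLim x w)) :=
      (((C.tendsto_rev_p x x).const_sub 1).inv₀ (by linarith [pLim_self_lt_one hi hN])).mul
        (C.tendsto_rev_p x w)
    by_cases hw : w ∈ O.cell i s ∧ w ≠ x
    · rw [if_pos hw, if_pos ((toMetastate_eq_iff hi hs).2 hw.1), div_eq_inv_mul]
      refine hlim.congr fun β => ?_
      rw [(C.rev β).exitProb_of_mem (D := {x}) rfl hw.2, mul_one, Finset.sum_eq_single x,
        (C.rev β).green_singleton hne]
      · intro y _ hy
        rw [(C.rev β).green_of_notMem_right (D := {x}) rfl hy, zero_mul]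
      · simp
    · rw [if_neg hw, zero_div]
      refine tendsto_const_nhds.congr fun β => ?_
      by_cases hwx : w = x
      · rw [hwx, (C.rev β).exitProb_of_mem_right (D := {x}) rfl, zero_mul]
      · rw [if_neg, mul_zero]
        exact fun h => hw ⟨(toMetastate_eq_iff hi hs).1 h, hwx⟩

end Residence

end MinimaOrder

end EnergyChain

/-! ### The strong Markov property and conditioning on the history. -/

namespace EnergyChain

variable {S : Type*} [Fintype S] {C : EnergyChain S}

namespace MinimaOrder

variable {O : C.MinimaOrder} {i : ℕ}

section StrongMarkov

variable [Nonempty S]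

theorem jumpTime_succ_eq_top {k t : ℕ} {ω : ℕ → S} (h : O.jumpTime i k ω = t) :
    O.jumpTime i (k + 1) ω = ⊤ ↔ O.jumpTime i 1 (fun l => ω (t + l)) = ⊤ := by
  constructor
  · intro h'
    by_contra hne
    obtain ⟨u, hu⟩ := ENat.ne_top_iff_exists.1 hne
    have := (jumpTime_succ_eq_add_iff h).2 hu.symm
    rw [h'] at this
    exact ENat.top_ne_natCast _ this
  · intro h'
    by_contra hne
    obtain ⟨u, hu⟩ := ENat.ne_top_iff_exists.1 hne
    have hle := le_jumpTime_succ h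
    rw [← hu] at hle
    obtain ⟨v, rfl⟩ := Nat.exists_eq_add_of_le (ENat.natCast_le_natCast.1 hle)
    have := (jumpTime_succ_eq_add_iff h).1 hu.symm
    rw [h'] at this
    exact ENat.top_ne_natCast _ this

theorem accelerated_succ_of_ne_top {k t : ℕ} {ω : ℕ → S} (h : O.jumpTime i k ω = t)
    (hne : O.jumpTime i (k + 1) ω ≠ ⊤) :
    O.accelerated i (k + 1) ω = O.accelerated i 1 (fun l => ω (t + l)) := by
  obtain ⟨u, hu⟩ := ENat.ne_top_iff_exists.1 hne
  have hle := le_jumpTime_succ h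
  rw [← hu] at hle
  obtain ⟨v, rfl⟩ := Nat.exists_eq_add_of_le (ENat.natCast_le_natCast.1 hle)
  have hv := (jumpTime_succ_eq_add_iff h).1 hu.symm
  simp only [accelerated, ← hu, hv, ENat.toNat_natCast]
  rfl

theorem jumpTime_mono {j k : ℕ} (hjk : j ≤ k) (ω : ℕ → S) :
    O.jumpTime i j ω ≤ O.jumpTime i k ω := by
  induction k, hjk using Nat.le_induction with
  | base => exact le_rfl
  | succ k _ ih =>
    refine ih.trans ?_
    by_contra! h
    obtain ⟨s, hs⟩ := ENat.ne_top_iff_exists.1 h.ne_top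
    have := (jumpTime_succ_eq_iff.1 hs.symm).1.1
    rw [← hs] at h
    exact lt_asymm h this

theorem determinedBy_history (k : ℕ) (y : ℕ → S) (t : ℕ) :
    DeterminedBy t ({ω | ∀ j ≤ k, O.accelerated i j ω = y j} ∩ {ω | O.jumpTime i k ω = t}) := by
  rintro ω ω' h ⟨h1, h2⟩
  refine ⟨fun j hj => ?_, jumpTime_congr k h h2⟩
  have hle := jumpTime_mono (O := O) (i := i) hj ω
  rw [show O.jumpTime i k ω = t from h2] at hle
  obtain ⟨s, hs⟩ := ENat.ne_top_iff_exists.1 (hle.trans_lt (ENat.natCast_lt_top t)).ne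
  rw [← hs] at hle
  have hst := ENat.natCast_le_natCast.1 hle
  have hs' := jumpTime_congr j (fun l hl => h l (by omega)) hs.symm
  rw [← h1 j hj]
  simp only [accelerated, hs', ← hs, ENat.toNat_natCast, aggregated, h s hst]

variable [MeasurableSpace S] [MeasurableSingletonClass S]

theorem measurableSet_jumpTime_eq_top (k : ℕ) :
    MeasurableSet {ω : ℕ → S | O.jumpTime i k ω = ⊤} :=
  measurable_jumpTime k (measurableSet_singleton ⊤)

theorem law_jumpTime_eq_top (hi : 1 ≤ i) (hne : ∀ r ∈ O.metastates i, O.cell i r ≠ Set.univ)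
    {β : ℝ} (hβ : 0 < β) (x : S) (k : ℕ) : C.law β x {ω | O.jumpTime i k ω = ⊤} = 0 := by
  induction k with
  | zero => simp [jumpTime]
  | succ k ih =>
    have h : ∀ t : ℕ, ∀ a : S, C.law β x {ω | ω ∈ {ω : ℕ → S | O.jumpTime i k ω = t} ∧ ω t = a ∧
        (fun l => ω (t + l)) ∈ {ω : ℕ → S | O.jumpTime i 1 ω = ⊤}} = 0 := by
      intro t a
      have := C.law_inter_shift β a (measurableSet_jumpTime_eq_top (O := O) (i := i) 1) t x
        (A := {ω | O.jumpTime i k ω = (t : ℕ∞)}) (fun _ _ h hω => jumpTime_congr k h hω)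
      rw [this, law_jumpTime_one_eq_top hi hne hβ, mul_zero]
    refine measure_mono_null (fun ω hω => ?_)
      (measure_union_null ih (measure_iUnion_null fun t => measure_iUnion_null fun a => h t a))
    by_cases htop : O.jumpTime i k ω = ⊤
    · exact Or.inl htop
    · obtain ⟨t, ht⟩ := ENat.ne_top_iff_exists.1 htop
      exact Or.inr (Set.mem_iUnion.2 ⟨t, Set.mem_iUnion.2 ⟨ω t, ht.symm, rfl,
        (jumpTime_succ_eq_top ht.symm).1 hω⟩⟩)

/-- The strong Markov property at the jump times of the aggregated chain. -/
theorem law_inter_accelerated_succ (hi : 1 ≤ i)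
    (hne : ∀ r ∈ O.metastates i, O.cell i r ≠ Set.univ) {β : ℝ} (hβ : 0 < β) (x₀ x s : S) (k : ℕ)
    {H : Set (ℕ → S)} (hH : ∀ t : ℕ, DeterminedBy t (H ∩ {ω | O.jumpTime i k ω = t})) :
    C.law β x₀ {ω | (ω ∈ H ∧ O.entrance i k ω = x) ∧ O.accelerated i (k + 1) ω = s} =
      C.law β x₀ {ω | ω ∈ H ∧ O.entrance i k ω = x} *
        C.law β x {ω | O.accelerated i 1 ω = s} := by
  set A : ℕ → Set (ℕ → S) := fun t => H ∩ {ω | O.jumpTime i k ω = t} with hA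
  -- Finiteness of the jump time is built in because the value of the accelerated chain commutes
  -- with the time shift only then; it costs nothing, since jump times are almost surely finite.
  set B : Set (ℕ → S) := {ω | O.accelerated i 1 ω = s ∧ O.jumpTime i 1 ω ≠ ⊤} with hB
  have hBm : MeasurableSet B :=
    (measurableSet_accelerated 1 s).inter (measurableSet_jumpTime_eq_top 1).compl
  have hshift : ∀ t : ℕ, Measurable fun (ω : ℕ → S) l => ω (t + l) := fun t =>
    measurable_pi_iff.2 fun l => measurable_pi_apply _
  have hfin : ∀ l, ∀ᵐ ω ∂(C.law β x₀), O.jumpTime i l ω ≠ ⊤ := fun l => by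
    rw [ae_iff]
    simpa using law_jumpTime_eq_top hi hne hβ x₀ l
  have hBlaw : C.law β x B = C.law β x {ω | O.accelerated i 1 ω = s} := by
    refine measure_congr ?_
    have : ∀ᵐ ω ∂(C.law β x), O.jumpTime i 1 ω ≠ ⊤ := by
      rw [ae_iff]
      simpa using law_jumpTime_eq_top hi hne hβ x 1
    filter_upwards [this] with ω hω
    exact propext ⟨fun h => h.1, fun h => ⟨h, hω⟩⟩
  have hdisj : ∀ {F : ℕ → Set (ℕ → S)}, Pairwise (Function.onFun Disjoint fun t => A t ∩ F t) := by
    intro F t t' htt'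
    refine Set.disjoint_left.2 fun ω h h' => htt' ?_
    exact ENat.natCast_inj.1 ((show O.jumpTime i k ω = t from h.1.2).symm.trans h'.1.2)
  have hent : ∀ {ω : ℕ → S} {t : ℕ}, O.jumpTime i k ω = t → O.entrance i k ω = ω t := by
    intro ω t h
    simp [entrance, h]
  -- Splitting according to σ_k = t turns the entrance state into X_t and reduces the claim to the
  -- Markov property at the fixed time t.
  have hL : C.law β x₀ {ω | (ω ∈ H ∧ O.entrance i k ω = x) ∧ O.accelerated i (k + 1) ω = s} =
      C.law β x₀ (⋃ t, A t ∩ ({ω | ω t = x} ∩ {ω | (fun l => ω (t + l)) ∈ B})) := by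
    refine measure_congr ?_
    filter_upwards [hfin k, hfin (k + 1)] with ω h1 h2
    obtain ⟨t, ht⟩ := ENat.ne_top_iff_exists.1 h1
    refine propext ⟨fun h => Set.mem_iUnion.2 ⟨t, ⟨h.1.1, ht.symm⟩, ?_, ?_, ?_⟩, fun h => ?_⟩
    · exact (hent ht.symm).symm.trans h.1.2
    · exact (accelerated_succ_of_ne_top ht.symm h2).symm.trans h.2
    · exact fun h' => h2 ((jumpTime_succ_eq_top ht.symm).2 h')
    · obtain ⟨t', ⟨hH', ht'⟩, hx, hs, -⟩ := Set.mem_iUnion.1 h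
      exact ⟨⟨hH', (hent ht').trans hx⟩, (accelerated_succ_of_ne_top ht' h2).trans hs⟩
  have hR : C.law β x₀ {ω | ω ∈ H ∧ O.entrance i k ω = x} =
      C.law β x₀ (⋃ t, A t ∩ {ω | ω t = x}) := by
    refine measure_congr ?_
    filter_upwards [hfin k] with ω h1
    obtain ⟨t, ht⟩ := ENat.ne_top_iff_exists.1 h1
    refine propext ⟨fun h => Set.mem_iUnion.2 ⟨t, ⟨h.1, ht.symm⟩, ?_⟩, fun h => ?_⟩
    · exact (hent ht.symm).symm.trans h.2
    · obtain ⟨t', ⟨hH', ht'⟩, hx⟩ := Set.mem_iUnion.1 h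
      exact ⟨hH', (hent ht').trans hx⟩
  have hm : ∀ t, MeasurableSet (A t ∩ ({ω | ω t = x} ∩ {ω | (fun l => ω (t + l)) ∈ B})) := fun t =>
    (hH t).measurableSet.inter ((measurableSet_coord_eq t x).inter (hshift t hBm))
  have hm' : ∀ t, MeasurableSet (A t ∩ {ω | ω t = x}) := fun t =>
    (hH t).measurableSet.inter (measurableSet_coord_eq t x)
  rw [hL, hR, measure_iUnion hdisj hm, measure_iUnion hdisj hm', ← ENNReal.tsum_mul_right, ← hBlaw]
  exact tsum_congr fun t => C.law_inter_shift β x hBm t x₀ (hH t)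

theorem measurableSet_history (k : ℕ) (y : ℕ → S) :
    MeasurableSet {ω : ℕ → S | ∀ j ≤ k, O.accelerated i j ω = y j} := by
  have : {ω : ℕ → S | ∀ j ≤ k, O.accelerated i j ω = y j} =
      ⋂ j, ⋂ _ : j ≤ k, {ω | O.accelerated i j ω = y j} := by
    ext ω
    simp
  rw [this]
  exact MeasurableSet.iInter fun j => MeasurableSet.iInter fun _ => measurableSet_accelerated j (y j)

theorem cond_entrance_eq (hi : 1 ≤ i) (hne : ∀ r ∈ O.metastates i, O.cell i r ≠ Set.univ) {β : ℝ}
    (hβ : 0 < β) (x₀ x s : S) (k : ℕ) (y : ℕ → S)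
    (h0 : C.law β x₀ {ω | (∀ j ≤ k, O.accelerated i j ω = y j) ∧ O.entrance i k ω = x} ≠ 0) :
    (C.law β x₀)[{ω | O.accelerated i (k + 1) ω = s} |
      {ω | (∀ j ≤ k, O.accelerated i j ω = y j) ∧ O.entrance i k ω = x}] =
      C.law β x {ω | O.accelerated i 1 ω = s} := by
  have hm : MeasurableSet {ω | (∀ j ≤ k, O.accelerated i j ω = y j) ∧ O.entrance i k ω = x} :=
    (measurableSet_history k y).inter (measurable_entrance k (measurableSet_singleton x))
  rw [cond_apply hm]
  have := law_inter_accelerated_succ hi hne hβ x₀ x s k (determinedBy_history (O := O) (i := i) k y)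
  simp only [Set.mem_ofPred_eq] at this
  rw [show {ω : ℕ → S | (∀ j ≤ k, O.accelerated i j ω = y j) ∧ O.entrance i k ω = x} ∩
    {ω | O.accelerated i (k + 1) ω = s} = {ω | ((∀ j ≤ k, O.accelerated i j ω = y j) ∧
      O.entrance i k ω = x) ∧ O.accelerated i (k + 1) ω = s} from rfl, this, ← mul_assoc,
    ENNReal.inv_mul_cancel h0 (measure_ne_top _ _), one_mul]

/-- Given the history, the next jump is a mixture of one-jump laws over the entrance states in the
cell of y_k. The weights depend on β without any control, so they are bounded by one and the
deviations from c are summed. -/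
theorem abs_cond_sub_le (hi : 1 ≤ i) (hne : ∀ r ∈ O.metastates i, O.cell i r ≠ Set.univ) {β : ℝ}
    (hβ : 0 < β) (x₀ s : S) (k : ℕ) (y : ℕ → S) (hy : y k ∈ O.metastates i)
    (h0 : C.law β x₀ {ω | ∀ j ≤ k, O.accelerated i j ω = y j} ≠ 0) (c : ℝ) :
    |((C.law β x₀)[{ω | O.accelerated i (k + 1) ω = s} |
      {ω | ∀ j ≤ k, O.accelerated i j ω = y j}]).toReal - c| ≤
      ∑ x, open scoped Classical in
        if x ∈ O.cell i (y k) then |(C.law β x {ω | O.accelerated i 1 ω = s}).toReal - c| else 0 := by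
  classical
  set H : Set (ℕ → S) := {ω | ∀ j ≤ k, O.accelerated i j ω = y j} with hH
  have hHm : MeasurableSet H := measurableSet_history k y
  set q : S → ℝ := fun x => (C.law β x₀ {ω | ω ∈ H ∧ O.entrance i k ω = x}).toReal with hq
  have hcov : ∀ {F : Set (ℕ → S)}, MeasurableSet F → (C.law β x₀ F).toReal =
      ∑ x, (C.law β x₀ (F ∩ {ω | O.entrance i k ω = x})).toReal := by
    intro F hF
    rw [← ENNReal.toReal_sum fun x _ => measure_ne_top _ _, ← measure_biUnion_finset]
    · congr 2
      ext ω
      simp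
    · intro a _ b _ hab
      exact Set.disjoint_left.2 fun ω h h' => hab (h.2.symm.trans h'.2)
    · exact fun x _ => hF.inter (measurable_entrance k (measurableSet_singleton x))
  have hqsum : (C.law β x₀ H).toReal = ∑ x, q x := hcov hHm
  have hnum : (C.law β x₀ (H ∩ {ω | O.accelerated i (k + 1) ω = s})).toReal =
      ∑ x, q x * (C.law β x {ω | O.accelerated i 1 ω = s}).toReal := by
    rw [hcov (hHm.inter (measurableSet_accelerated (k + 1) s))]
    refine Finset.sum_congr rfl fun x _ => ?_
    rw [hq, ← ENNReal.toReal_mul, ← law_inter_accelerated_succ hi hne hβ x₀ x s k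
      (determinedBy_history (O := O) (i := i) k y)]
    congr 2
    ext ω
    exact ⟨fun h => ⟨⟨h.1.1, h.2⟩, h.1.2⟩, fun h => ⟨⟨h.1.1, h.2⟩, h.1.2⟩⟩
  have hq0 : ∀ x, x ∉ O.cell i (y k) → q x = 0 := by
    intro x hx
    have : {ω | ω ∈ H ∧ O.entrance i k ω = x} = ∅ := by
      refine Set.eq_empty_of_forall_notMem fun ω h => hx ?_
      rw [← toMetastate_eq_iff hi hy, ← h.1 k le_rfl, accelerated_eq, h.2]
    rw [hq]
    simp only [this, measure_empty, ENNReal.toReal_zero]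
  have hHpos : 0 < (C.law β x₀ H).toReal := ENNReal.toReal_pos h0 (measure_ne_top _ _)
  have hqle : ∀ x, q x ≤ (C.law β x₀ H).toReal := fun x => by
    rw [hqsum]
    exact Finset.single_le_sum (f := q) (fun x _ => ENNReal.toReal_nonneg) (Finset.mem_univ x)
  rw [cond_apply hHm, ENNReal.toReal_mul, ENNReal.toReal_inv, hnum]
  have e : (C.law β x₀ H).toReal⁻¹ * ∑ x, q x * (C.law β x {ω | O.accelerated i 1 ω = s}).toReal -
      c = ∑ x, (C.law β x₀ H).toReal⁻¹ * q x *
        ((C.law β x {ω | O.accelerated i 1 ω = s}).toReal - c) := by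
    simp_rw [mul_sub, Finset.sum_sub_distrib, ← Finset.sum_mul, ← Finset.mul_sum]
    rw [← hqsum, inv_mul_cancel₀ hHpos.ne', one_mul, Finset.mul_sum]
    simp only [mul_assoc]
  rw [e]
  refine (Finset.abs_sum_le_sum_abs _ _).trans (Finset.sum_le_sum fun x _ => ?_)
  split_ifs with hx
  · rw [abs_mul]
    refine mul_le_of_le_one_left (abs_nonneg _) ?_
    rw [abs_of_nonneg (mul_nonneg (inv_nonneg.2 hHpos.le) ENNReal.toReal_nonneg),
      inv_mul_le_iff₀ hHpos, mul_one]
    exact hqle x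
  · rw [hq0 x hx]; simp

end StrongMarkov

end MinimaOrder

end EnergyChain

namespace EnergyChain

variable {S : Type*} [Fintype S] {C : EnergyChain S}

namespace MinimaOrder

variable {O : C.MinimaOrder} {i : ℕ}

/-! ### Transitions between valleys -/

variable (O i) in
/-- There is a strictly descending path of non-assigned states from `x` into the cell of `c`. -/
inductive Downhill (c : S) : S → Prop
  | mem {x : S} : x ∈ O.cell i c → Downhill c x
  | step {x y : S} : x ∈ O.nonAssigned i → C.G.Adj x y → C.E y < C.E x → Downhill c y → Downhill c x

/-- Non-assigned states are not local minima, so the energy can be lowered step by step until a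
valley is entered. -/
theorem exists_downhill (hi : 1 ≤ i) (x : S) : ∃ c ∈ O.metaMinima i, O.Downhill i c x := by
  have hwf : WellFounded fun a b : S => C.E a < C.E b := by
    have : IsTrans S fun a b : S => C.E a < C.E b := ⟨fun _ _ _ h h' => h.trans h'⟩
    have : Std.Irrefl fun a b : S => C.E a < C.E b := ⟨fun _ => lt_irrefl _⟩
    exact Finite.wellFounded_of_trans_of_irrefl _
  induction x using hwf.induction with
  | _ x ih =>
    by_cases hx : x ∈ O.nonAssigned i
    · have hmin : x ∉ C.localMinima := fun h => by
        obtain ⟨j, hj, rfl⟩ := O.bijOn.surjOn h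
        exact hx j hj.1 hj.2 (bottom_mem_valley hi hj.1 hj.2)
      have hmin' : ∃ u, C.G.Adj x u ∧ C.E u ≤ C.E x := by
        by_contra! h
        exact hmin fun r hr => h r hr
      obtain ⟨u, hu, hE⟩ := hmin'
      have hE' : C.E u < C.E x := lt_of_le_of_ne hE fun h => hu.ne' (C.E_injective h)
      obtain ⟨c, hc, h⟩ := ih u hE'
      exact ⟨c, hc, .step hx hu hE' h⟩
    · obtain ⟨c, hc, h⟩ := exists_cell_of_notMem_nonAssigned hi hx
      exact ⟨c, hc, .mem h⟩

theorem downhill_of_adj_cell (hi : 1 ≤ i) {c x y : S} (hc : c ∈ O.metaMinima i)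
    (hx : x ∈ O.cell i c) (hy : y ∈ O.nonAssigned i) (h : C.G.Adj y x) : O.Downhill i c y := by
  refine .step hy h ?_ (.mem hx)
  obtain ⟨j, hj, hn, rfl, -⟩ := hc
  rw [cell_m hi hj hn] at hx
  exact energy_lt_of_adj hj hn hx (hy j hj hn) h.symm

/-- Two distinct classes of valleys are joined by an uphill-downhill path through non-assigned
states below the minimal communication height of these classes. -/
theorem exists_downhill_pair (hi : 1 ≤ i) {A B : Set S} (hA : A.Nonempty) (hB : B.Nonempty)
    (hAB : Disjoint A B) (hU : A ∪ B = O.metaMinima i) :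
    ∃ a ∈ A, ∃ b ∈ B, ∃ x ∈ O.nonAssigned i, ∃ y ∈ O.nonAssigned i, O.Downhill i a x ∧
      O.Downhill i b y ∧ (x = y ∨ C.G.Adj x y) ∧ C.E x ≤ C.height a b ∧ C.E y ≤ C.height a b := by
  classical
  obtain ⟨p, hp, hmin⟩ := Finset.exists_min_image
    (Finset.univ.filter fun p : S × S => p.1 ∈ A ∧ p.2 ∈ B) (fun p => C.height p.1 p.2)
    ⟨(hA.some, hB.some), by simp [hA.some_mem, hB.some_mem]⟩
  simp only [Finset.mem_filter, Finset.mem_univ, true_and] at hp hmin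
  obtain ⟨a₀, b₀⟩ := p
  obtain ⟨ha₀, hb₀⟩ := hp
  have hAm : A ⊆ O.metaMinima i := hU ▸ Set.subset_union_left
  have hBm : B ⊆ O.metaMinima i := hU ▸ Set.subset_union_right
  -- On a minimal walk between the closest pair of the two classes, look for the first state with no
  -- descent into a valley of A; it must descend into one of B, while its predecessor descends into
  -- one of A.
  have key : ∃ x y, (∃ a ∈ A, O.Downhill i a x) ∧ (∃ b ∈ B, O.Downhill i b y) ∧
      (x = y ∨ C.G.Adj x y) ∧ C.E x ≤ C.height a₀ b₀ ∧ C.E y ≤ C.height a₀ b₀ := by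
    have hself : ∀ {c}, c ∈ O.metaMinima i → O.Downhill i c c := fun hc =>
      .mem (self_mem_cell hi (Or.inl hc))
    by_cases h : ∃ a ∈ A, O.Downhill i a b₀
    · exact ⟨b₀, b₀, h, ⟨b₀, hb₀, hself (hBm hb₀)⟩, Or.inl rfl, right_le_height _ _,
        right_le_height _ _⟩
    · obtain ⟨u, t, h1, h2, h3, h4⟩ := (reach_height (C := C) a₀ b₀).exists_first_hit
        (B := {x | ¬ ∃ a ∈ A, O.Downhill i a x})
        (fun h' => h' ⟨a₀, ha₀, hself (hAm ha₀)⟩) h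
      refine ⟨u, t, not_not.1 h1.right_mem.2, ?_, Or.inr h2, h1.right_mem.1, h4.left_mem⟩
      obtain ⟨c, hc, hct⟩ := exists_downhill (O := O) hi t
      rw [← hU] at hc
      rcases hc with hc | hc
      · exact (h3 ⟨c, hc, hct⟩).elim
      · exact ⟨c, hc, hct⟩
  obtain ⟨x, y, ⟨a, ha, hax⟩, ⟨b, hb, hby⟩, hxy, hEx, hEy⟩ := key
  have hle := hmin (a, b) ⟨ha, hb⟩
  have hab : a ≠ b := fun h => Set.disjoint_left.1 hAB ha (h ▸ hb)
  refine ⟨a, ha, b, hb, ?_⟩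
  have hcell : ∀ {z}, z ∈ O.cell i a → z ∉ O.cell i b := fun h h' =>
    hab (cell_unique hi (Or.inl (hAm ha)) (Or.inl (hBm hb)) h h')
  have hNd : ∀ {c z}, O.Downhill i c z → z ∈ O.cell i c ∨ z ∈ O.nonAssigned i := by
    intro c z h
    cases h with
    | mem h => exact Or.inl h
    | step h => exact Or.inr h
  -- If one of the two crossing states lies in a valley, the other is a non-assigned neighbour,
  -- descends into both classes, and replaces both.
  rcases hNd hax with hx | hx <;> rcases hNd hby with hy | hy
  · rcases hxy with rfl | hxy
    · exact (hcell hx hy).elim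
    · exact (notMem_nonAssigned_of_mem_cell hi (hBm hb) hy
        (nonAssigned_of_adj_cell hi (hAm ha) hx (fun h => hcell h hy) hxy)).elim
  · rcases hxy with rfl | hxy
    · exact (notMem_nonAssigned_of_mem_cell hi (hAm ha) hx hy).elim
    · exact ⟨y, hy, y, hy, downhill_of_adj_cell hi (hAm ha) hx hy hxy.symm, hby, Or.inl rfl,
        hEy.trans hle, hEy.trans hle⟩
  · rcases hxy with rfl | hxy
    · exact (notMem_nonAssigned_of_mem_cell hi (hBm hb) hy hx).elim
    · exact ⟨x, hx, x, hx, hax, downhill_of_adj_cell hi (hBm hb) hy hx hxy, Or.inl rfl,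
        hEx.trans hle, hEx.trans hle⟩
  · exact ⟨x, hx, y, hy, hax, hby, hxy, hEx.trans hle, hEy.trans hle⟩

variable (O i) in
/-- After the first visit to a non-assigned state, the next valley visited is that of `b`. -/
def entersCell (b : S) : Set (ℕ → S) :=
  {ω | ∃ t, (∃ s ≤ t, ω s ∈ O.nonAssigned i) ∧ ω t ∈ O.cell i b ∧
    ∀ t' < t, (∃ s ≤ t', ω s ∈ O.nonAssigned i) → ω t' ∈ O.nonAssigned i}

/-- From an assigned start, ζ_0 is simply the first visit to a non-assigned state. The event
`entersCell` has the advantage of recording the next valley from non-assigned starts too, which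
permits step-by-step lower bounds. -/
theorem mem_entersCell_iff (hi : 1 ≤ i) {b : S} (hb : b ∈ O.metaMinima i) {ω : ℕ → S}
    (h0 : ω 0 ∉ O.nonAssigned i) :
    ω ∈ O.entersCell i b ↔ ∃ t : ℕ, O.secondEntrance i ω = t ∧ ω t ∈ O.cell i b := by
  have hL : ∀ n : ℕ, O.firstExit i ω ≤ n ↔ ∃ s ≤ n, ω s ∈ O.nonAssigned i := by
    intro n
    rw [firstExit_le_iff]
    exact ⟨fun ⟨t, ht, h, _⟩ => ⟨t, ht, h⟩, fun ⟨t, ht, h⟩ => ⟨t, ht, h, 0, Nat.zero_le t, h0⟩⟩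
  refine exists_congr fun t => ?_
  rw [secondEntrance, hitFrom_eq_iff, hL]
  simp only [hL, Set.mem_compl_iff, not_not]
  constructor
  · rintro ⟨h1, h2, h3⟩
    exact ⟨⟨⟨h1, notMem_nonAssigned_of_mem_cell hi hb h2⟩, h3⟩, h2⟩
  · rintro ⟨⟨⟨h1, -⟩, h3⟩, h2⟩
    exact ⟨h1, h2, h3⟩

theorem prepend_mem_entersCell_iff {b x : S} (hx : x ∉ O.nonAssigned i) {ω : ℕ → S} :
    prepend x ω ∈ O.entersCell i b ↔ ω ∈ O.entersCell i b := by
  have hL : ∀ n, (∃ s ≤ n + 1, prepend x ω s ∈ O.nonAssigned i) ↔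
      ∃ s ≤ n, ω s ∈ O.nonAssigned i := by
    intro n
    constructor
    · rintro ⟨s, hs, h⟩
      cases s with
      | zero => exact (hx h).elim
      | succ s => exact ⟨s, by omega, h⟩
    · rintro ⟨s, hs, h⟩
      exact ⟨s + 1, by omega, h⟩
  constructor
  · rintro ⟨t, h1, h2, h3⟩
    cases t with
    | zero =>
      obtain ⟨s, hs, h⟩ := h1
      obtain rfl : s = 0 := by omega
      exact (hx h).elim
    | succ t => exact ⟨t, (hL t).1 h1, h2, fun t' ht' h => h3 (t' + 1) (by omega) ((hL t').2 h)⟩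
  · rintro ⟨t, h1, h2, h3⟩
    refine ⟨t + 1, (hL t).2 h1, h2, fun t' ht' h => ?_⟩
    cases t' with
    | zero =>
      obtain ⟨s, hs, h⟩ := h
      obtain rfl : s = 0 := by omega
      exact h
    | succ t' => exact h3 t' (by omega) ((hL t').1 h)

theorem prepend_mem_entersCell_of_mem {b x : S} (hx : x ∈ O.nonAssigned i) {ω : ℕ → S}
    (h : ω 0 ∈ O.cell i b ∨ ω 0 ∈ O.nonAssigned i ∧ ω ∈ O.entersCell i b) :
    prepend x ω ∈ O.entersCell i b := by
  rcases h with h | ⟨h0, t, -, h2, h3⟩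
  · refine ⟨1, ⟨0, by omega, hx⟩, h, fun t' ht' _ => ?_⟩
    obtain rfl : t' = 0 := by omega
    exact hx
  · refine ⟨t + 1, ⟨0, by omega, hx⟩, h2, fun t' ht' _ => ?_⟩
    cases t' with
    | zero => exact hx
    | succ t' => exact h3 t' (by omega) ⟨0, by omega, h0⟩

section EntersCell

variable [MeasurableSpace S] [MeasurableSingletonClass S]

theorem measurableSet_entersCell (b : S) : MeasurableSet (O.entersCell i b) := by
  have : O.entersCell i b = ⋃ t, {ω | (∃ s ≤ t, ω s ∈ O.nonAssigned i) ∧ ω t ∈ O.cell i b ∧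
      ∀ t' < t, (∃ s ≤ t', ω s ∈ O.nonAssigned i) → ω t' ∈ O.nonAssigned i} := by
    ext ω
    simp [entersCell]
  rw [this]
  refine MeasurableSet.iUnion fun t => DeterminedBy.measurableSet (n := t) ?_
  rintro ω ω' h ⟨⟨s, hs, h1⟩, h2, h3⟩
  refine ⟨⟨s, hs, h s hs ▸ h1⟩, h t le_rfl ▸ h2, fun t' ht' => ?_⟩
  rintro ⟨s', hs', h'⟩
  exact h t' ht'.le ▸ h3 t' ht' ⟨s', hs', (h s' (by omega)).symm ▸ h'⟩

theorem valleyTransition_eq (hi : 1 ≤ i) (β : ℝ) {a b : S} (ha : a ∈ O.metaMinima i)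
    (hb : b ∈ O.metaMinima i) : O.valleyTransition i β a b = C.law β a (O.entersCell i b) := by
  refine C.law_congr β a fun ω hω => ?_
  exact (mem_entersCell_iff hi hb (hω ▸ metaMinima_notMem_nonAssigned hi ha)).symm

theorem toReal_law_entersCell_eq_sum {β : ℝ} (hβ : 0 < β) {x : S} (hx : x ∉ O.nonAssigned i)
    (b : S) : ∑ y, (C.rev β).p x y * (C.law β y (O.entersCell i b)).toReal =
      (C.law β x (O.entersCell i b)).toReal := by
  rw [toReal_law_eq_sum hβ x (measurableSet_entersCell b)]
  have : prepend x ⁻¹' O.entersCell i b = O.entersCell i b :=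
    Set.ext fun ω => prepend_mem_entersCell_iff hx
  rw [this]

theorem p_mul_le_toReal_law_entersCell {β : ℝ} (hβ : 0 < β) {x y : S} (hx : x ∈ O.nonAssigned i)
    (hy : y ∈ O.nonAssigned i) (b : S) :
    (C.rev β).p x y * (C.law β y (O.entersCell i b)).toReal ≤
      (C.law β x (O.entersCell i b)).toReal := by
  rw [toReal_law_eq_sum hβ x (measurableSet_entersCell b)]
  have h1 : (C.law β y (O.entersCell i b)).toReal ≤
      (C.law β y (prepend x ⁻¹' O.entersCell i b)).toReal := by
    refine ENNReal.toReal_mono (measure_ne_top _ _) ?_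
    rw [C.law_congr β y (A := O.entersCell i b) (B := O.entersCell i b ∩ {ω | ω 0 = y})
      fun ω hω => ⟨fun h => ⟨h, hω⟩, fun h => h.1⟩]
    refine measure_mono fun ω hω => prepend_mem_entersCell_of_mem hx (Or.inr ⟨?_, hω.1⟩)
    exact (show ω 0 = y from hω.2) ▸ hy
  refine (mul_le_mul_of_nonneg_left h1 ((C.rev β).p_nonneg x y)).trans ?_
  exact Finset.single_le_sum (f := fun y => (C.rev β).p x y *
    (C.law β y (prepend x ⁻¹' O.entersCell i b)).toReal)
    (fun z _ => mul_nonneg ((C.rev β).p_nonneg x z) ENNReal.toReal_nonneg) (Finset.mem_univ y)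

theorem p_le_toReal_law_entersCell {β : ℝ} (hβ : 0 < β) {b x y : S} (hx : x ∈ O.nonAssigned i)
    (hy : y ∈ O.cell i b) : (C.rev β).p x y ≤ (C.law β x (O.entersCell i b)).toReal := by
  rw [toReal_law_eq_sum hβ x (measurableSet_entersCell b)]
  have h1 : C.law β y (prepend x ⁻¹' O.entersCell i b) = 1 :=
    C.law_univ_of_start β fun ω hω => prepend_mem_entersCell_of_mem hx (Or.inl (hω ▸ hy))
  have := Finset.single_le_sum (f := fun y => (C.rev β).p x y *
    (C.law β y (prepend x ⁻¹' O.entersCell i b)).toReal)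
    (fun z _ => mul_nonneg ((C.rev β).p_nonneg x z) ENNReal.toReal_nonneg) (Finset.mem_univ y)
  simpa [h1] using this

/-- Every descending step keeps a positive probability in the limit, so following the descent costs
only a constant factor. -/
theorem Downhill.eventually_le {b x : S} (h : O.Downhill i b x) (hx : x ∈ O.nonAssigned i)
    (hi : 1 ≤ i) (hb : b ∈ O.metaMinima i) :
    ∃ κ > 0, ∀ᶠ β in atTop, κ ≤ (C.law β x (O.entersCell i b)).toReal := by
  induction h with
  | mem h => exact (notMem_nonAssigned_of_mem_cell hi hb h hx).elim
  | @step x y hx' hadj hE hy ih =>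
    have hp : ∀ᶠ β in atTop, C.pLim x y / 2 ≤ (C.rev β).p x y :=
      (C.tendsto_rev_p x y).eventually (le_mem_nhds
        (by linarith [C.pLim_pos x y (Or.inr hadj) hE.le]))
    have hpos := C.pLim_pos x y (Or.inr hadj) hE.le
    by_cases hN : y ∈ O.nonAssigned i
    · obtain ⟨κ, hκ, h⟩ := ih hN
      refine ⟨C.pLim x y / 2 * κ, by positivity, ?_⟩
      filter_upwards [h, hp, eventually_gt_atTop 0] with β h1 h2 h3
      refine le_trans ?_ (p_mul_le_toReal_law_entersCell h3 hx' hN b)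
      gcongr
      exact (C.rev β).p_nonneg x y
    · cases hy with
      | mem hy =>
        refine ⟨C.pLim x y / 2, by positivity, ?_⟩
        filter_upwards [hp, eventually_gt_atTop 0] with β h2 h3
        exact h2.trans (p_le_toReal_law_entersCell h3 hx' hy)
      | step h => exact (hN h).elim

variable [Nonempty S]

/-- Climbing from the valley of `a` to a state above it costs at most the energy above `s_a`, up to
the escape probability from the valley. -/
theorem Downhill.eventually_ge {a x : S} (h : O.Downhill i a x) (hx : x ∈ O.nonAssigned i)
    (hi : 1 ≤ i) (ha : a ∈ O.metaMinima i) (hne : O.cell i a ≠ Set.univ) {η : ℝ} (hη : 0 < η)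
    (b : S) :
    ∃ κ > 0, ∀ᶠ β in atTop, κ * Real.exp (-β * (C.E x - C.E (O.exit i a) + η)) *
      (C.law β x (O.entersCell i b)).toReal ≤ (C.law β a (O.entersCell i b)).toReal := by
  have hN : (0 : ℝ) < Fintype.card S := by exact_mod_cast Fintype.card_pos
  induction h generalizing η with
  | mem h => exact (notMem_nonAssigned_of_mem_cell hi ha h hx).elim
  | @step x y hx' hadj hE hy ih =>
    by_cases hyN : y ∈ O.nonAssigned i
    · obtain ⟨κ, hκ, h⟩ := ih hyN (half_pos hη)
      refine ⟨κ, hκ, ?_⟩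
      filter_upwards [h, C.eventually_approx (half_pos hη)] with β h1 h2
      refine le_trans ?_ h1
      have h3 := p_mul_le_toReal_law_entersCell h2.pos hyN hx' b
      have h4 := h2.le_p y x hadj.symm
      rw [max_eq_left (by linarith)] at h4
      calc κ * Real.exp (-β * (C.E x - C.E (O.exit i a) + η)) *
            (C.law β x (O.entersCell i b)).toReal
          = κ * Real.exp (-β * (C.E y - C.E (O.exit i a) + η / 2)) *
            (Real.exp (-β * (C.E x - C.E y + η / 2)) *
              (C.law β x (O.entersCell i b)).toReal) := by
            rw [← mul_assoc, mul_assoc κ, mul_assoc κ, ← Real.exp_add]; ring_nf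
        _ ≤ κ * Real.exp (-β * (C.E y - C.E (O.exit i a) + η / 2)) *
            ((C.rev β).p y x * (C.law β x (O.entersCell i b)).toReal) := by gcongr
        _ ≤ _ := by gcongr
    · have hya : y ∈ O.cell i a := by
        cases hy with
        | mem hy => exact hy
        | step h => exact (hyN h).elim
      -- The first step out of the valley, from y to x: the exit probability at x is at least G(a,y)
      -- p(y,x), and by reversibility G(a,y) = (w(y)/w(a)) G(y,a). The three factors w(y)/w(a),
      -- G(y,a) and p(y,x) each lose η/3, and their exponents combine to -(E(x) - E(s_a)).
      have hη' : 0 < η / 3 := by positivity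
      have haa := self_mem_cell hi (Or.inl ha : a ∈ O.metastates i)
      have hxa : x ∉ O.cell i a := fun h => notMem_nonAssigned_of_mem_cell hi ha h hx'
      refine ⟨(2 * Fintype.card S : ℝ)⁻¹, by positivity, ?_⟩
      filter_upwards [eventually_le_green_bottom hi ha hne hya hη',
        C.eventually_approx hη'] with β h1 h2
      have h4 := h2.le_p y x hadj.symm
      rw [max_eq_left (by linarith)] at h4
      have hwa := (C.rev β).w_pos a
      have h5 : Real.exp (-β * (C.E y - C.E a + η / 3)) * (C.rev β).w a ≤ (C.rev β).w y := by
        have := h2.w_le a y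
        calc _ ≤ Real.exp (-β * (C.E y - C.E a + η / 3)) *
              ((C.rev β).w y * Real.exp (β * (C.E y - C.E a + η / 3))) := by gcongr
          _ = (C.rev β).w y * (Real.exp (-β * (C.E y - C.E a + η / 3)) *
              Real.exp (β * (C.E y - C.E a + η / 3))) := by ring
          _ = _ := by rw [← Real.exp_add]; simp
      have h6 : Real.exp (-β * (C.E y - C.E a + η / 3)) * (C.rev β).green (O.cell i a) y a ≤
          (C.rev β).green (O.cell i a) a y := by
        have hb := (C.rev β).green_balance (D := O.cell i a) a y
        have hg := (C.rev β).green_nonneg (D := O.cell i a) y a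
        have := mul_le_mul_of_nonneg_right h5 hg
        rw [← hb] at this
        refine le_of_mul_le_mul_left ?_ hwa
        linarith
      have h7 : (C.rev β).green (O.cell i a) a y * (C.rev β).p y x ≤
          (C.rev β).exitProb (O.cell i a) a x := by
        rw [(C.rev β).exitProb_of_mem haa hxa]
        exact Finset.single_le_sum (f := fun y => (C.rev β).green (O.cell i a) a y *
          (C.rev β).p y x) (fun z _ => mul_nonneg ((C.rev β).green_nonneg a z)
            ((C.rev β).p_nonneg z x)) (Finset.mem_univ y)
      have h8 : (C.rev β).exitProb (O.cell i a) a x * (C.law β x (O.entersCell i b)).toReal ≤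
          (C.law β a (O.entersCell i b)).toReal := by
        refine le_trans ?_ ((C.rev β).sum_exitProb_mul_le hne
          (f := fun z => (C.law β z (O.entersCell i b)).toReal)
          (fun z hz => (toReal_law_entersCell_eq_sum h2.pos
            (notMem_nonAssigned_of_mem_cell hi ha hz) b).le) haa)
        exact Finset.single_le_sum (f := fun w => (C.rev β).exitProb (O.cell i a) a w *
          (C.law β w (O.entersCell i b)).toReal) (fun z _ => mul_nonneg
            ((C.rev β).exitProb_nonneg a z) ENNReal.toReal_nonneg) (Finset.mem_univ x)
      refine le_trans ?_ h8
      gcongr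
      refine le_trans ?_ h7
      calc (2 * Fintype.card S : ℝ)⁻¹ * Real.exp (-β * (C.E x - C.E (O.exit i a) + η))
          = Real.exp (-β * (C.E y - C.E a + η / 3)) * ((2 * Fintype.card S : ℝ)⁻¹ *
              Real.exp (β * (C.E (O.exit i a) - C.E a - η / 3))) *
              Real.exp (-β * (C.E x - C.E y + η / 3)) := by
            rw [mul_left_comm, mul_assoc, mul_assoc, ← Real.exp_add, ← Real.exp_add]; ring_nf
        _ ≤ Real.exp (-β * (C.E y - C.E a + η / 3)) * (C.rev β).green (O.cell i a) y a *
              (C.rev β).p y x := by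
          gcongr
          exact mul_nonneg (Real.exp_pos _).le ((C.rev β).green_nonneg y a)
        _ ≤ _ := by
          gcongr
          exact (C.rev β).p_nonneg y x

/-- The pair from `exists_downhill_pair` is used: climbing to x costs E(x) - E(s_a), crossing to y
at most h(a,b) - E(x), and the descent into b only a constant. -/
theorem exists_eventually_le_valleyTransition (hi : 1 ≤ i)
    (hne : ∀ m ∈ O.metaMinima i, O.cell i m ≠ Set.univ) {A : Set S} (hA : A.Nonempty)
    (hAM : A ⊂ O.metaMinima i) : ∃ a ∈ A, ∃ b ∈ O.metaMinima i \ A, ∀ η > 0, ∃ κ > 0,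
      ∀ᶠ β in atTop, ENNReal.ofReal
        (κ * Real.exp (-β * (C.height a b - C.E (O.exit i a) + η))) ≤
          O.valleyTransition i β a b := by
  obtain ⟨a, ha, b, hb, x, hx, y, hy, hax, hby, hxy, hEx, hEy⟩ := exists_downhill_pair hi hA
    (Set.nonempty_of_ssubset hAM) Set.disjoint_sdiff_right (Set.union_sdiff_cancel hAM.1)
  have ha' := hAM.1 ha
  refine ⟨a, ha, b, hb, fun η hη => ?_⟩
  obtain ⟨κ, hκ, h⟩ := hby.eventually_le hy hi hb.1
  obtain ⟨κ', hκ', h'⟩ := hax.eventually_ge hx hi ha' (hne a ha') (half_pos hη) b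
  refine ⟨κ' * κ, by positivity, ?_⟩
  filter_upwards [h, h', C.eventually_approx (half_pos hη)] with β h1 h2 h3
  rw [valleyTransition_eq hi β ha' hb.1]
  refine ENNReal.ofReal_le_of_le_toReal (le_trans ?_ h2)
  have h4 : Real.exp (-β * (C.height a b - C.E x + η / 2)) * κ ≤
      (C.law β x (O.entersCell i b)).toReal := by
    have hβ := h3.pos
    rcases hxy with rfl | hxy
    · refine le_trans (mul_le_of_le_one_left hκ.le ?_) h1
      rw [Real.exp_le_one_iff]
      nlinarith
    · refine le_trans ?_ (p_mul_le_toReal_law_entersCell hβ hx hy b)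
      refine mul_le_mul (le_trans ?_ (h3.le_p x y hxy)) h1 hκ.le ((C.rev β).p_nonneg x y)
      rw [Real.exp_le_exp]
      have : max (C.E y - C.E x) 0 ≤ C.height a b - C.E x :=
        max_le (by linarith) (by linarith)
      nlinarith
  calc κ' * κ * Real.exp (-β * (C.height a b - C.E (O.exit i a) + η))
      = κ' * Real.exp (-β * (C.E x - C.E (O.exit i a) + η / 2)) *
        (Real.exp (-β * (C.height a b - C.E x + η / 2)) * κ) := by
        rw [show -β * (C.height a b - C.E (O.exit i a) + η) =
          -β * (C.E x - C.E (O.exit i a) + η / 2) + -β * (C.height a b - C.E x + η / 2) by ring,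
          Real.exp_add]
        ring
    _ ≤ _ := by gcongr

/-- The defining inequality is tested on the escape from A that is known not to be too unlikely; the
competing probability inside A is at most one, so the liminf is at most h(a,b) - E(s_a). -/
theorem ReciprocatingJumps.exists_le (hi : 1 ≤ i)
    (hne : ∀ m ∈ O.metaMinima i, O.cell i m ≠ Set.univ) {δ : ℝ} (h : O.ReciprocatingJumps i δ) :
    ∃ a ∈ O.metaMinima i, ∃ b ∈ O.metaMinima i, b ≠ a ∧
      δ ≤ C.height a b - C.E (O.exit i a) := by
  obtain ⟨A, hA, hAM, hrec⟩ := h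
  obtain ⟨a, ha, b, hb, hlow⟩ := exists_eventually_le_valleyTransition hi hne hA hAM
  refine ⟨a, hAM.1 ha, b, hb.1, fun h => hb.2 (h ▸ ha), ?_⟩
  obtain ⟨c, -, hc⟩ := hrec a ha
  have hlim := hc b hb
  refine le_of_forall_pos_le_add fun η hη => ?_
  obtain ⟨κ, hκ, hev⟩ := hlow (η / 2) (half_pos hη)
  set e : ℝ := C.height a b - C.E (O.exit i a) with he
  have hκ0 : Tendsto (fun β : ℝ => -Real.log κ / β) atTop (𝓝 0) :=
    tendsto_const_nhds.div_atTop tendsto_id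
  have hle : liminf (fun β : ℝ => ((1 / β : ℝ) : EReal) *
      (ENNReal.log (O.valleyTransition i β a c) -
        ENNReal.log (O.valleyTransition i β a b))) atTop ≤ ((e + η : ℝ) : EReal) := by
    refine liminf_le_of_frequently_le' (Eventually.frequently ?_)
    filter_upwards [hev, hκ0.eventually (ge_mem_nhds (half_pos hη)), eventually_gt_atTop 0]
      with β h1 h2 hβ
    have h3 : ENNReal.log (O.valleyTransition i β a c) ≤ 0 :=
      ENNReal.log_le_zero_iff.2 prob_le_one
    have h4 : ((Real.log (κ * Real.exp (-β * (e + η / 2))) : ℝ) : EReal) ≤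
        ENNReal.log (O.valleyTransition i β a b) := by
      rw [← ENNReal.log_ofReal_of_pos (by positivity)]
      exact ENNReal.log_monotone h1
    rw [Real.log_mul hκ.ne' (Real.exp_ne_zero _), Real.log_exp] at h4
    calc ((1 / β : ℝ) : EReal) * (ENNReal.log (O.valleyTransition i β a c) -
          ENNReal.log (O.valleyTransition i β a b))
        ≤ ((1 / β : ℝ) : EReal) * (0 - ((Real.log κ + -β * (e + η / 2) : ℝ) : EReal)) := by
          refine mul_le_mul_of_nonneg_left (EReal.sub_le_sub h3 h4) ?_
          exact_mod_cast (one_div_pos.2 hβ).le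
      _ = ((1 / β * (0 - (Real.log κ + -β * (e + η / 2))) : ℝ) : EReal) := by norm_cast
      _ ≤ _ := by
          refine EReal.coe_le_coe_iff.2 ?_
          have : 1 / β * (0 - (Real.log κ + -β * (e + η / 2))) =
              -Real.log κ / β + (e + η / 2) := by
            field_simp
            ring
          rw [this]
          linarith
  exact EReal.coe_le_coe_iff.1 (hlim.trans hle)

end EntersCell

end MinimaOrder

end EnergyChain

/-! ### Metabasins: threshold energy and assembly of the theorem. -/

namespace EnergyChain

variable {S : Type*} [Fintype S] {C : EnergyChain S}

namespace MinimaOrder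

variable {O : C.MinimaOrder} {i : ℕ} {ε : ℝ}

theorem m_n_mem_metaMinima (hn : 1 ≤ O.n) : O.m O.n ∈ O.metaMinima i := by
  refine ⟨O.n, hn, le_rfl, rfl, ?_⟩
  have : O.mergeLevel O.n = ⊤ := by
    rw [mergeLevel, sInf_eq_top]
    rintro k ⟨k', -, h1, h2, -⟩
    omega
  rw [this]
  exact ENat.natCast_lt_top i

variable [Nonempty S]

/-- (MB2) supplies an unmerged minimum other than a given one; for a non-assigned r the last
minimum, which never merges, lies outside the cell. -/
theorem HasMetabasins.cell_ne_univ (h : O.HasMetabasins i ε) {r : S} (hr : r ∈ O.metastates i) :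
    O.cell i r ≠ Set.univ := by
  have hi := h.level_pos
  intro hu
  rcases hr with hr | hr
  · obtain ⟨m, hm, -, -, hne, -⟩ := h.mb2 r hr
    have hm' : m ∈ O.cell i r := hu ▸ Set.mem_univ m
    exact hne (cell_unique hi (Or.inl hm) (Or.inl hr) (self_mem_cell hi (Or.inl hm)) hm')
  · have hn := h.level_lt
    have hm := m_n_mem_metaMinima (O := O) (i := i) (by omega)
    have hm' : O.m O.n ∈ O.cell i r := hu ▸ Set.mem_univ _
    exact metaMinima_notMem_nonAssigned hi hm
      (cell_unique hi (Or.inl hm) (Or.inr hr) (self_mem_cell hi (Or.inl hm)) hm' ▸ hr)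

/-- The threshold is the largest exit energy, attained at m₁. Since the saddle of m and m₁ is
symmetric, E(s_{m₁}) ≤ h(m,m₁) ≤ E(s_m) + ε, so all exit energies lie within ε of it; the saddles
follow from E(s_m) ≤ h(m,m') ≤ E(s_m) + ε. -/
theorem HasMetabasins.exists_threshold (h : O.HasMetabasins i ε) (hε : 0 < ε) :
    ∃ E₀ : ℝ, ∀ m ∈ O.metaMinima i,
      (E₀ - ε ≤ C.E (O.exit i m) ∧ C.E (O.exit i m) ≤ E₀ + ε) ∧
      ∀ m' ∈ O.metaMinima i, m' ≠ m →
        E₀ - ε ≤ C.E (C.saddle m m') ∧ C.E (C.saddle m m') ≤ E₀ + ε := by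
  classical
  have hi := h.level_pos
  have hlow : ∀ m ∈ O.metaMinima i, ∀ m' ∈ O.metaMinima i, m' ≠ m →
      C.E (O.exit i m) ≤ C.E (C.saddle m m') := fun m hm m' hm' hne =>
    exit_le_height hi hm (self_mem_cell hi (Or.inl hm)) fun hmem => hne
      (cell_unique hi (Or.inl hm') (Or.inl hm) (self_mem_cell hi (Or.inl hm')) hmem)
  obtain ⟨m₁, hm₁, hmax⟩ := Finset.exists_max_image
    (Finset.univ.filter (· ∈ O.metaMinima i)) (fun m => C.E (O.exit i m))
    ⟨O.m O.n, by simpa using m_n_mem_metaMinima (by have := h.level_lt; omega)⟩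
  simp only [Finset.mem_filter, Finset.mem_univ, true_and] at hm₁ hmax
  have hclose : ∀ m ∈ O.metaMinima i, C.E (O.exit i m₁) - ε ≤ C.E (O.exit i m) := by
    intro m hm
    by_cases he : m = m₁
    · rw [he]; linarith
    · have h1 := h.mb1 m hm m₁ hm₁ (Ne.symm he)
      have h2 := hlow m₁ hm₁ m hm he
      have h3 : C.E (C.saddle m m₁) = C.E (C.saddle m₁ m) := height_comm m m₁
      linarith
  refine ⟨C.E (O.exit i m₁), fun m hm => ⟨⟨hclose m hm, ?_⟩, fun m' hm' hne => ⟨?_, ?_⟩⟩⟩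
  · linarith [hmax m hm]
  · linarith [hclose m hm, hlow m hm m' hm' hne]
  · linarith [hmax m hm, h.mb1 m hm m' hm' hne]

variable [MeasurableSpace S] [MeasurableSingletonClass S]

theorem tendsto_cond_history (hi : 1 ≤ i) (hne : ∀ r ∈ O.metastates i, O.cell i r ≠ Set.univ)
    {s : S} (hs : s ∈ O.metastates i) (x₀ : S) (k : ℕ) (y : ℕ → S) (hy : y k ∈ O.metastates i)
    (h0 : ∀ β > 0, C.law β x₀ {ω | ∀ j ≤ k, O.accelerated i j ω = y j} ≠ 0) :
    Tendsto (fun β => ((C.law β x₀)[{ω | O.accelerated i (k + 1) ω = s} |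
      {ω | ∀ j ≤ k, O.accelerated i j ω = y j}]).toReal) atTop (𝓝 (O.jumpProb i (y k) s)) := by
  classical
  rw [tendsto_iff_dist_tendsto_zero]
  refine squeeze_zero' (g := fun β => ∑ x, if x ∈ O.cell i (y k) then
    |(C.law β x {ω | O.accelerated i 1 ω = s}).toReal - O.jumpProb i (y k) s| else 0)
    (Eventually.of_forall fun β => dist_nonneg) ?_ ?_
  · filter_upwards [eventually_gt_atTop 0] with β hβ
    rw [Real.dist_eq]
    refine (abs_cond_sub_le hi hne hβ x₀ s k y hy (h0 β hβ) _).trans (le_of_eq ?_)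
    exact Finset.sum_congr rfl fun x _ => if_congr Iff.rfl rfl rfl
  · rw [← Finset.sum_const_zero (s := (Finset.univ : Finset S))]
    refine tendsto_finsetSum _ fun x _ => ?_
    by_cases hx : x ∈ O.cell i (y k)
    · simp only [hx, if_true]
      simpa [Real.dist_eq] using tendsto_iff_dist_tendsto_zero.1
        (tendsto_law_accelerated_one hi hy hs (hne _ hy) hx)
    · simp [hx]

theorem tendsto_cond_entrance (hi : 1 ≤ i) (hne : ∀ r ∈ O.metastates i, O.cell i r ≠ Set.univ)
    {r s : S} (hr : r ∈ O.metastates i) (hs : s ∈ O.metastates i) (x₀ : S) (k : ℕ) (y : ℕ → S)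
    {x : S} (hx : x ∈ O.cell i r) (h0 : ∀ β > 0, C.law β x₀
      {ω | (∀ j ≤ k, O.accelerated i j ω = y j) ∧ O.entrance i k ω = x} ≠ 0) :
    Tendsto (fun β => ((C.law β x₀)[{ω | O.accelerated i (k + 1) ω = s} |
      {ω | (∀ j ≤ k, O.accelerated i j ω = y j) ∧ O.entrance i k ω = x}]).toReal) atTop
      (𝓝 (O.jumpProb i r s)) := by
  refine (tendsto_law_accelerated_one hi hr hs (hne r hr) hx).congr' ?_
  filter_upwards [eventually_gt_atTop 0] with β hβ
  rw [cond_entrance_eq hi hne hβ x₀ x s k y (h0 β hβ)]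

end MinimaOrder

end EnergyChain

theorem mainTheorem1 {S : Type*} [Fintype S] [Nonempty S] [MeasurableSpace S]
    [MeasurableSingletonClass S] (C : EnergyChain S) (O : C.MinimaOrder) (i : ℕ) (ε : ℝ)
    (hε : 0 < ε) (hMB : O.HasMetabasins i ε) :
    -- (1) transition probabilities do not depend on the point of entrance
    (∀ r ∈ O.metastates i, ∀ s ∈ O.metastates i,
      (∀ x ∈ O.cell i r,
        Tendsto (fun β => (C.law β x {ω | O.accelerated i 1 ω = s}).toReal) atTop
          (𝓝 (O.jumpProb i r s))) ∧
      ∀ (x₀ : S) (k : ℕ) (y : ℕ → S), y k = r →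
        ((∀ β > 0, C.law β x₀ {ω | ∀ j ≤ k, O.accelerated i j ω = y j} ≠ 0) →
          Tendsto (fun β => ((C.law β x₀)[{ω | O.accelerated i (k + 1) ω = s} |
              {ω | ∀ j ≤ k, O.accelerated i j ω = y j}]).toReal) atTop
            (𝓝 (O.jumpProb i r s))) ∧
        ∀ x ∈ O.cell i r,
          (∀ β > 0, C.law β x₀
            {ω | (∀ j ≤ k, O.accelerated i j ω = y j) ∧ O.entrance i k ω = x} ≠ 0) →
          Tendsto (fun β => ((C.law β x₀)[{ω | O.accelerated i (k + 1) ω = s} |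
              {ω | (∀ j ≤ k, O.accelerated i j ω = y j) ∧ O.entrance i k ω = x}]).toReal) atTop
            (𝓝 (O.jumpProb i r s))) ∧
    -- (2) no reciprocating jumps
    ((∀ δ > ε, ¬ O.ReciprocatingJumps i δ) ∧
      ((∀ m ∈ O.metaMinima i, ∀ m' ∈ O.metaMinima i, m' ≠ m →
          C.E (C.saddle m m') - C.E (O.exit i m) < ε) →
        ¬ O.ReciprocatingJumps i ε)) ∧
    -- (3) the expected residence time depends on the energies only via the depth
    ((∀ m ∈ O.metaMinima i, ∀ r ∈ O.cell i m,
        (∀ β > 0, ∫⁻ ω, (O.firstExit i ω : ℝ≥0∞) ∂(C.law β r) ≠ ⊤) ∧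
        Tendsto (fun β => 1 / β *
            Real.log (∫⁻ ω, (O.firstExit i ω : ℝ≥0∞) ∂(C.law β r)).toReal) atTop
          (𝓝 (C.E (O.exit i m) - C.E m))) ∧
      ∀ s ∈ O.nonAssigned i,
        (∀ β > 0, ∫⁻ ω, (O.jumpTime i 1 ω : ℝ≥0∞) ∂(C.law β s) ≠ ⊤) ∧
        Tendsto (fun β => 1 / β *
            Real.log (∫⁻ ω, (O.jumpTime i 1 ω : ℝ≥0∞) ∂(C.law β s)).toReal) atTop (𝓝 0)) ∧
    -- (4) trap model: up to `ε`, all barriers have the same height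
    (∃ E₀ : ℝ, ∀ m ∈ O.metaMinima i,
      (E₀ - ε ≤ C.E (O.exit i m) ∧ C.E (O.exit i m) ≤ E₀ + ε) ∧
      ∀ m' ∈ O.metaMinima i, m' ≠ m →
        E₀ - ε ≤ C.E (C.saddle m m') ∧ C.E (C.saddle m m') ≤ E₀ + ε) := by
  have hi := hMB.level_pos
  have hne : ∀ r ∈ O.metastates i, O.cell i r ≠ Set.univ := fun r hr => hMB.cell_ne_univ hr
  have hne' : ∀ m ∈ O.metaMinima i, O.cell i m ≠ Set.univ := fun m hm => hne m (Or.inl hm)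
  refine ⟨fun r hr s hs => ⟨fun x hx =>
      EnergyChain.MinimaOrder.tendsto_law_accelerated_one hi hr hs (hne r hr) hx,
    fun x₀ k y hy => ⟨fun h0 => ?_, fun x hx h0 =>
      EnergyChain.MinimaOrder.tendsto_cond_entrance hi hne hr hs x₀ k y hx h0⟩⟩,
    ⟨fun δ hδ h => ?_, fun hlt h => ?_⟩,
    ⟨fun m hm r hr => ⟨fun β hβ => ?_, ?_⟩, fun s hs => ⟨fun β hβ => ?_, ?_⟩⟩,
    hMB.exists_threshold hε⟩
  · exact hy ▸ EnergyChain.MinimaOrder.tendsto_cond_history hi hne hs x₀ k y (hy ▸ hr) h0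
  · obtain ⟨a, ha, b, hb, hab, hle⟩ := h.exists_le hi hne'
    exact (hδ.trans_le (hle.trans (hMB.mb1 a ha b hb hab))).false
  · obtain ⟨a, ha, b, hb, hab, hle⟩ := h.exists_le hi hne'
    exact (hle.trans_lt (hlt a ha b hb hab)).false
  · rw [EnergyChain.MinimaOrder.lintegral_firstExit hi hm (hne' m hm) hβ hr]
    exact ENNReal.ofReal_ne_top
  · refine (EnergyChain.MinimaOrder.tendsto_log_sum_green hi hm (hne' m hm) hr).congr' ?_
    filter_upwards [eventually_gt_atTop 0] with β hβ
    rw [EnergyChain.MinimaOrder.lintegral_firstExit hi hm (hne' m hm) hβ hr,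
      ENNReal.toReal_ofReal (Finset.sum_nonneg fun y _ => (C.rev β).green_nonneg r y)]
  · rw [EnergyChain.MinimaOrder.lintegral_jumpTime_one hi (Or.inr hs) (hne s (Or.inr hs)) hβ
      (EnergyChain.MinimaOrder.self_mem_cell hi (Or.inr hs))]
    exact ENNReal.ofReal_ne_top
  · have hs' := hne s (Or.inr hs)
    have hc := EnergyChain.MinimaOrder.cell_nonAssigned hi hs
    refine (EnergyChain.MinimaOrder.tendsto_log_sum_green_singleton hi hs (hc ▸ hs')).congr' ?_
    filter_upwards [eventually_gt_atTop 0] with β hβ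
    rw [EnergyChain.MinimaOrder.lintegral_jumpTime_one hi (Or.inr hs) hs' hβ
      (EnergyChain.MinimaOrder.self_mem_cell hi (Or.inr hs)), hc,
      ENNReal.toReal_ofReal (Finset.sum_nonneg fun y _ => (C.rev β).green_nonneg s y)]
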